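/- Notation. Let $X=\mathbb Z\varpi_1\oplus\mathbb Z\varpi_2$ be the weight lattice of $Sp_4$, with positive roots $\alpha_1=2\varpi_1-\varpi_2$, $\alpha_2=-2\varpi_1+2\varpi_2$, $\alpha_{12}=2\alpha_1+\alpha_2$, $\alpha_{21}=\alpha_1+\alpha_2$, positive coroots $\alpha_1^\vee,\alpha_2^\vee$ (dual to $\varpi_1,\varpi_2$), $\alpha_{12}^\vee=\alpha_1^\vee+\alpha_2^\vee$, $\alpha_{21}^\vee=\alpha_1^\vee+2\alpha_2^\vee$, and $\rho^\vee=\tfrac32\alpha_1^\vee+2\alpha_2^\vee$. Write $\mu=\mu_1\varpi_1+\mu_2\varpi_2$. *Crystals.* For dominant $\lambda$ let $\mathcal B(\lambda)$ be the crystal of highest weight $\lambda$ with highest weight element $v_\lambda$, operators $e_i,f_i$, and $\varepsilon_i,\phi_i$ ($i=1,2$); $s_i$ acts on it by reversing $f_i$-strings, $f_{12}=s_1f_2s_1$, and $\phi_{12}(T)=\max\{n: f_{12}^n(T)\ne0\}$. The string $\mathrm{str}_2(T)=(a,b,c,d)$ is obtained by applying $e_2,e_1,e_2,e_1$ to $T$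 successively, each as often as possible, so that $T=f_2^af_1^bf_2^cf_1^dv_\lambda$. Let $\Phi:\mathcal B(\lambda)\to\mathcal B(\lambda+2\varpi_1)$ be the embedding that adds $(0,1,1,1)$ to $\mathrm{str}_2$. The principal preatom is $\mathcal P(\lambda)=\mathcal B(\lambda)\setminus\Phi(\mathcal B(\lambda-2\varpi_1))$ if $\lambda_1\ge2$ and $\mathcal P(\lambda)=\mathcal B(\lambda)$ if $\lambda_1\le1$. For $T\in\mathcal P(\lambda)$ with $\mathrm{str}_2(T)=(a,b,c,d)$ let $\Psi(T)\in\mathcal P(\lambda+\varpi_2)$ have string $(a,b+1,c+1,d)$ if $d\in\{0,\lambda_1\}$ and $(a,b,c+1,d+1)$ otherwise; let $\bar\Psi(T)=\Psi(T)$ if $\mathrm{wt}(T)_1\le0$ and $\bar\Psi(T)=s_1\Psi(s_1T)$ otherwise. For $T\in\mathcal B(\lambda')$ let $p=\mathrm{pat}(T)$ be the maximal $p$ with $T\in\mathrm{Im}(\Phi^p)$ and put $\lambda=\lambda'-2p\varpi_1$, so that $T=\Phi^p(U)$ with $U\in\mathcal P(\lambda)$. The atomic number $A=\mathrm{at}(T)$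 is the maximal $A$ such that $U$ lies in the image of $\bar\Psi^A:\mathcal P(\lambda-A\varpi_2)\to\mathcal P(\lambda)$. *Bruhat graphs.* For an affine coroot $\beta^\vee+M\delta$ with $\beta$ a positive root, $s_{\beta^\vee+M\delta}(\mu)=\mu-(\langle\mu,\beta^\vee\rangle-M)\beta$. The Bruhat order $\le$ on $X$ is generated by $s_{\beta^\vee+M\delta}(\mu)<\mu$ whenever $\langle\mu,\beta^\vee\rangle>M\ge0$ or $\langle\mu,\beta^\vee\rangle<M<0$. Let $\widehat\phi_i(\mu,\lambda)$ be the maximal integer $k$ with $\mu-k\alpha_i\le\lambda$. The graph $\Gamma_\lambda$ has vertices $\{\mu\le\lambda\}$ and an edge $\mu\to\nu$ whenever $\mu<\nu$ and $\nu-\mu\in\mathbb Z\beta$ for a positive root $\beta$; its label is $m\delta-\beta^\vee$ with $m=-\tfrac12\langle\mu+\nu,\beta^\vee\rangle$. Let $y_m$ be the product of the first $m$ letters of the infinite reduced word $(s_0s_2s_1s_2)(s_0s_2s_1s_2)\cdots$ in the affine Weyl group (with $\alpha_0^\vee=\delta-\alpha_{21}^\vee$), $N(y_m)$ its inversion set,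 $N(y_\infty)=\bigcup_mN(y_m)$, and $t_{m+1}$ the reflection whose root is the element of $N(y_{m+1})\setminus N(y_m)$. For $m\in\mathbb N\cup\{\infty\}$ let $\Gamma^m_\lambda$ be $\Gamma_\lambda$ with all arrows with label in $N(y_m)$ inverted, and let $\ell_m(\mu,\lambda)$ be the number of arrows pointing to $\mu$ in $\Gamma_\lambda^m$. An edge $\mu\to t_{m+1}\mu$ of $\Gamma_\lambda$ is swappable if $\ell_m(\mu,\lambda)=\ell_m(t_{m+1}\mu,\lambda)-1$ and non-swappable otherwise; $E^S(\lambda)$ and $E^N(\lambda)$ are the sets of swappable and non-swappable edges of this form. Let $\mathcal N_\infty(\mu,\lambda)$ be the number of edges in $E^N(\lambda)$ starting at $\mu$. Let $\widehat{\mathcal D}_\infty(\mu,\lambda)$ be the largest $a\ge0$ for which there are a positive root $\alpha$ and an integer $n\ge0$ with $(\mu\to\mu-(n+i)\alpha)\in E^N(\lambda+i\varpi_2)$ for $1\le i\le a$ and with $n=0$ or $(\mu\to\mu-n\alpha)\in E^S(\lambda)$; put $\mathcal D_\infty(\mu,\lambda,k)=\min(k,\widehat{\mathcal D}_\infty(\mu,\lambda-k\varpi_2))$.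 *Statistics.* Let $\ell^1(\mu)$ be the number of $\nu<\mu$ with $\nu-\mu\in\mathbb Z\alpha_1$. For $T\in\mathcal B(\lambda')$ with $p,\lambda,A$ as above and $\mu=\mathrm{wt}(T)$ put $$r_\infty(T)=-\ell_\infty(\mu,\lambda-A\varpi_2)+\mathcal N_\infty(\mu,\lambda-A\varpi_2)-\mathcal D_\infty(\mu,\lambda,A)-A-2p+\langle\lambda',\rho^\vee\rangle,$$ $$r_P(T)=-\langle\mathrm{wt}(T),\rho^\vee\rangle+\phi_1(T)-\ell^1(\mathrm{wt}(T)).$$ **Proposition.** Let $\lambda'$ be dominant, $T\in\mathcal B(\lambda')$, $p=\mathrm{pat}(T)$, $\lambda=\lambda'-2p\varpi_1$, $A=\mathrm{at}(T)$ and $\mu=\mathrm{wt}(T)$ (so $p=0$ and $\lambda=\lambda'$ if $T$ lies in the principal preatom $\mathcal P(\lambda')$). If $\mu_1\le0$, then $$\phi_2(T)=\widehat\phi_2(\mu,\lambda-A\varpi_2),$$ $$\phi_{12}(T)=\widehat\phi_{12}(\mu,\lambda-A\varpi_2)-\mathcal N_\infty(\mu,\lambda-A\varpi_2)+\mathcal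 D_\infty(\mu,\lambda,A).$$ Moreover $r_\infty(T)=r_P(T)$, for every $T\in\mathcal B(\lambda')$, without assumption on $\mu_1$. -/

import Mathlib

namespace SpFour

/-! ### Weights, roots and coroots of type `C₂` -/

/-- The weight lattice `X`; `(a, b)` is the weight `a ϖ₁ + b ϖ₂`. -/
abbrev Weight := ℤ × ℤ

def varpi1 : Weight := (1, 0)

def varpi2 : Weight := (0, 1)

def Dominant (lam : Weight) : Prop := 0 ≤ lam.1 ∧ 0 ≤ lam.2

/-- The positive roots `α₁`, `α₂`, `α₁₂ = 2α₁ + α₂`, `α₂₁ = α₁ + α₂`. -/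
inductive PosRoot
  | a1 | a2 | a12 | a21
  deriving DecidableEq

namespace PosRoot

/-- The root as a weight: `α₁ = 2ϖ₁ - ϖ₂`, `α₂ = -2ϖ₁ + 2ϖ₂`. -/
def vec : PosRoot → Weight
  | a1 => (2, -1)
  | a2 => (-2, 2)
  | a12 => (2, 0)
  | a21 => (0, 1)

/-- Coordinates of the coroot in the basis `α₁^∨, α₂^∨`:
`α₁₂^∨ = α₁^∨ + α₂^∨`, `α₂₁^∨ = α₁^∨ + 2α₂^∨`. -/
def coroot : PosRoot → ℤ × ℤ
  | a1 => (1, 0)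
  | a2 => (0, 1)
  | a12 => (1, 1)
  | a21 => (1, 2)

/-- The pairing `⟨μ, β^∨⟩`. -/
def pair (β : PosRoot) (μ : Weight) : ℤ := β.coroot.1 * μ.1 + β.coroot.2 * μ.2

end PosRoot

/-- `⟨μ, ρ^∨⟩` with `ρ^∨ = (3/2) α₁^∨ + 2 α₂^∨` (half an integer in general). -/
def rhoPair (μ : Weight) : ℚ := 3 / 2 * (μ.1 : ℚ) + 2 * (μ.2 : ℚ)

/-! ### Crystals: words in the vector representation

`B(λ)` is realised as the connected component of the highest weight word `1^{λ₁} (12)^{λ₂}` in a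
tensor power of the crystal `1 → 2 → 2̄ → 1̄` of the vector representation of `Sp₄`; its elements
are the reading words of the Kashiwara–Nakashima tableaux of shape `λ`. -/

/-- The alphabet `1 < 2 < 2̄ < 1̄`. -/
inductive Letter
  | one | two | twoBar | oneBar
  deriving DecidableEq

abbrev Word := List Letter

/-- The nodes of the Dynkin diagram. -/
inductive Node
  | n1 | n2
  deriving DecidableEq

namespace Letter

def wt : Letter → Weight
  | one => (1, 0)
  | two => (-1, 1)
  | twoBar => (1, -1)
  | oneBar => (-1, 0)

/-- The arrow `x → f_i x` of the vector representation; `f_i x ≠ 0` says that `x` is labelled `+`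
for `i`. -/
def lower : Node → Letter → Option Letter
  | .n1, one => some two
  | .n1, twoBar => some oneBar
  | .n2, two => some twoBar
  | _, _ => none

/-- The arrow `x → e_i x`; `e_i x ≠ 0` says that `x` is labelled `-` for `i`. -/
def raise : Node → Letter → Option Letter
  | .n1, two => some one
  | .n1, oneBar => some twoBar
  | .n2, twoBar => some two
  | _, _ => none

end Letter

def wt (w : Word) : Weight := (w.map Letter.wt).sum

/-- The number of `-` labels left in the `i`-signature, i.e. after every `+` has been cancelled
with the first available `-` to its right. -/
def minusCount (i : Node) : Word → ℕ
  | [] => 0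
  | x :: w =>
    if (x.lower i).isSome then minusCount i w - 1
    else if (x.raise i).isSome then minusCount i w + 1
    else minusCount i w

/-- `f_i` lowers the letter carrying the left-most uncancelled `+` of the `i`-signature;
`none` stands for `0`. -/
def f (i : Node) : Word → Option Word
  | [] => none
  | x :: w =>
    match x.lower i with
    | some y => if minusCount i w = 0 then some (y :: w) else (f i w).map (x :: ·)
    | none => (f i w).map (x :: ·)

/-- `e_i` raises the letter carrying the right-most uncancelled `-` of the `i`-signature;
`none` stands for `0`. In `x :: w` with `x` labelled `+`, the first uncancelled `-` of `w`
is cancelled by `x`. -/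
def e (i : Node) : Word → Option Word
  | [] => none
  | x :: w =>
    match x.raise i with
    | some y => if minusCount i w = 0 then some (y :: w) else (e i w).map (x :: ·)
    | none =>
      if (x.lower i).isSome ∧ minusCount i w ≤ 1 then none else (e i w).map (x :: ·)

/-- The `n`-th power of a partially defined operator. -/
def iter (g : Word → Option Word) : ℕ → Word → Option Word
  | 0, T => some T
  | n + 1, T => (iter g n T).bind g

/-- The maximal `n` with `g ^ n T ≠ 0`. -/
noncomputable def maxPow (g : Word → Option Word) (T : Word) : ℕ :=
  sSup {n : ℕ | iter g n T ≠ none}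

/-- `ε_i`. -/
noncomputable def eps (i : Node) (T : Word) : ℕ := maxPow (e i) T

/-- `φ_i`. -/
noncomputable def phi (i : Node) (T : Word) : ℕ := maxPow (f i) T

/-- The action of the simple reflection `s_i`: reversal of the `f_i`-string. -/
noncomputable def refl (i : Node) (T : Word) : Option Word :=
  if phi i T ≤ eps i T then iter (e i) (eps i T - phi i T) T
  else iter (f i) (phi i T - eps i T) T

/-- The modified crystal operator `f₁₂ = s₁ f₂ s₁`. -/
noncomputable def f12 (T : Word) : Option Word :=
  ((refl .n1 T).bind (f .n2)).bind (refl .n1)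

/-- `φ₁₂`. -/
noncomputable def phi12 (T : Word) : ℕ := maxPow f12 T

/-- The highest weight word of weight `λ`. -/
def highest (lam : Weight) : Word :=
  List.replicate lam.1.toNat Letter.one ++
    (List.replicate lam.2.toNat [Letter.one, Letter.two]).flatten

/-- The crystal `B(λ)` (empty unless `λ` is dominant). -/
def crystal (lam : Weight) : Set Word :=
  {T | Dominant lam ∧
    Relation.ReflTransGen (fun U V => ∃ i, f i U = some V) (highest lam) T}

/-! ### Adapted strings for `s₂s₁s₂s₁`, preatoms and atoms -/

/-- The end `e_i^{ε_i(T)} T` of the `i`-string of `T` (the default value is never used). -/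
noncomputable def top (i : Node) (T : Word) : Word := (iter (e i) (eps i T) T).getD T

/-- The adapted string `str₂(T) = (a, b, c, d)`: one applies `e₂`, `e₁`, `e₂`, `e₁` to `T`, each
as often as possible. -/
noncomputable def str (T : Word) : ℕ × ℕ × ℕ × ℕ :=
  let T₁ := top .n2 T
  let T₂ := top .n1 T₁
  let T₃ := top .n2 T₂
  (eps .n2 T, eps .n1 T₁, eps .n2 T₂, eps .n1 T₃)

/-- `f₂^a f₁^b f₂^c f₁^d v_λ`. -/
def ofString (lam : Weight) (s : ℕ × ℕ × ℕ × ℕ) : Option Word :=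
  (((iter (f .n1) s.2.2.2 (highest lam)).bind (iter (f .n2) s.2.2.1)).bind
    (iter (f .n1) s.2.1)).bind (iter (f .n2) s.1)

/-- The embedding of crystals `Φ : B(λ) → B(λ + 2ϖ₁)`, which adds `(0, 1, 1, 1)` to the string. -/
noncomputable def Phi (lam : Weight) (T : Word) : Option Word :=
  ofString (lam + 2 • varpi1)
    ((str T).1, (str T).2.1 + 1, (str T).2.2.1 + 1, (str T).2.2.2 + 1)

/-- `Φ^p : B(λ) → B(λ + 2pϖ₁)`. -/
noncomputable def PhiPow (lam : Weight) : ℕ → Word → Option Word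
  | 0, T => some T
  | p + 1, T => (PhiPow lam p T).bind (Phi (lam + (2 * p) • varpi1))

/-- The principal preatom `P(λ) ⊆ B(λ)`. -/
def principalPreatom (lam : Weight) : Set Word :=
  {T ∈ crystal lam | 2 ≤ lam.1 →
    ¬ ∃ U ∈ crystal (lam - 2 • varpi1), Phi (lam - 2 • varpi1) U = some T}

/-- The preatomic number of `T ∈ B(λ)`: the maximal `p` such that `T` lies in the image of
`Φ^p : B(λ - 2pϖ₁) → B(λ)`. -/
noncomputable def pat (lam : Weight) (T : Word) : ℕ :=
  sSup {p : ℕ | ∃ U ∈ crystal (lam - (2 * p) • varpi1),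
    PhiPow (lam - (2 * p) • varpi1) p U = some T}

/-- The highest weight `λ - 2 pat(T) ϖ₁` of the preatom of `T ∈ B(λ)`. -/
noncomputable def preatomWeight (lam : Weight) (T : Word) : Weight :=
  lam - (2 * pat lam T) • varpi1

/-- The map `Ψ : P(λ) → P(λ + ϖ₂)`. -/
noncomputable def Psi (lam : Weight) (T : Word) : Option Word :=
  let (a, b, c, d) := str T
  ofString (lam + varpi2)
    (if d = 0 ∨ (d : ℤ) = lam.1 then (a, b + 1, c + 1, d) else (a, b, c + 1, d + 1))

/-- The map `Ψ̄ : P(λ) → P(λ + ϖ₂)`: equal to `Ψ` if `wt(T)₁ ≤ 0`, to `s₁ Ψ s₁` otherwise. -/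
noncomputable def PsiBar (lam : Weight) (T : Word) : Option Word :=
  if (wt T).1 ≤ 0 then Psi lam T
  else ((refl .n1 T).bind (Psi lam)).bind (refl .n1)

/-- `Ψ̄^k : P(λ) → P(λ + kϖ₂)`. -/
noncomputable def PsiBarPow (lam : Weight) : ℕ → Word → Option Word
  | 0, T => some T
  | k + 1, T => (PsiBarPow lam k T).bind (PsiBar (lam + k • varpi2))

/-- The atomic number of `T ∈ B(λ')`. With `p = pat(T)` and `λ = λ' - 2pϖ₁`, so that `T` lies in
the copy `Φ^p(P(λ))` of `P(λ)`, it is the maximal `k` such that `T` comes from an element of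
the image of `Ψ̄^k : P(λ - kϖ₂) → P(λ)`. -/
noncomputable def atomicNumber (lam' : Weight) (T : Word) : ℕ :=
  sSup {k : ℕ | ∃ V ∈ principalPreatom (preatomWeight lam' T - k • varpi2),
    (PsiBarPow (preatomWeight lam' T - k • varpi2) k V).bind
      (PhiPow (preatomWeight lam' T) (pat lam' T)) = some T}

/-! ### The Bruhat order on the weight lattice and the quantities `φ̂_i` -/

/-- An elementary relation `s_{Mδ + β^∨}(λ) < λ` of the Bruhat order, with `β` positive;
`s_{Mδ + β^∨}(λ) = λ - (⟨λ, β^∨⟩ - M) β`. -/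
def BruhatStep (ν lam : Weight) : Prop :=
  ∃ (β : PosRoot) (M : ℤ), ν = lam - (β.pair lam - M) • β.vec ∧
    ((0 ≤ M ∧ M < β.pair lam) ∨ (M < 0 ∧ β.pair lam < M))

/-- The Bruhat order on `X`, generated by the elementary relations. For dominant `λ`,
`{μ | μ ≤ λ} = Conv(W λ) ∩ (λ + ℤΦ)`. -/
def BruhatLE (μ lam : Weight) : Prop := Relation.ReflTransGen BruhatStep μ lam

/-- `φ̂_β(μ, λ)`: the maximal integer `k` with `μ - kβ ≤ λ`. -/
noncomputable def phiHat (β : PosRoot) (μ lam : Weight) : ℤ :=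
  sSup {k : ℤ | BruhatLE (μ - k • β.vec) lam}

/-! ### Affine coroots and the infinite reduced expression `(s₀s₂s₁s₂)(s₀s₂s₁s₂)…` -/

/-- `c₁ α₁^∨ + c₂ α₂^∨ + m δ`. -/
@[ext] structure AffCoroot where
  c₁ : ℤ
  c₂ : ℤ
  m : ℤ
  deriving DecidableEq

/-- The simple affine coroots `α₀^∨ = δ - α₂₁^∨`, `α₁^∨`, `α₂^∨`. -/
def simpleCoroot : Fin 3 → AffCoroot
  | 0 => ⟨-1, -2, 1⟩
  | 1 => ⟨1, 0, 0⟩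
  | 2 => ⟨0, 1, 0⟩

/-- The pairing of `x` with the finite part of the simple root `α_i` (for `i = 0` this is `-α₂₁`). -/
def simplePair : Fin 3 → AffCoroot → ℤ
  | 0, x => -x.c₂
  | 1, x => 2 * x.c₁ - x.c₂
  | 2, x => -2 * x.c₁ + 2 * x.c₂

/-- The simple reflection `s_i(x) = x - ⟨α_i, x⟩ α_i^∨` on affine coroots. -/
def simpleRefl (i : Fin 3) (x : AffCoroot) : AffCoroot :=
  ⟨x.c₁ - simplePair i x * (simpleCoroot i).c₁,
   x.c₂ - simplePair i x * (simpleCoroot i).c₂,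
   x.m - simplePair i x * (simpleCoroot i).m⟩

/-- The `(j + 1)`-st letter of `y_∞`. -/
def yLetter (j : ℕ) : Fin 3 :=
  if j % 4 = 0 then 0 else if j % 4 = 2 then 1 else 2

/-- The action of `y_j`, the product of the first `j` letters of `y_∞`. -/
def yAct : ℕ → AffCoroot → AffCoroot
  | 0, x => x
  | j + 1, x => yAct j (simpleRefl (yLetter j) x)

/-- The root of the reflection `t_{j+1}`, i.e. the only element of `N(y_{j+1}) \ N(y_j)`. -/
def tRoot (j : ℕ) : AffCoroot := yAct j (simpleCoroot (yLetter j))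

/-- The inversion set `N(y_m)`, for `m ∈ ℕ ∪ {∞}`. -/
def inversions (m : ℕ∞) : Set AffCoroot := {x | ∃ j : ℕ, (j : ℕ∞) < m ∧ x = tRoot j}

theorem yAct_four_mul (M : ℕ) (x : AffCoroot) :
    yAct (4 * M) x = ⟨x.c₁, x.c₂, x.m - M * x.c₂⟩ := by
  induction M generalizing x with
  | zero => simp [yAct]
  | succ M ih =>
    have h0 : yLetter (4 * M) = 0 := by simp [yLetter]
    have h1 : yLetter (4 * M + 1) = 2 := by
      have h : (4 * M + 1) % 4 = 1 := by omega
      simp [yLetter, h]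
    have h2 : yLetter (4 * M + 2) = 1 := by
      have h : (4 * M + 2) % 4 = 2 := by omega
      simp [yLetter, h]
    have h3 : yLetter (4 * M + 3) = 2 := by
      have h : (4 * M + 3) % 4 = 3 := by omega
      simp [yLetter, h]
    have h4 : 4 * (M + 1) = 4 * M + 3 + 1 := by ring
    rw [h4]
    simp only [yAct, h0, h1, h2, h3, ih]
    ext <;> simp [simpleRefl, simplePair, simpleCoroot] <;> ring

/-- The roots of `N(y_∞)` in order are `δ - α₂₁^∨`, `δ - α₁₂^∨`, `2δ - α₂₁^∨`, `δ - α₂^∨`,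
`3δ - α₂₁^∨`, `2δ - α₁₂^∨`, `4δ - α₂₁^∨`, `2δ - α₂^∨`, … -/
theorem tRoot_eq (M : ℕ) :
    tRoot (4 * M) = ⟨-1, -2, 2 * M + 1⟩ ∧ tRoot (4 * M + 1) = ⟨-1, -1, M + 1⟩ ∧
    tRoot (4 * M + 2) = ⟨-1, -2, 2 * M + 2⟩ ∧ tRoot (4 * M + 3) = ⟨0, -1, M + 1⟩ := by
  have h0 : yLetter (4 * M) = 0 := by simp [yLetter]
  have h1 : yLetter (4 * M + 1) = 2 := by
    have h : (4 * M + 1) % 4 = 1 := by omega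
    simp [yLetter, h]
  have h2 : yLetter (4 * M + 2) = 1 := by
    have h : (4 * M + 2) % 4 = 2 := by omega
    simp [yLetter, h]
  have h3 : yLetter (4 * M + 3) = 2 := by
    have h : (4 * M + 3) % 4 = 3 := by omega
    simp [yLetter, h]
  refine ⟨?_, ?_, ?_, ?_⟩ <;> simp only [tRoot, yAct, h0, h1, h2, h3, yAct_four_mul] <;>
    ext <;> simp [simpleRefl, simplePair, simpleCoroot] <;> ring

/-! ### Bruhat graphs, swappable edges and staircases -/

/-- There is an edge `μ → ν` in direction `β` in the Bruhat graph `Γ_λ`. -/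
def IsEdge (lam : Weight) (β : PosRoot) (μ ν : Weight) : Prop :=
  BruhatLE μ lam ∧ BruhatLE ν lam ∧ μ ≠ ν ∧ BruhatLE μ ν ∧ ∃ k : ℤ, ν = μ - k • β.vec

/-- The label `mδ - β^∨` of an edge `μ → ν` in direction `β > 0`, with
`m = -⟨μ + ν, β^∨⟩ / 2` (the division is exact). A label in `N(y_∞)` always has this sign. -/
def edgeLabel (β : PosRoot) (μ ν : Weight) : AffCoroot :=
  ⟨-β.coroot.1, -β.coroot.2, -(β.pair (μ + ν) / 2)⟩

/-- There is an arrow `ν → μ` in the twisted graph `Γ_λ^m`, obtained from `Γ_λ` by inverting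
the arrows with label in `N(y_m)`. -/
def TwistedArrow (m : ℕ∞) (lam ν μ : Weight) : Prop :=
  (∃ β, IsEdge lam β ν μ ∧ edgeLabel β ν μ ∉ inversions m) ∨
  (∃ β, IsEdge lam β μ ν ∧ edgeLabel β μ ν ∈ inversions m)

/-- `ℓ_m(μ, λ)`: the number of arrows pointing to `μ` in `Γ_λ^m`. -/
noncomputable def twistedLength (m : ℕ∞) (μ lam : Weight) : ℕ :=
  {ν | TwistedArrow m lam ν μ}.ncard

/-- `ℓ¹(μ)`: the number of arrows `μ - kα₁ → μ` pointing to `μ` (their labels are never in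
`N(y_∞)`, so that they are not inverted). -/
noncomputable def lengthOne (μ : Weight) : ℕ :=
  {ν | BruhatLE ν μ ∧ ν ≠ μ ∧ ∃ k : ℤ, ν = μ - k • PosRoot.a1.vec}.ncard

/-- `(μ → ν) ∈ E^S(λ)`: the edge is of the form `μ → t_{j+1} μ` and
`ℓ_j(μ, λ) = ℓ_j(t_{j+1} μ, λ) - 1`. -/
def IsSwappable (lam μ ν : Weight) : Prop :=
  ∃ (β : PosRoot) (j : ℕ), IsEdge lam β μ ν ∧ edgeLabel β μ ν = tRoot j ∧
    twistedLength j μ lam + 1 = twistedLength j ν lam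

/-- `(μ → ν) ∈ E^N(λ)`: the edge is of the form `μ → t_{j+1} μ` and is not swappable. -/
def IsNonSwappable (lam μ ν : Weight) : Prop :=
  ∃ (β : PosRoot) (j : ℕ), IsEdge lam β μ ν ∧ edgeLabel β μ ν = tRoot j ∧
    twistedLength j μ lam + 1 ≠ twistedLength j ν lam

/-- `𝒩_∞(μ, λ)`: the number of non-swappable edges in `Γ_λ` starting at `μ`. -/
noncomputable def NInf (μ lam : Weight) : ℕ := {ν | IsNonSwappable lam μ ν}.ncard

/-- The edges `e_i = (μ → μ - (n + i)α)`, `1 ≤ i ≤ a`, form a staircase of non-swappable edges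
over `(μ, λ)`. -/
def IsNSStaircase (μ lam : Weight) (α : PosRoot) (n a : ℕ) : Prop :=
  (∀ i : ℕ, 1 ≤ i → i ≤ a →
    IsNonSwappable (lam + i • varpi2) μ (μ - (n + i) • α.vec)) ∧
  (n = 0 ∨ IsSwappable lam μ (μ - n • α.vec))

/-- `𝒟̂_∞(μ, λ)`: the length of the longest staircase of non-swappable edges over `(μ, λ)`. -/
noncomputable def DHatInf (μ lam : Weight) : ℕ :=
  sSup {a : ℕ | ∃ α n, IsNSStaircase μ lam α n a}

/-- `𝒟_∞(μ, λ, k) = min(k, 𝒟̂_∞(μ, λ - kϖ₂))`. -/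
noncomputable def DInf (μ lam : Weight) (k : ℕ) : ℕ :=
  min k (DHatInf μ (lam - k • varpi2))

/-! ### The statistics `r_∞` and `r_P` -/

/-- `σ_∞(T)` for `T ∈ B(λ')`. -/
noncomputable def sigmaInf (lam' : Weight) (T : Word) : ℤ :=
  let lam := preatomWeight lam' T
  let a := atomicNumber lam' T
  (twistedLength ⊤ (wt T) (lam - a • varpi2) : ℤ) - NInf (wt T) (lam - a • varpi2)
    + DInf (wt T) lam a + a + 2 * pat lam' T

/-- `r_∞(T) = -σ_∞(T) + ⟨λ', ρ^∨⟩` for `T ∈ B(λ')`. -/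
noncomputable def rInf (lam' : Weight) (T : Word) : ℚ :=
  -(sigmaInf lam' T : ℚ) + rhoPair lam'

/-- The recharge in the parabolic region, `r_P(T) = -⟨wt T, ρ^∨⟩ + φ₁(T) - ℓ¹(wt T)`. -/
noncomputable def rPar (T : Word) : ℚ :=
  -rhoPair (wt T) + phi .n1 T - lengthOne (wt T)

end SpFour

set_option linter.unusedSimpArgs false
set_option linter.unnecessarySeqFocus false
set_option linter.unusedTactic false
set_option linter.unreachableTactic false
set_option linter.unusedVariables false

namespace SpFour

/-! ### String coordinates -/

/-! Elements of the crystal are replaced by their strings, the lattice points `Str.Mem` of a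
polytope on which all crystal data are piecewise linear. `word` builds the reading word with a given
string, one letter or column at a time; by induction the signature rule becomes `Str.low`
(`f_word`), and `mem_crystal_iff` identifies B(λ) with the polytope. Passing to the string for
s₁s₂s₁s₂ and back straightens the f₁-strings (`Str.move`), which gives formulas for s₁, φ₁ and
φ₁₂(T) = φ₂(s₁T). Adding (0,1,1,1) affects only three slacks, whose minimum is the preatomic number
(`pat_element`); counting how often Ψ̄ can be undone gives the atomic number
(`atomicNumber_element`).

On the Bruhat side, use the orthonormal coordinates x = μ₁ + μ₂, y = μ₂. The lower set of λ is the
set of lattice points of a polygon (`bruhatLE_iff_hull`), so φ̂_β is the explicit function `reach`.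
The arrows at μ in direction β form an interval of multiples of β, so twisted lengths are sums of
four `arrowCount`s, and ℓ_∞ = ℓ¹ + φ̂₂ + φ̂₁₂ + φ̂₂₁ (`twistedLength_top`). Comparing lengths at the
two ends of an edge (`swappable_iff`) shows that, for μ₁ ≠ 0, the non-swappable edges at μ all lower
the smaller of x and y along a long root, and are exactly those longer than a threshold `nsStart`;
for μ₁ = 0 there are none. This gives 𝒩_∞ (`NInf_eq`). A staircase must begin exactly at the
threshold, and only if the threshold is the same for λ + ϖ₂, which gives 𝒟̂_∞ (`DHatInf_eq`).

Both sides are now explicit functions of (a,b,c,d). For μ₁ ≤ 0 the formulas for φ₂ and φ₁₂ are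
checked on the three regions of the principal preatom (`Str.Principal.ph_n2_neg`,
`Str.Principal.ph12_neg`). Together with φ₁ + φ₂ + φ₁₂ + φ̂₂₁ + A = ⟨λ + μ, ρ^∨⟩
(`Str.Principal.ph_add_neg`) they give the equality of the two statistics on the preatom. Φ
preserves the weight, φ₂ and φ₁₂ and raises φ₁ by one, which settles the other preatoms; weights
with μ₁ > 0 are handled by applying s₁. -/

/-- Integral string data `(a, b, c, d)`. -/
@[ext] structure Str where
  a : ℤ
  b : ℤ
  c : ℤ
  d : ℤ

namespace Str

/-- The inequalities satisfied by the adapted strings of `B(m ϖ₁ + n ϖ₂)`. -/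
structure Mem (m n : ℤ) (s : Str) : Prop where
  a0 : 0 ≤ s.a
  d0 : 0 ≤ s.d
  dc : s.d ≤ s.c
  cb : s.c ≤ s.b
  dm : s.d ≤ m
  cn : s.c ≤ n + s.d
  bm : s.b ≤ m - 2 * s.d + 2 * s.c
  an : s.a ≤ n + s.d - 2 * s.c + s.b

def wt1 (m : ℤ) (s : Str) : ℤ := m - 2 * (s.b + s.d) + 2 * (s.a + s.c)

def wt2 (n : ℤ) (s : Str) : ℤ := n + s.b + s.d - 2 * (s.a + s.c)

/-- `ε_i` in terms of the string. -/
def ep : Node → Str → ℤ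
  | .n1, s => max (max s.d (2 * s.c - s.b)) (s.b - 2 * s.a)
  | .n2, s => s.a

/-- `φ_i` in terms of the string. -/
def ph (m n : ℤ) : Node → Str → ℤ
  | .n1, s => ep .n1 s + wt1 m s
  | .n2, s => ep .n2 s + wt2 n s

/-- The effect of `f_i` on strings. -/
def low : Node → Str → Str
  | .n1, s =>
    if s.d ≤ s.b - 2 * s.a ∧ 2 * s.c - s.b ≤ s.b - 2 * s.a then ⟨s.a, s.b + 1, s.c, s.d⟩
    else if s.d ≤ 2 * s.c - s.b then ⟨s.a - 1, s.b + 1, s.c + 1, s.d⟩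
    else ⟨s.a - 1, s.b, s.c + 1, s.d + 1⟩
  | .n2, s => ⟨s.a + 1, s.b, s.c, s.d⟩

end Str

/-! ### Words with prescribed strings, and the signature rule on them. -/

/-- The first letter of the word with string `s`, and the string of the remaining word. -/
def letterStep (s : Str) : Letter × Str :=
  if 1 ≤ s.d then (.oneBar, ⟨s.a, s.b - 1, s.c - 1, s.d - 1⟩)
  else if s.c < s.b then
    if 1 ≤ s.a then (.twoBar, ⟨s.a - 1, s.b - 1, s.c, s.d⟩) else (.two, ⟨s.a, s.b - 1, s.c, s.d⟩)
  else if s.b = 0 then (.one, s)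
  else (.two, ⟨s.a + 1, s.b - 1, s.c - 1, s.d⟩)

/-- The first column of the word with string `s` of a crystal `B(n ϖ₂)`, and the string of the
remaining word. -/
def columnStep (s : Str) : Letter × Letter × Str :=
  if s.c = 0 then
    if s.a = 0 then (.one, .two, s) else (.one, .twoBar, ⟨s.a - 1, s.b, s.c, s.d⟩)
  else if s.b = 1 then (.two, .twoBar, ⟨s.a, s.b - 1, s.c - 1, s.d⟩)
  else if s.b = s.c then (.two, .oneBar, ⟨s.a + 1, s.b - 2, s.c - 2, s.d⟩)
  else if s.a = 0 then (.two, .oneBar, ⟨s.a, s.b - 2, s.c - 1, s.d⟩)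
  else (.twoBar, .oneBar, ⟨s.a - 1, s.b - 2, s.c - 1, s.d⟩)

def columnWord : ℕ → Str → Word
  | 0, _ => []
  | n + 1, s => (columnStep s).1 :: (columnStep s).2.1 :: columnWord n (columnStep s).2.2

/-- The element of `B(m ϖ₁ + n ϖ₂)` with string `s`. -/
def word (n : ℕ) : ℕ → Str → Word
  | 0, s => columnWord n s
  | m + 1, s => (letterStep s).1 :: word n m (letterStep s).2

theorem letterStep_mem {m n : ℤ} {s : Str} (h : s.Mem (m + 1) n) (hm : 0 ≤ m) :
    (letterStep s).2.Mem m n := by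
  obtain ⟨h1, h2, h3, h4, h5, h6, h7, h8⟩ := h
  unfold letterStep
  split_ifs <;> constructor <;> dsimp only <;> omega

theorem columnStep_mem {n : ℤ} {s : Str} (h : s.Mem 0 (n + 1)) (hn : 0 ≤ n) :
    (columnStep s).2.2.Mem 0 n := by
  obtain ⟨h1, h2, h3, h4, h5, h6, h7, h8⟩ := h
  unfold columnStep
  split_ifs <;> constructor <;> dsimp only <;> omega

theorem Str.low_mem {m n : ℤ} {s : Str} (h : s.Mem m n) (i : Node) (hi : 0 < s.ph m n i) :
    (s.low i).Mem m n := by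
  obtain ⟨h1, h2, h3, h4, h5, h6, h7, h8⟩ := h
  cases i <;> simp only [ph, ep, wt1, wt2, low] at hi ⊢ <;> (try split_ifs) <;>
    constructor <;> dsimp only <;> omega

theorem Str.ep_nonneg {m n : ℤ} {s : Str} (h : s.Mem m n) (i : Node) : 0 ≤ s.ep i := by
  obtain ⟨h1, h2, h3, h4, h5, h6, h7, h8⟩ := h
  cases i <;> simp only [ep] <;> omega

theorem Str.ph_nonneg {m n : ℤ} {s : Str} (h : s.Mem m n) (i : Node) : 0 ≤ s.ph m n i := by
  obtain ⟨h1, h2, h3, h4, h5, h6, h7, h8⟩ := h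
  cases i <;> simp only [ph, ep, wt1, wt2] <;> omega

theorem minusCount_cons_eq (i : Node) (x : Letter) (w : Word) :
    (minusCount i (x :: w) : ℤ) =
      if (x.lower i).isSome then max ((minusCount i w : ℤ) - 1) 0
      else if (x.raise i).isSome then (minusCount i w : ℤ) + 1 else minusCount i w := by
  simp only [minusCount]
  split_ifs <;> omega

/-- This is the recursion of `minusCount_cons_eq` transported to strings; the two together identify
the signature count with `ep` by induction on the word. -/
theorem letterStep_ep {m n : ℤ} {s : Str} (h : s.Mem (m + 1) n) (i : Node) :
    s.ep i = if ((letterStep s).1.lower i).isSome then max ((letterStep s).2.ep i - 1) 0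
      else if ((letterStep s).1.raise i).isSome then (letterStep s).2.ep i + 1
      else (letterStep s).2.ep i := by
  obtain ⟨h1, h2, h3, h4, h5, h6, h7, h8⟩ := h
  cases i <;> unfold letterStep <;> split_ifs <;>
    simp_all [Letter.lower, Letter.raise, Str.ep] <;> omega

/-- The value of `ε_i` after a letter has been put in front of a word with `ε_i = k`. -/
def consEp (i : Node) (x : Letter) (k : ℤ) : ℤ :=
  if (x.lower i).isSome then max (k - 1) 0 else if (x.raise i).isSome then k + 1 else k

theorem columnStep_ep {n : ℤ} {s : Str} (h : s.Mem 0 (n + 1)) (i : Node) :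
    s.ep i = consEp i (columnStep s).1 (consEp i (columnStep s).2.1 ((columnStep s).2.2.ep i)) := by
  obtain ⟨h1, h2, h3, h4, h5, h6, h7, h8⟩ := h
  cases i <;> unfold columnStep <;> split_ifs <;>
    simp_all [Letter.lower, Letter.raise, Str.ep, consEp] <;> omega

/-- For `n1` the branch is chosen by the term of `ep` that attains the maximum, ties going first to
b - 2a, then to 2c - b; each branch raises its own term by one. -/
theorem Str.low_cases (s : Str) (i : Node) :
    (i = .n1 ∧ s.d ≤ s.b - 2 * s.a ∧ 2 * s.c - s.b ≤ s.b - 2 * s.a ∧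
      s.low i = ⟨s.a, s.b + 1, s.c, s.d⟩) ∨
    (i = .n1 ∧ s.b - 2 * s.a < 2 * s.c - s.b ∧ s.d ≤ 2 * s.c - s.b ∧
      s.low i = ⟨s.a - 1, s.b + 1, s.c + 1, s.d⟩) ∨
    (i = .n1 ∧ s.b - 2 * s.a < s.d ∧ 2 * s.c - s.b < s.d ∧
      s.low i = ⟨s.a - 1, s.b, s.c + 1, s.d + 1⟩) ∨
    (i = .n2 ∧ s.low i = ⟨s.a + 1, s.b, s.c, s.d⟩) := by
  cases i
  · simp only [low, reduceCtorEq, true_and, false_and, or_false]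
    split_ifs with h1 h2
    · exact Or.inl ⟨h1.1, h1.2, rfl⟩
    · exact Or.inr (Or.inl ⟨by omega, h2, rfl⟩)
    · exact Or.inr (Or.inr ⟨by omega, by omega, rfl⟩)
  · simp [low]

theorem letterStep_cases (s : Str) :
    (1 ≤ s.d ∧ letterStep s = (.oneBar, ⟨s.a, s.b - 1, s.c - 1, s.d - 1⟩)) ∨
    (s.d < 1 ∧ s.c < s.b ∧ 1 ≤ s.a ∧ letterStep s = (.twoBar, ⟨s.a - 1, s.b - 1, s.c, s.d⟩)) ∨
    (s.d < 1 ∧ s.c < s.b ∧ s.a < 1 ∧ letterStep s = (.two, ⟨s.a, s.b - 1, s.c, s.d⟩)) ∨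
    (s.d < 1 ∧ s.b ≤ s.c ∧ s.b = 0 ∧ letterStep s = (.one, s)) ∨
    (s.d < 1 ∧ s.b ≤ s.c ∧ s.b ≠ 0 ∧
      letterStep s = (.two, ⟨s.a + 1, s.b - 1, s.c - 1, s.d⟩)) := by
  simp only [letterStep]
  split_ifs <;> simp only [and_true, true_and, and_false, or_false, false_or, reduceCtorEq,
    Prod.mk.injEq, Str.ext_iff] <;> omega

theorem columnStep_cases (s : Str) :
    (s.c = 0 ∧ s.a = 0 ∧ columnStep s = (.one, .two, s)) ∨
    (s.c = 0 ∧ s.a ≠ 0 ∧ columnStep s = (.one, .twoBar, ⟨s.a - 1, s.b, s.c, s.d⟩)) ∨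
    (s.c ≠ 0 ∧ s.b = 1 ∧ columnStep s = (.two, .twoBar, ⟨s.a, s.b - 1, s.c - 1, s.d⟩)) ∨
    (s.c ≠ 0 ∧ s.b ≠ 1 ∧ s.b = s.c ∧
      columnStep s = (.two, .oneBar, ⟨s.a + 1, s.b - 2, s.c - 2, s.d⟩)) ∨
    (s.c ≠ 0 ∧ s.b ≠ 1 ∧ s.b ≠ s.c ∧ s.a = 0 ∧
      columnStep s = (.two, .oneBar, ⟨s.a, s.b - 2, s.c - 1, s.d⟩)) ∨
    (s.c ≠ 0 ∧ s.b ≠ 1 ∧ s.b ≠ s.c ∧ s.a ≠ 0 ∧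
      columnStep s = (.twoBar, .oneBar, ⟨s.a - 1, s.b - 2, s.c - 1, s.d⟩)) := by
  simp only [columnStep]
  split_ifs <;> simp only [and_true, true_and, and_false, or_false, false_or, reduceCtorEq,
    Prod.mk.injEq, Str.ext_iff] <;> omega

/-- The branch of the signature rule in which f_i acts on the first letter: its `+` meets no
uncancelled `-`, and the tail stays put. -/
theorem letterStep_low_self {m n : ℤ} (hm : 0 ≤ m) {s : Str} (h : s.Mem (m + 1) n) (i : Node)
    {y : Letter}
    (hy : (letterStep s).1.lower i = some y) (he : (letterStep s).2.ep i = 0) :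
    0 < s.ph (m + 1) n i ∧ letterStep (s.low i) = (y, (letterStep s).2) := by
  obtain ⟨h1, h2, h3, h4, h5, h6, h7, h8⟩ := h
  have H := letterStep_cases (s.low i)
  rcases letterStep_cases s with ⟨g1, g⟩ | ⟨g1, g2, g3, g⟩ | ⟨g1, g2, g3, g⟩ | ⟨g1, g2, g3, g⟩ |
    ⟨g1, g2, g3, g⟩ <;> rw [g] at hy he ⊢ <;>
    rcases s.low_cases i with ⟨rfl, l1, l2, l⟩ | ⟨rfl, l1, l2, l⟩ | ⟨rfl, l1, l2, l⟩ | ⟨rfl, l⟩ <;>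
    rw [l] at H ⊢ <;>
    simp only [Letter.lower, reduceCtorEq, Option.some.injEq, Str.ep] at hy he <;>
    subst hy <;> simp only [Str.ep, Str.ph, Str.wt1, Str.wt2] at H ⊢ <;>
    refine ⟨by omega, ?_⟩ <;>
    rcases H with ⟨_, H⟩ | ⟨_, _, _, H⟩ | ⟨_, _, _, H⟩ | ⟨_, _, _, H⟩ | ⟨_, _, _, H⟩ <;> first
    | (exfalso; omega)
    | (rw [H]; done)
    | (rw [H]; simp only [Prod.mk.injEq, Str.ext_iff, true_and, and_true] <;> omega)

/-- The complementary branch: f_i acts on the tail, so peeling off the first letter commutes with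
`low`, and f_i kills the word exactly when it kills the tail. -/
theorem letterStep_low_tail {m n : ℤ} (hm : 0 ≤ m) {s : Str} (h : s.Mem (m + 1) n) (i : Node)
    (hy : (letterStep s).1.lower i = none ∨ 0 < (letterStep s).2.ep i) :
    (0 < s.ph (m + 1) n i ↔ 0 < (letterStep s).2.ph m n i) ∧
      (0 < (letterStep s).2.ph m n i →
        letterStep (s.low i) = ((letterStep s).1, (letterStep s).2.low i)) := by
  obtain ⟨h1, h2, h3, h4, h5, h6, h7, h8⟩ := h
  have H := letterStep_cases (s.low i)
  have K := (letterStep s).2.low_cases i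
  -- The branches at `s`, at its tail and at the lowered string constrain each other: most
  -- combinations are contradictory, and in the others the strings agree entrywise.
  rcases letterStep_cases s with ⟨g1, g⟩ | ⟨g1, g2, g3, g⟩ | ⟨g1, g2, g3, g⟩ | ⟨g1, g2, g3, g⟩ |
    ⟨g1, g2, g3, g⟩ <;> rw [g] at hy K ⊢ <;>
    rcases s.low_cases i with ⟨rfl, l1, l2, l⟩ | ⟨rfl, l1, l2, l⟩ | ⟨rfl, l1, l2, l⟩ | ⟨rfl, l⟩ <;>
    rw [l] at H ⊢ <;>
    simp only [Letter.lower, reduceCtorEq, true_or, false_or, Str.ep] at hy <;>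
    simp only [Str.ep, Str.ph, Str.wt1, Str.wt2] at H K ⊢ <;>
    refine ⟨by omega, fun hp => ?_⟩ <;>
    rcases K with ⟨k0, k1, k2, K⟩ | ⟨k0, k1, k2, K⟩ | ⟨k0, k1, k2, K⟩ | ⟨k0, K⟩ <;>
    first | (cases k0; done) | (try rw [K]) <;>
    rcases H with ⟨_, H⟩ | ⟨_, _, _, H⟩ | ⟨_, _, _, H⟩ | ⟨_, _, _, H⟩ | ⟨_, _, _, H⟩ <;> first
    | (exfalso; omega)
    | (rw [H]; done)
    | (rw [H]; simp only [Prod.mk.injEq, Str.ext_iff, true_and, and_true] <;> omega)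

/-- A column contributes two letters, so the signature rule has three branches: f_i acts on the
first letter, on the second, or on the remaining columns. -/
theorem columnStep_low_first {n : ℤ} (hn : 0 ≤ n) {s : Str} (h : s.Mem 0 (n + 1)) (i : Node)
    {y : Letter}
    (hy : (columnStep s).1.lower i = some y)
    (he : consEp i (columnStep s).2.1 ((columnStep s).2.2.ep i) = 0) :
    0 < s.ph 0 (n + 1) i ∧
      columnStep (s.low i) = (y, (columnStep s).2.1, (columnStep s).2.2) := by
  obtain ⟨h1, h2, h3, h4, h5, h6, h7, h8⟩ := h
  have H := columnStep_cases (s.low i)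
  rcases columnStep_cases s with ⟨g1, g2, g⟩ | ⟨g1, g2, g⟩ | ⟨g1, g2, g⟩ | ⟨g1, g2, g3, g⟩ |
    ⟨g1, g2, g3, g4, g⟩ | ⟨g1, g2, g3, g4, g⟩ <;> rw [g] at hy he ⊢ <;>
    rcases s.low_cases i with ⟨rfl, l1, l2, l⟩ | ⟨rfl, l1, l2, l⟩ | ⟨rfl, l1, l2, l⟩ | ⟨rfl, l⟩ <;>
    rw [l] at H ⊢ <;>
    simp only [Letter.lower, Letter.raise, consEp, reduceCtorEq, Option.some.injEq, Str.ep,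
      Option.isSome, Bool.false_eq_true, if_true, if_false] at hy he <;>
    subst hy <;> simp only [Str.ep, Str.ph, Str.wt1, Str.wt2] at H ⊢ <;>
    refine ⟨by omega, ?_⟩ <;>
    rcases H with ⟨_, _, H⟩ | ⟨_, _, H⟩ | ⟨_, _, H⟩ | ⟨_, _, _, H⟩ | ⟨_, _, _, _, H⟩ |
      ⟨_, _, _, _, H⟩ <;> first
    | (exfalso; omega)
    | (rw [H]; done)
    | (rw [H]; simp only [Prod.mk.injEq, Str.ext_iff, true_and, and_true] <;> omega)

theorem columnStep_low_second {n : ℤ} (hn : 0 ≤ n) {s : Str} (h : s.Mem 0 (n + 1)) (i : Node)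
    {y : Letter}
    (hx : (columnStep s).1.lower i = none ∨
      0 < consEp i (columnStep s).2.1 ((columnStep s).2.2.ep i))
    (hy : (columnStep s).2.1.lower i = some y) (he : (columnStep s).2.2.ep i = 0) :
    0 < s.ph 0 (n + 1) i ∧
      columnStep (s.low i) = ((columnStep s).1, y, (columnStep s).2.2) := by
  obtain ⟨h1, h2, h3, h4, h5, h6, h7, h8⟩ := h
  have H := columnStep_cases (s.low i)
  rcases columnStep_cases s with ⟨g1, g2, g⟩ | ⟨g1, g2, g⟩ | ⟨g1, g2, g⟩ | ⟨g1, g2, g3, g⟩ |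
    ⟨g1, g2, g3, g4, g⟩ | ⟨g1, g2, g3, g4, g⟩ <;> rw [g] at hx hy he ⊢ <;>
    rcases s.low_cases i with ⟨rfl, l1, l2, l⟩ | ⟨rfl, l1, l2, l⟩ | ⟨rfl, l1, l2, l⟩ | ⟨rfl, l⟩ <;>
    rw [l] at H ⊢ <;>
    simp only [Letter.lower, Letter.raise, consEp, reduceCtorEq, Option.some.injEq, Str.ep,
      Option.isSome, Bool.false_eq_true, if_true, if_false, true_or, false_or] at hx hy he <;>
    subst hy <;> simp only [Str.ep, Str.ph, Str.wt1, Str.wt2] at H ⊢ <;>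
    refine ⟨by omega, ?_⟩ <;>
    rcases H with ⟨_, _, H⟩ | ⟨_, _, H⟩ | ⟨_, _, H⟩ | ⟨_, _, _, H⟩ | ⟨_, _, _, _, H⟩ |
      ⟨_, _, _, _, H⟩ <;> first
    | (exfalso; omega)
    | (rw [H]; done)
    | (rw [H]; simp only [Prod.mk.injEq, Str.ext_iff, true_and, and_true] <;> omega)

theorem columnStep_low_tail {n : ℤ} (hn : 0 ≤ n) {s : Str} (h : s.Mem 0 (n + 1)) (i : Node)
    (hx : (columnStep s).1.lower i = none ∨
      0 < consEp i (columnStep s).2.1 ((columnStep s).2.2.ep i))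
    (hy : (columnStep s).2.1.lower i = none ∨ 0 < (columnStep s).2.2.ep i) :
    (0 < s.ph 0 (n + 1) i ↔ 0 < (columnStep s).2.2.ph 0 n i) ∧
      (0 < (columnStep s).2.2.ph 0 n i → columnStep (s.low i) =
        ((columnStep s).1, (columnStep s).2.1, (columnStep s).2.2.low i)) := by
  obtain ⟨h1, h2, h3, h4, h5, h6, h7, h8⟩ := h
  have H := columnStep_cases (s.low i)
  have K := (columnStep s).2.2.low_cases i
  rcases columnStep_cases s with ⟨g1, g2, g⟩ | ⟨g1, g2, g⟩ | ⟨g1, g2, g⟩ | ⟨g1, g2, g3, g⟩ |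
    ⟨g1, g2, g3, g4, g⟩ | ⟨g1, g2, g3, g4, g⟩ <;> rw [g] at hx hy K ⊢ <;>
    rcases s.low_cases i with ⟨rfl, l1, l2, l⟩ | ⟨rfl, l1, l2, l⟩ | ⟨rfl, l1, l2, l⟩ | ⟨rfl, l⟩ <;>
    rw [l] at H ⊢ <;>
    simp only [Letter.lower, Letter.raise, consEp, reduceCtorEq, Option.some.injEq, Str.ep,
      Option.isSome, Bool.false_eq_true, if_true, if_false, true_or, false_or] at hx hy <;>
    simp only [Str.ep, Str.ph, Str.wt1, Str.wt2] at H K ⊢ <;>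
    refine ⟨by omega, fun hp => ?_⟩ <;>
    rcases K with ⟨k0, k1, k2, K⟩ | ⟨k0, k1, k2, K⟩ | ⟨k0, k1, k2, K⟩ | ⟨k0, K⟩ <;>
    first | (cases k0; done) | (try rw [K]) <;>
    rcases H with ⟨_, _, H⟩ | ⟨_, _, H⟩ | ⟨_, _, H⟩ | ⟨_, _, _, H⟩ | ⟨_, _, _, _, H⟩ |
      ⟨_, _, _, _, H⟩ <;> first
    | (exfalso; omega)
    | (rw [H]; done)
    | (rw [H]; simp only [Prod.mk.injEq, Str.ext_iff, true_and, and_true] <;> omega)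

/-! ### Crystal operators on words in terms of strings -/

theorem Letter.raise_eq_some_iff {i : Node} {x y : Letter} :
    y.raise i = some x ↔ x.lower i = some y := by
  cases i <;> cases x <;> cases y <;> simp [Letter.raise, Letter.lower]

theorem Letter.raise_eq_none_of_lower {i : Node} {x y : Letter} (h : x.lower i = some y) :
    x.raise i = none := by
  cases i <;> cases x <;> simp_all [Letter.raise, Letter.lower]

theorem Letter.lower_eq_none_of_raise {i : Node} {x y : Letter} (h : x.raise i = some y) :
    x.lower i = none := by
  cases i <;> cases x <;> simp_all [Letter.raise, Letter.lower]

theorem f_cons_of_lower {i : Node} {x y : Letter} (h : x.lower i = some y) (w : Word) :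
    f i (x :: w) = if minusCount i w = 0 then some (y :: w) else (f i w).map (x :: ·) := by
  simp only [f, h]

theorem f_cons_of_none {i : Node} {x : Letter} (h : x.lower i = none) (w : Word) :
    f i (x :: w) = (f i w).map (x :: ·) := by
  simp only [f, h]

theorem e_cons_of_raise {i : Node} {x y : Letter} (h : x.raise i = some y) (w : Word) :
    e i (x :: w) = if minusCount i w = 0 then some (y :: w) else (e i w).map (x :: ·) := by
  simp only [e, h]

theorem e_cons_of_none {i : Node} {x : Letter} (h : x.raise i = none) (w : Word) :
    e i (x :: w) = if (x.lower i).isSome ∧ minusCount i w ≤ 1 then none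
      else (e i w).map (x :: ·) := by
  simp only [e, h]

/-- Lowering turns the left-most uncancelled `+` into the right-most uncancelled `-`, so raising
undoes it. Hence e_i needs no separate computation on strings. -/
theorem e_of_f {i : Node} {U T : Word} (h : f i U = some T) :
    minusCount i T = minusCount i U + 1 ∧ e i T = some U := by
  induction U generalizing T with
  | nil => simp [f] at h
  | cons x w ih =>
    rcases hx : x.lower i with _ | y
    · rw [f_cons_of_none hx] at h
      obtain ⟨T', hT', rfl⟩ := Option.map_eq_some_iff.1 h
      obtain ⟨h1, h2⟩ := ih hT'
      rcases hr : x.raise i with _ | z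
      · simp [minusCount, hx, hr, e_cons_of_none hr, h1, h2]
      · simp [minusCount, hx, hr, e_cons_of_raise hr, h1, h2]
    · have hy := Letter.raise_eq_some_iff.2 hx
      have hy' := Letter.lower_eq_none_of_raise hy
      have hr := Letter.raise_eq_none_of_lower hx
      rw [f_cons_of_lower hx] at h
      split_ifs at h with h0
      · cases h
        simp [minusCount, hx, hy, hy', e_cons_of_raise hy, h0]
      · obtain ⟨T', hT', rfl⟩ := Option.map_eq_some_iff.1 h
        obtain ⟨h1, h2⟩ := ih hT'
        -- The `+` of `x` cancels only one `-` of the tail; the one created by f_i makes at least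
        -- two, so `e` does not vanish here.
        have : ¬ (minusCount i w + 1 ≤ 1) := by omega
        simp only [minusCount, hx, hr, e_cons_of_none hr, h1, h2, this, Option.isSome, if_true]
        simp; omega

theorem f_of_e {i : Node} {U T : Word} (h : e i T = some U) :
    minusCount i T = minusCount i U + 1 ∧ f i U = some T := by
  induction T generalizing U with
  | nil => simp [e] at h
  | cons x w ih =>
    rcases hx : x.raise i with _ | y
    · rw [e_cons_of_none hx] at h
      split_ifs at h with h0
      obtain ⟨T', hT', rfl⟩ := Option.map_eq_some_iff.1 h
      obtain ⟨h1, h2⟩ := ih hT'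
      rcases hr : x.lower i with _ | z
      · simp [minusCount, hx, hr, f_cons_of_none hr, h1, h2]
      · have h3 : ¬ minusCount i w ≤ 1 := by simpa [hr] using h0
        have h4 : minusCount i T' ≠ 0 := by omega
        simp only [minusCount, hr, f_cons_of_lower hr, h1, h2, h4, Option.isSome, if_true]
        simp; omega
    · have hy := Letter.raise_eq_some_iff.1 hx
      have hr := Letter.lower_eq_none_of_raise hx
      rw [e_cons_of_raise hx] at h
      split_ifs at h with h0
      · cases h
        simp [minusCount, hx, hy, hr, f_cons_of_lower hy, h0]
      · obtain ⟨T', hT', rfl⟩ := Option.map_eq_some_iff.1 h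
        obtain ⟨h1, h2⟩ := ih hT'
        simp [minusCount, hx, hr, f_cons_of_none hr, h1, h2]

theorem minusCount_cons_consEp (i : Node) (x : Letter) (w : Word) :
    (minusCount i (x :: w) : ℤ) = consEp i x (minusCount i w) :=
  minusCount_cons_eq i x w

theorem Str.Mem.eq_zero {s : Str} (h : s.Mem 0 0) : s = ⟨0, 0, 0, 0⟩ := by
  obtain ⟨h1, h2, h3, h4, h5, h6, h7, h8⟩ := h
  ext <;> dsimp only <;> omega

theorem minusCount_columnWord {n : ℕ} {s : Str} (h : s.Mem 0 n) (i : Node) :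
    (minusCount i (columnWord n s) : ℤ) = s.ep i := by
  induction n generalizing s with
  | zero => rw [h.eq_zero]; cases i <;> simp [columnWord, minusCount, Str.ep]
  | succ n ih =>
    push_cast at h
    rw [columnWord, minusCount_cons_consEp, minusCount_cons_consEp,
      ih (columnStep_mem h (by omega)), columnStep_ep h i]

theorem minusCount_word {n m : ℕ} {s : Str} (h : s.Mem m n) (i : Node) :
    (minusCount i (word n m s) : ℤ) = s.ep i := by
  induction m generalizing s with
  | zero => exact minusCount_columnWord (by simpa using h) i
  | succ m ih =>
    push_cast at h
    rw [word, minusCount_cons_consEp, ih (letterStep_mem h (by omega)), letterStep_ep h i, consEp]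

theorem f_columnWord {n : ℕ} {s : Str} (h : s.Mem 0 n) (i : Node) :
    f i (columnWord n s) =
      if 0 < s.ph 0 n i then some (columnWord n (s.low i)) else none := by
  induction n generalizing s with
  | zero => rw [h.eq_zero]; cases i <;> simp [columnWord, f, Str.ph, Str.ep, Str.wt1, Str.wt2]
  | succ n ih =>
    push_cast at h ⊢
    have ht := columnStep_mem h (by omega)
    have e0 := minusCount_columnWord ht i
    have e1 := minusCount_cons_consEp i (columnStep s).2.1 (columnWord n (columnStep s).2.2)
    rw [e0] at e1
    have hp := Str.ep_nonneg ht i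
    have hn : (0 : ℤ) ≤ n := by omega
    have key : ((columnStep s).1.lower i = none ∨
        0 < consEp i (columnStep s).2.1 ((columnStep s).2.2.ep i)) →
        (f i ((columnStep s).2.1 :: columnWord n (columnStep s).2.2)).map
          ((columnStep s).1 :: ·) =
        if 0 < s.ph 0 (n + 1) i then some (columnWord (n + 1) (s.low i)) else none := by
      intro hx
      have tail (hy : (columnStep s).2.1.lower i = none ∨ 0 < (columnStep s).2.2.ep i) :
          ((f i (columnWord n (columnStep s).2.2)).map ((columnStep s).2.1 :: ·)).map
            ((columnStep s).1 :: ·) =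
          if 0 < s.ph 0 (n + 1) i then some (columnWord (n + 1) (s.low i)) else none := by
        obtain ⟨k1, k2⟩ := columnStep_low_tail hn h i hx hy
        rw [ih ht]
        by_cases h0 : 0 < (columnStep s).2.2.ph 0 n i
        · rw [if_pos h0, if_pos (k1.2 h0), columnWord, k2 h0]; rfl
        · rw [if_neg h0, if_neg (mt k1.1 h0)]; rfl
      rcases hy : (columnStep s).2.1.lower i with _ | y
      · rw [f_cons_of_none hy]
        exact tail (Or.inl hy)
      · rw [f_cons_of_lower hy]
        split_ifs with h0
        · obtain ⟨k1, k2⟩ := columnStep_low_second hn h i hx hy (by omega)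
          rw [columnWord, k2]; rfl
        · obtain ⟨k1, k2⟩ := columnStep_low_second hn h i hx hy (by omega)
          contradiction
        · rw [tail (Or.inr (by omega)), if_pos (by assumption)]
        · rw [tail (Or.inr (by omega)), if_neg (by assumption)]
    rw [columnWord]
    rcases hx : (columnStep s).1.lower i with _ | y
    · rw [f_cons_of_none hx, key (Or.inl hx)]
    · rw [f_cons_of_lower hx]
      split_ifs with h0
      · obtain ⟨k1, k2⟩ := columnStep_low_first hn h i hx (by omega)
        rw [columnWord, k2]
      · obtain ⟨k1, k2⟩ := columnStep_low_first hn h i hx (by omega)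
        contradiction
      · rw [key (Or.inr (by omega)), if_pos (by assumption)]
      · rw [key (Or.inr (by omega)), if_neg (by assumption)]

theorem f_word {n m : ℕ} {s : Str} (h : s.Mem m n) (i : Node) :
    f i (word n m s) = if 0 < s.ph m n i then some (word n m (s.low i)) else none := by
  induction m generalizing s with
  | zero => exact_mod_cast f_columnWord (by simpa using h) i
  | succ m ih =>
    push_cast at h ⊢
    have ht := letterStep_mem h (by omega)
    have e0 := minusCount_word ht i
    have hp := Str.ep_nonneg ht i
    have hm : (0 : ℤ) ≤ m := by omega
    have tail (hy : (letterStep s).1.lower i = none ∨ 0 < (letterStep s).2.ep i) :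
        (f i (word n m (letterStep s).2)).map ((letterStep s).1 :: ·) =
        if 0 < s.ph (m + 1) n i then some (word n (m + 1) (s.low i)) else none := by
      obtain ⟨k1, k2⟩ := letterStep_low_tail hm h i hy
      rw [ih ht]
      by_cases h0 : 0 < (letterStep s).2.ph m n i
      · rw [if_pos h0, if_pos (k1.2 h0), word, k2 h0]; rfl
      · rw [if_neg h0, if_neg (mt k1.1 h0)]; rfl
    rw [word]
    rcases hx : (letterStep s).1.lower i with _ | y
    · rw [f_cons_of_none hx, tail (Or.inl hx)]
    · rw [f_cons_of_lower hx]
      split_ifs with h0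
      · obtain ⟨k1, k2⟩ := letterStep_low_self hm h i hx (by omega)
        rw [word, k2]
      · obtain ⟨k1, k2⟩ := letterStep_low_self hm h i hx (by omega)
        contradiction
      · rw [tail (Or.inr (by omega)), if_pos (by assumption)]
      · rw [tail (Or.inr (by omega)), if_neg (by assumption)]

/-! ### The f₁-strings in the coordinates adapted to s₁s₂s₁s₂. -/

namespace Str

/-- The last coordinate of the string adapted to `s₁s₂s₁s₂`. -/
def dualD (s : Str) : ℤ := min (min s.a (s.b - s.c)) (s.c - s.d)

/-- The string for `s₂s₁s₂s₁` in terms of the string `(A, B, C, D)` for `s₁s₂s₁s₂`. -/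
def ofDual (A B C D : ℤ) : Str :=
  ⟨max (max D (C - B)) (B - A), A + C - min (min A (2 * B - C)) (C - 2 * D),
    B + D - max (max D (C - B)) (B - A), min (min A (2 * B - C)) (C - 2 * D)⟩

/-- The element at distance `k` from `s` on its `i`-string. -/
def move : Node → ℤ → Str → Str
  | .n1, k, s =>
    ofDual (s.ep .n1 + k) (s.a + s.c - s.dualD) (s.b + s.d - s.ep .n1) s.dualD
  | .n2, k, s => ⟨s.a + k, s.b, s.c, s.d⟩

variable {m n : ℤ} {s : Str}

/-- For `n1` this says that `ofDual` inverts the passage from (a,b,c,d) to the dual string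
(A,B,C,D), whose first entry A is ε₁. The remaining ones are recovered from D and the totals A + C =
b + d and B + D = a + c. -/
theorem move_zero (h : s.Mem m n) (i : Node) : s.move i 0 = s := by
  obtain ⟨h1, h2, h3, h4, h5, h6, h7, h8⟩ := h
  cases i <;> simp only [move, ofDual, dualD, ep, Str.ext_iff]
  · refine ⟨?_, ?_, ?_, ?_⟩ <;> omega
  · simp

theorem ep_move (h : s.Mem m n) (i : Node) {k : ℤ} (hk : -s.ep i ≤ k) :
    (s.move i k).ep i = s.ep i + k := by
  obtain ⟨h1, h2, h3, h4, h5, h6, h7, h8⟩ := h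
  cases i <;> simp only [move, ofDual, dualD, ep] at hk ⊢
  omega

theorem wt1_move (i : Node) {k : ℤ} :
    (s.move i k).wt1 m = s.wt1 m - match i with | .n1 => 2 * k | .n2 => -2 * k := by
  cases i <;> simp only [move, ofDual, dualD, ep, wt1] <;> ring_nf

theorem wt2_move (i : Node) {k : ℤ} :
    (s.move i k).wt2 n = s.wt2 n - match i with | .n1 => -k | .n2 => 2 * k := by
  cases i <;> simp only [move, ofDual, dualD, ep, wt2] <;> ring_nf

theorem ph_move (h : s.Mem m n) (i : Node) {k : ℤ} (hk : -s.ep i ≤ k) :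
    (s.move i k).ph m n i = s.ph m n i - k := by
  have h1 := ep_move h i hk
  have h2 := wt1_move (m := m) (s := s) i (k := k)
  have h3 := wt2_move (n := n) (s := s) i (k := k)
  cases i <;> simp only [ph] at * <;> omega

theorem ep_ofDual {A B C D : ℤ} (hA : 0 ≤ A) (hD : 0 ≤ D) (hC : 2 * D ≤ C) (hB : C ≤ 2 * B) :
    (ofDual A B C D).ep .n1 = A := by
  simp only [ofDual, ep]
  omega

/-- In dual coordinates f₁ is just a shift of A; the hypotheses are the inequalities of the dual
string cone. -/
theorem low_ofDual {A B C D : ℤ} (hA : 0 ≤ A) (hD : 0 ≤ D) (hC : 2 * D ≤ C) (hB : C ≤ 2 * B) :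
    (ofDual A B C D).low .n1 = ofDual (A + 1) B C D := by
  have h1 := ep_ofDual hA hD hC hB
  have H := Str.low_cases (ofDual A B C D) .n1
  simp only [reduceCtorEq, false_and, or_false, true_and] at H
  simp only [ep] at h1
  rcases H with ⟨g1, g2, g⟩ | ⟨g1, g2, g⟩ | ⟨g1, g2, g⟩ <;> rw [g]
  -- The branch of `low` tells which term realises the maximum `ep`, and by `ep_ofDual` that term
  -- equals A.
  · have k : (ofDual A B C D).b - 2 * (ofDual A B C D).a = A := by omega
    clear h1 g
    simp only [ofDual] at *
    simp only [Str.mk.injEq]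
    omega
  · have k : 2 * (ofDual A B C D).c - (ofDual A B C D).b = A := by omega
    clear h1 g
    simp only [ofDual] at *
    simp only [Str.mk.injEq]
    omega
  · have k : (ofDual A B C D).d = A := by omega
    clear h1 g
    simp only [ofDual] at *
    simp only [Str.mk.injEq]
    omega

theorem low_move (h : s.Mem m n) (i : Node) {k : ℤ} (hk : -s.ep i ≤ k) :
    (s.move i k).low i = s.move i (k + 1) := by
  obtain ⟨h1, h2, h3, h4, h5, h6, h7, h8⟩ := h
  cases i
  · rw [move, move, low_ofDual, add_assoc] <;> simp only [dualD, ep] at * <;> omega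
  · simp only [move, low, Str.mk.injEq, and_true]; omega

theorem move_mem (h : s.Mem m n) (i : Node) {k : ℤ} (hk : -s.ep i ≤ k) (hk' : k ≤ s.ph m n i) :
    (s.move i k).Mem m n := by
  obtain ⟨h1, h2, h3, h4, h5, h6, h7, h8⟩ := h
  cases i <;> simp only [ep, ph, wt1, wt2] at hk hk' <;> constructor <;>
    simp only [move, ofDual, dualD, ep] <;> omega

theorem move_move (h : s.Mem m n) (i : Node) {k l : ℤ} (hk : -s.ep i ≤ k) :
    (s.move i k).move i l = s.move i (k + l) := by
  have h0 := ep_move h i hk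
  obtain ⟨h1, h2, h3, h4, h5, h6, h7, h8⟩ := h
  cases i
  -- B, C and D are constant along a 1-string; only A moves.
  · have hd : (s.move .n1 k).dualD = s.dualD := by
      simp only [ep, move, ofDual, dualD] at hk ⊢
      omega
    have hb : (s.move .n1 k).a + (s.move .n1 k).c = s.a + s.c := by
      simp only [move, ofDual]; omega
    have hc : (s.move .n1 k).b + (s.move .n1 k).d = s.b + s.d + k := by
      simp only [move, ofDual]; omega
    rw [move, h0, hd, hb, hc, move]
    congr 1 <;> omega
  · simp only [move, Str.mk.injEq, and_true]; omega

/-- Reversal of the `i`-string. -/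
def reverse (m n : ℤ) (i : Node) (s : Str) : Str := s.move i (s.ph m n i - s.ep i)

theorem reverse_mem (h : s.Mem m n) (i : Node) : (s.reverse m n i).Mem m n :=
  move_mem h i (by have := ph_nonneg h i; omega) (by have := ep_nonneg h i; omega)

theorem ep_reverse (h : s.Mem m n) (i : Node) : (s.reverse m n i).ep i = s.ph m n i := by
  rw [reverse, ep_move h i (by have := ph_nonneg h i; omega)]; ring

theorem ph_reverse (h : s.Mem m n) (i : Node) : (s.reverse m n i).ph m n i = s.ep i := by
  rw [reverse, ph_move h i (by have := ph_nonneg h i; omega)]; ring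

theorem reverse_reverse (h : s.Mem m n) (i : Node) : (s.reverse m n i).reverse m n i = s := by
  rw [reverse, ep_reverse h, ph_reverse h, reverse, move_move h i
    (by have := ph_nonneg h i; omega)]
  rw [show s.ph m n i - s.ep i + (s.ep i - s.ph m n i) = 0 by ring, move_zero h]

end Str

/-! ### Powers of partially defined operators -/

theorem maxPow_eq {g : Word → Option Word} {T : Word} {N : ℕ}
    (h : ∀ k, iter g k T ≠ none ↔ k ≤ N) : maxPow g T = N := by
  have : {k : ℕ | iter g k T ≠ none} = Set.Iic N := by ext k; exact h k
  rw [maxPow, this, csSup_Iic]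

/-- If `g` acts on the elements `F 0, …, F N` by `F k ↦ F (k + 1)` and kills `F N`, then
`N` is the maximal power of `g` that does not kill `F 0`. -/
theorem iter_of_chain {g : Word → Option Word} {F : ℕ → Word} {N : ℕ}
    (h1 : ∀ k < N, g (F k) = some (F (k + 1))) {k : ℕ} (hk : k ≤ N) :
    iter g k (F 0) = some (F k) := by
  induction k with
  | zero => rfl
  | succ k ih => rw [iter, ih (by omega), Option.bind_some, h1 k (by omega)]

theorem maxPow_of_chain {g : Word → Option Word} {F : ℕ → Word} {N : ℕ}
    (h1 : ∀ k < N, g (F k) = some (F (k + 1))) (h2 : g (F N) = none) :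
    maxPow g (F 0) = N := by
  refine maxPow_eq fun k => ⟨fun h => ?_, fun h => by simp [iter_of_chain h1 h]⟩
  by_contra hk
  refine h ?_
  have : ∀ j, iter g (N + 1 + j) (F 0) = none := by
    intro j
    induction j with
    | zero => rw [Nat.add_zero, iter, iter_of_chain h1 le_rfl, Option.bind_some, h2]
    | succ j ih => rw [← Nat.add_assoc, iter, ih]; rfl
  obtain ⟨j, rfl⟩ := Nat.exists_eq_add_of_le (Nat.succ_le_of_lt (not_le.1 hk))
  exact this j

/-! ### The crystal `B(λ)` in terms of strings -/

/-- The element of `B(λ)` with string `s`. -/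
def element (lam : Weight) (s : Str) : Word := word lam.2.toNat lam.1.toNat s

/-- The strings of the elements of `B(λ)`. -/
abbrev Str.In (lam : Weight) (s : Str) : Prop := s.Mem lam.1 lam.2

theorem Str.Mem.nonneg {m n : ℤ} {s : Str} (h : s.Mem m n) : 0 ≤ m ∧ 0 ≤ n := by
  obtain ⟨h1, h2, h3, h4, h5, h6, h7, h8⟩ := h
  omega

section
variable {lam : Weight} {s : Str}

theorem f_element (h : s.In lam) (i : Node) :
    f i (element lam s) =
      if 0 < s.ph lam.1 lam.2 i then some (element lam (s.low i)) else none := by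
  obtain ⟨h1, h2⟩ := h.nonneg
  have h' : s.Mem (lam.1.toNat : ℤ) (lam.2.toNat : ℤ) := by
    rwa [Int.toNat_of_nonneg h1, Int.toNat_of_nonneg h2]
  rw [element, f_word h', Int.toNat_of_nonneg h1, Int.toNat_of_nonneg h2]
  rfl

theorem minusCount_element (h : s.In lam) (i : Node) :
    (minusCount i (element lam s) : ℤ) = s.ep i := by
  obtain ⟨h1, h2⟩ := h.nonneg
  exact minusCount_word (by rwa [Int.toNat_of_nonneg h1, Int.toNat_of_nonneg h2]) i

theorem f_element_move (h : s.In lam) (i : Node) {k : ℤ} (hk : -s.ep i ≤ k)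
    (hk' : k < s.ph lam.1 lam.2 i) :
    f i (element lam (s.move i k)) = some (element lam (s.move i (k + 1))) := by
  rw [f_element (Str.move_mem h i hk hk'.le), if_pos (by rw [Str.ph_move h i hk]; omega),
    Str.low_move h i hk]

theorem f_element_move_last (h : s.In lam) (i : Node) :
    f i (element lam (s.move i (s.ph lam.1 lam.2 i))) = none := by
  have h1 : -s.ep i ≤ s.ph lam.1 lam.2 i := by
    have := Str.ph_nonneg h i; have := Str.ep_nonneg h i; omega
  rw [f_element (Str.move_mem h i h1 le_rfl), if_neg (by rw [Str.ph_move h i h1]; omega)]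

theorem e_element_move (h : s.In lam) (i : Node) {k : ℤ} (hk : -s.ep i < k)
    (hk' : k ≤ s.ph lam.1 lam.2 i) :
    e i (element lam (s.move i k)) = some (element lam (s.move i (k - 1))) := by
  refine (e_of_f ?_).2
  rw [f_element_move h i (by omega) (by omega), sub_add_cancel]

theorem e_element_move_last (h : s.In lam) (i : Node) :
    e i (element lam (s.move i (-s.ep i))) = none := by
  have h1 : -s.ep i ≤ s.ph lam.1 lam.2 i := by
    have := Str.ph_nonneg h i; have := Str.ep_nonneg h i; omega
  by_contra hne
  obtain ⟨U, hU⟩ := Option.ne_none_iff_exists'.1 hne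
  -- A nonzero e_i forces at least one uncancelled `-`, while `ep` is 0 at this end of the string.
  have h2 := (f_of_e hU).1
  have h3 := minusCount_element (Str.move_mem h i le_rfl h1) i
  rw [Str.ep_move h i le_rfl] at h3
  omega

theorem iter_f_element (h : s.In lam) (i : Node) {k : ℕ} (hk : (k : ℤ) ≤ s.ph lam.1 lam.2 i) :
    iter (f i) k (element lam s) = some (element lam (s.move i k)) := by
  have := iter_of_chain (g := f i) (F := fun k : ℕ => element lam (s.move i k)) (N := k)
    (fun j hj => by
      have := f_element_move h i (k := j) (by have := Str.ep_nonneg h i; omega) (by omega)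
      exact_mod_cast this) le_rfl
  simpa [Str.move_zero h] using this

theorem iter_e_element (h : s.In lam) (i : Node) {k : ℕ} (hk : (k : ℤ) ≤ s.ep i) :
    iter (e i) k (element lam s) = some (element lam (s.move i (-k))) := by
  have := iter_of_chain (g := e i) (F := fun k : ℕ => element lam (s.move i (-k))) (N := k)
    (fun j hj => by
      have := e_element_move h i (k := -j) (by omega) (by have := Str.ph_nonneg h i; omega)
      rw [this]; push_cast; rw [neg_add']) le_rfl
  simpa [Str.move_zero h] using this

theorem phi_element (h : s.In lam) (i : Node) :
    (phi i (element lam s) : ℤ) = s.ph lam.1 lam.2 i := by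
  have h0 := Str.ph_nonneg h i
  have := maxPow_of_chain (g := f i) (F := fun k : ℕ => element lam (s.move i k))
    (N := (s.ph lam.1 lam.2 i).toNat)
    (fun j hj => by
      have := f_element_move h i (k := j) (by have := Str.ep_nonneg h i; omega) (by omega)
      exact_mod_cast this)
    (by rw [Int.toNat_of_nonneg h0]; exact f_element_move_last h i)
  simp only [Nat.cast_zero, Str.move_zero h] at this
  rw [phi, this, Int.toNat_of_nonneg h0]

theorem eps_element (h : s.In lam) (i : Node) :
    (eps i (element lam s) : ℤ) = s.ep i := by
  have h0 := Str.ep_nonneg h i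
  have := maxPow_of_chain (g := e i) (F := fun k : ℕ => element lam (s.move i (-k)))
    (N := (s.ep i).toNat)
    (fun j hj => by
      have := e_element_move h i (k := -j) (by omega) (by have := Str.ph_nonneg h i; omega)
      rw [this]; push_cast; rw [neg_add'])
    (by rw [Int.toNat_of_nonneg h0]; exact e_element_move_last h i)
  simp only [Nat.cast_zero, neg_zero, Str.move_zero h] at this
  rw [eps, this, Int.toNat_of_nonneg h0]

theorem refl_element (h : s.In lam) (i : Node) :
    refl i (element lam s) = some (element lam (s.reverse lam.1 lam.2 i)) := by
  have h1 := phi_element h i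
  have h2 := eps_element h i
  rw [refl, Str.reverse, ← h1, ← h2]
  split_ifs with h0
  · rw [iter_e_element h i (by omega)]
    congr 3; omega
  · rw [iter_f_element h i (by omega)]
    congr 3; omega

/-- Since s₁ is an involution, f₁₂ᵏ = s₁ f₂ᵏ s₁, hence φ₁₂(T) = φ₂(s₁T). The chain is the 2-string
below s₁T, reflected back by s₁. -/
theorem phi12_element (h : s.In lam) :
    (phi12 (element lam s) : ℤ) = (s.reverse lam.1 lam.2 .n1).ph lam.1 lam.2 .n2 := by
  set t := s.reverse lam.1 lam.2 .n1 with ht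
  have hs : t.In lam := Str.reverse_mem h .n1
  have h0 := Str.ph_nonneg hs .n2
  have h3 := Str.ep_nonneg hs .n2
  have key (k : ℕ) (hk : (k : ℤ) ≤ t.ph lam.1 lam.2 .n2) :
      f12 (element lam ((t.move .n2 k).reverse lam.1 lam.2 .n1)) =
        (f .n2 (element lam (t.move .n2 k))).bind (refl .n1) := by
    have hm : (t.move .n2 k).In lam := Str.move_mem hs .n2 (by omega) hk
    rw [f12, refl_element (Str.reverse_mem hm .n1), Str.reverse_reverse hm, Option.bind_some]
  have := maxPow_of_chain (g := f12)
    (F := fun k : ℕ => element lam ((t.move .n2 k).reverse lam.1 lam.2 .n1))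
    (N := (t.ph lam.1 lam.2 .n2).toNat)
    (fun j hj => by
      rw [key j (by omega), f_element_move hs .n2 (by omega) (by omega), Option.bind_some,
        refl_element (Str.move_mem hs .n2 (by omega) (by omega))]
      push_cast; rfl)
    (by
      rw [key _ (by omega), Int.toNat_of_nonneg h0, f_element_move_last hs .n2]; rfl)
  simp only [Nat.cast_zero, Str.move_zero hs] at this
  rw [ht, Str.reverse_reverse h, ← ht] at this
  rw [phi12, this, Int.toNat_of_nonneg h0]

theorem top_element (h : s.In lam) (i : Node) :
    top i (element lam s) = element lam (s.move i (-s.ep i)) := by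
  rw [top, iter_e_element h i (by rw [eps_element h i]), eps_element h i]
  rfl

/-- A string with natural entries. -/
def Str.toNats (s : Str) : ℕ × ℕ × ℕ × ℕ := (s.a.toNat, s.b.toNat, s.c.toNat, s.d.toNat)

/-- Raising to the top of successive strings strips off the entries one by one: (a,b,c,d),
(0,b,c,d), (c,d,0,0), (0,d,0,0). -/
theorem str_element (h : s.In lam) : str (element lam s) = s.toNats := by
  have m1 := Str.move_mem h .n2 (k := -s.ep .n2) le_rfl
    (by have := Str.ep_nonneg h .n2; have := Str.ph_nonneg h .n2; omega)
  set t := s.move .n2 (-s.ep .n2) with ht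
  have t0 : t = ⟨0, s.b, s.c, s.d⟩ := by simp [ht, Str.move, Str.ep]
  have m2 := Str.move_mem m1 .n1 (k := -t.ep .n1) le_rfl
    (by have := Str.ep_nonneg m1 .n1; have := Str.ph_nonneg m1 .n1; omega)
  set u := t.move .n1 (-t.ep .n1) with hu
  have hh := h
  obtain ⟨h1, h2, h3, h4, h5, h6, h7, h8⟩ := h
  -- With a = 0 the inequalities d ≤ c ≤ b make b the largest of the three terms of `ep`.
  have t1 : t.ep .n1 = s.b := by simp only [t0, Str.ep]; omega
  have u0 : u = ⟨s.c, s.d, 0, 0⟩ := by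
    rw [hu, t1]
    simp only [Str.move, t1]
    simp only [t0, Str.dualD, Str.ofDual, Str.ext_iff]
    refine ⟨?_, ?_, ?_, ?_⟩ <;> omega
  have m3 := Str.move_mem m2 .n2 (k := -u.ep .n2) le_rfl
    (by have := Str.ep_nonneg m2 .n2; have := Str.ph_nonneg m2 .n2; omega)
  set v := u.move .n2 (-u.ep .n2) with hv
  have v0 : v = ⟨0, s.d, 0, 0⟩ := by simp [hv, u0, Str.move, Str.ep]
  have v1 : v.ep .n1 = s.d := by simp only [v0, Str.ep]; omega
  have u1 : u.ep .n2 = s.c := by simp only [u0, Str.ep]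
  have e1 := eps_element hh .n2
  have e2 := eps_element m1 .n1
  have e3 := eps_element m2 .n2
  have e4 := eps_element m3 .n1
  rw [str]
  simp only [top_element hh, ← ht, top_element m1, ← hu, top_element m2, ← hv]
  rw [t1] at e2
  rw [u1] at e3
  rw [v1] at e4
  simp only [Str.ep] at e1
  simp only [Str.toNats, Prod.mk.injEq]
  omega

theorem highest_eq_element : highest lam = element lam ⟨0, 0, 0, 0⟩ := by
  rw [highest, element]
  have h2 : ∀ n : ℕ, (List.replicate n [Letter.one, Letter.two]).flatten =
      columnWord n ⟨0, 0, 0, 0⟩ := by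
    intro n
    induction n with
    | zero => rfl
    | succ n ih => simp [List.replicate_succ, columnWord, columnStep, ih]
  rw [h2]
  generalize lam.1.toNat = m
  induction m with
  | zero => rfl
  | succ m ih => simp [List.replicate_succ, word, letterStep, ih]

theorem ofString_toNats (h : s.In lam) : ofString lam s.toNats = some (element lam s) := by
  obtain ⟨g1, g2⟩ := h.nonneg
  obtain ⟨h1, h2, h3, h4, h5, h6, h7, h8⟩ := h
  have m0 : (⟨0, 0, 0, 0⟩ : Str).In lam := by constructor <;> dsimp only <;> omega
  have m1 : (⟨0, s.d, 0, 0⟩ : Str).In lam := by constructor <;> dsimp only <;> omega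
  have m2 : (⟨s.c, s.d, 0, 0⟩ : Str).In lam := by constructor <;> dsimp only <;> omega
  have m3 : (⟨0, s.b, s.c, s.d⟩ : Str).In lam := by constructor <;> dsimp only <;> omega
  have e1 : Str.move .n1 s.d ⟨0, 0, 0, 0⟩ = ⟨0, s.d, 0, 0⟩ := by
    simp only [Str.move, Str.ep, Str.dualD, Str.ofDual, Str.ext_iff]
    refine ⟨?_, ?_, ?_, ?_⟩ <;> omega
  have e2 : Str.move .n2 s.c ⟨0, s.d, 0, 0⟩ = ⟨s.c, s.d, 0, 0⟩ := by simp [Str.move]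
  have e3 : Str.move .n1 s.b ⟨s.c, s.d, 0, 0⟩ = ⟨0, s.b, s.c, s.d⟩ := by
    simp only [Str.move, Str.ep, Str.dualD, Str.ofDual, Str.ext_iff]
    refine ⟨?_, ?_, ?_, ?_⟩ <;> omega
  have e4 : Str.move .n2 s.a ⟨0, s.b, s.c, s.d⟩ = s := by simp [Str.move]
  simp only [ofString, Str.toNats, highest_eq_element]
  rw [iter_f_element m0, Int.toNat_of_nonneg h2, e1, Option.bind_some, iter_f_element m1,
    Int.toNat_of_nonneg (by omega), e2, Option.bind_some, iter_f_element m2,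
    Int.toNat_of_nonneg (by omega), e3, Option.bind_some, iter_f_element m3,
    Int.toNat_of_nonneg (by omega), e4]
  all_goals
    simp only [Str.ph, Str.ep, Str.wt1, Str.wt2]
    omega

theorem element_injOn {t : Str} (hs : s.In lam) (ht : t.In lam)
    (h : element lam s = element lam t) : s = t := by
  have := (str_element hs).symm.trans (h ▸ str_element ht)
  simp only [Str.toNats, Prod.mk.injEq] at this
  obtain ⟨h1, h2, h3, h4, h5, h6, h7, h8⟩ := hs
  obtain ⟨g1, g2, g3, g4, g5, g6, g7, g8⟩ := ht
  ext <;> omega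

theorem reflTransGen_of_iter {i : Node} {U V : Word} {k : ℕ} (h : iter (f i) k U = some V) :
    Relation.ReflTransGen (fun U V => ∃ i, f i U = some V) U V := by
  induction k generalizing V with
  | zero => cases h; exact .refl
  | succ k ih =>
    obtain ⟨W, h1, h2⟩ := Option.bind_eq_some_iff.1 h
    exact (ih h1).tail ⟨i, h2⟩

/-- The polytope contains the zero string and is stable under the nonzero f_i; conversely `ofString`
is a path of f_i's from the highest weight element to any of its points. -/
theorem mem_crystal_iff {T : Word} :
    T ∈ crystal lam ↔ ∃ s : Str, s.In lam ∧ element lam s = T := by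
  constructor
  · rintro ⟨⟨h1, h2⟩, h⟩
    induction h with
    | refl =>
      exact ⟨⟨0, 0, 0, 0⟩, by constructor <;> dsimp only <;> omega, highest_eq_element.symm⟩
    | tail _ hf ih =>
      obtain ⟨s, hs, rfl⟩ := ih
      obtain ⟨i, hi⟩ := hf
      rw [f_element hs] at hi
      split_ifs at hi with h0
      exact ⟨s.low i, Str.low_mem hs i h0, Option.some.inj hi⟩
  · rintro ⟨s, hs, rfl⟩
    refine ⟨hs.nonneg, ?_⟩
    have h := ofString_toNats hs
    rw [ofString] at h
    obtain ⟨W, h, h4⟩ := Option.bind_eq_some_iff.1 h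
    obtain ⟨V, h, h3⟩ := Option.bind_eq_some_iff.1 h
    obtain ⟨U, h1, h2⟩ := Option.bind_eq_some_iff.1 h
    exact (((reflTransGen_of_iter h1).trans (reflTransGen_of_iter h2)).trans
      (reflTransGen_of_iter h3)).trans (reflTransGen_of_iter h4)

theorem wt_cons (x : Letter) (w : Word) : wt (x :: w) = x.wt + wt w := by simp [wt]

theorem wt_columnWord {n : ℕ} {s : Str} (h : s.Mem 0 n) :
    wt (columnWord n s) = (s.wt1 0, s.wt2 n) := by
  induction n generalizing s with
  | zero => rw [h.eq_zero]; simp [columnWord, wt, Str.wt1, Str.wt2]; rfl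
  | succ n ih =>
    push_cast at h ⊢
    rw [columnWord, wt_cons, wt_cons, ih (columnStep_mem h (by omega))]
    rcases columnStep_cases s with ⟨g1, g2, g⟩ | ⟨g1, g2, g⟩ | ⟨g1, g2, g⟩ | ⟨g1, g2, g3, g⟩ |
      ⟨g1, g2, g3, g4, g⟩ | ⟨g1, g2, g3, g4, g⟩ <;> rw [g] <;>
      simp only [Letter.wt, Str.wt1, Str.wt2, Prod.mk_add_mk, Prod.mk.injEq] <;> omega

theorem wt_word {n m : ℕ} {s : Str} (h : s.Mem m n) :
    wt (word n m s) = (s.wt1 m, s.wt2 n) := by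
  induction m generalizing s with
  | zero => exact wt_columnWord (by simpa using h)
  | succ m ih =>
    push_cast at h ⊢
    rw [word, wt_cons, ih (letterStep_mem h (by omega))]
    obtain ⟨h1, h2, h3, h4, h5, h6, h7, h8⟩ := h
    rcases letterStep_cases s with ⟨g1, g⟩ | ⟨g1, g2, g3, g⟩ | ⟨g1, g2, g3, g⟩ |
      ⟨g1, g2, g3, g⟩ | ⟨g1, g2, g3, g⟩ <;> rw [g] <;>
      simp only [Letter.wt, Str.wt1, Str.wt2, Prod.mk_add_mk, Prod.mk.injEq] <;> omega

theorem wt_element (h : s.In lam) :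
    wt (element lam s) = (s.wt1 lam.1, s.wt2 lam.2) := by
  obtain ⟨h1, h2⟩ := h.nonneg
  rw [element, wt_word (by rwa [Int.toNat_of_nonneg h1, Int.toNat_of_nonneg h2]),
    Int.toNat_of_nonneg h1, Int.toNat_of_nonneg h2]

end

/-! ### Preatomic and atomic numbers in terms of strings -/

theorem add_smul_varpi1 (lam : Weight) (k : ℕ) : lam + k • varpi1 = (lam.1 + k, lam.2) := by
  simp [varpi1, Prod.ext_iff]

theorem sub_smul_varpi1 (lam : Weight) (k : ℕ) : lam - k • varpi1 = (lam.1 - k, lam.2) := by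
  simp [varpi1, Prod.ext_iff]

theorem add_smul_varpi2 (lam : Weight) (k : ℕ) : lam + k • varpi2 = (lam.1, lam.2 + k) := by
  simp [varpi2, Prod.ext_iff]

theorem sub_smul_varpi2 (lam : Weight) (k : ℕ) : lam - k • varpi2 = (lam.1, lam.2 - k) := by
  simp [varpi2, Prod.ext_iff]

theorem add_varpi2 (lam : Weight) : lam + varpi2 = (lam.1, lam.2 + 1) := by
  simp [varpi2, Prod.ext_iff]

namespace Str

variable {m n : ℤ} {s : Str}

/-- The string obtained by adding `p (0, 1, 1, 1)`. -/
def up (p : ℤ) (s : Str) : Str := ⟨s.a, s.b + p, s.c + p, s.d + p⟩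

theorem up_injective (p : ℤ) : Function.Injective (up p) := by
  intro s t h
  simp only [up, Str.mk.injEq, add_left_inj] at h
  exact Str.ext h.1 h.2.1 h.2.2.1 h.2.2.2

/-- The preatomic number of the element with string `s`. -/
def preatomic (m : ℤ) (s : Str) : ℤ := min (min s.d (m - s.d)) (m - 2 * s.d + 2 * s.c - s.b)

/-- The strings of the elements of the principal preatom. -/
structure Principal (m n : ℤ) (s : Str) : Prop where
  mem : s.Mem m n
  preatomic_eq : s.preatomic m = 0

/-- Adding (0,1,1,1) and 2ϖ₁ changes only the slacks of 0 ≤ d, d ≤ m and b ≤ m - 2d + 2c, each by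
one. `preatomic` is their minimum. -/
theorem up_mem (h : s.Mem m n) {p : ℤ} (hp : -s.preatomic m ≤ p) :
    (s.up p).Mem (m + 2 * p) n := by
  obtain ⟨h1, h2, h3, h4, h5, h6, h7, h8⟩ := h
  simp only [preatomic] at hp
  constructor <;> simp only [up] <;> omega

theorem preatomic_up (p : ℤ) : (s.up p).preatomic (m + 2 * p) = s.preatomic m + p := by
  simp only [preatomic, up]; omega

theorem preatomic_nonneg (h : s.Mem m n) : 0 ≤ s.preatomic m := by
  obtain ⟨h1, h2, h3, h4, h5, h6, h7, h8⟩ := h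
  simp only [preatomic]; omega

theorem dualD_move (h : s.Mem m n) {k : ℤ} (hk : -s.ep .n1 ≤ k) :
    (s.move .n1 k).dualD = s.dualD := by
  obtain ⟨h1, h2, h3, h4, h5, h6, h7, h8⟩ := h
  simp only [ep, move, ofDual, dualD] at hk ⊢
  omega

/-- Written in the dual coordinates, the preatomic number is symmetric in ε₁ and φ₁ and otherwise
involves only the constants B, C, D of the 1-string. This is why s₁ preserves it. -/
theorem preatomic_eq_min (h : s.Mem m n) :
    s.preatomic m = min (min (min (s.ep .n1) (s.ph m n .n1))
      (min (2 * (s.a + s.c - s.dualD) - (s.b + s.d - s.ep .n1))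
        (s.b + s.d - s.ep .n1 - 2 * s.dualD))) (m + 2 * s.dualD - (s.b + s.d - s.ep .n1)) := by
  obtain ⟨h1, h2, h3, h4, h5, h6, h7, h8⟩ := h
  simp only [preatomic, ph, wt1, ep, dualD]
  rcases le_total (max s.d (2 * s.c - s.b)) (s.b - 2 * s.a) with g | g
  · rw [max_eq_right g]
    rcases le_total s.a (s.b - s.c) with k | k
    · rw [min_eq_left k]
      rcases le_total s.a (s.c - s.d) with l | l
      · rw [min_eq_left l]; omega
      · rw [min_eq_right l]; omega
    · rw [min_eq_right k]; omega
  · rw [max_eq_left g]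
    rcases le_total s.d (2 * s.c - s.b) with k | k
    · rw [max_eq_right k]; omega
    · rw [max_eq_left k]; omega

theorem preatomic_reverse (h : s.Mem m n) :
    (s.reverse m n .n1).preatomic m = s.preatomic m := by
  have hk : -s.ep .n1 ≤ s.ph m n .n1 - s.ep .n1 := by have := ph_nonneg h .n1; omega
  have hb : (s.reverse m n .n1).a + (s.reverse m n .n1).c = s.a + s.c := by
    simp only [reverse, move, ofDual]; omega
  have hc : (s.reverse m n .n1).b + (s.reverse m n .n1).d =
      s.b + s.d + (s.ph m n .n1 - s.ep .n1) := by
    simp only [reverse, move, ofDual]; omega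
  rw [preatomic_eq_min (reverse_mem h .n1), preatomic_eq_min h, ep_reverse h, ph_reverse h, hb, hc,
    reverse, dualD_move h hk]
  generalize s.dualD = D
  generalize s.ph m n .n1 = P
  generalize s.ep .n1 = A
  omega

theorem Principal.reverse (h : s.Principal m n) : (s.reverse m n .n1).Principal m n :=
  ⟨reverse_mem h.mem .n1, by rw [preatomic_reverse h.mem, h.preatomic_eq]⟩

/-! ### Ψ, Ψ̄ and the atomic number on strings. -/

/-- The effect of `Ψ` on strings. -/
def psi (m : ℤ) (s : Str) : Str :=
  if s.d = 0 ∨ s.d = m then ⟨s.a, s.b + 1, s.c + 1, s.d⟩ else ⟨s.a, s.b, s.c + 1, s.d + 1⟩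

/-- The effect of `Ψ̄` on strings. -/
def psiBar (m n : ℤ) (s : Str) : Str :=
  if s.wt1 m ≤ 0 then s.psi m else ((s.reverse m n .n1).psi m).reverse m (n + 1) .n1

/-- The atomic number of an element of the principal preatom of weight `μ` with `μ₁ ≤ 0`. -/
def atomicNeg (m n : ℤ) (s : Str) : ℤ :=
  if s.d = 0 then min s.c (m + 2 * s.c - s.b)
  else (if s.d = m then 2 * s.c - s.b - s.d else 0) + min (s.d - 1) (n + s.d - s.c)

/-- The atomic number of an element of the principal preatom. -/
def atomic (m n : ℤ) (s : Str) : ℤ :=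
  if s.wt1 m ≤ 0 then s.atomicNeg m n else (s.reverse m n .n1).atomicNeg m n

theorem psi_principal (h : s.Principal m n) : (s.psi m).Principal m (n + 1) := by
  obtain ⟨⟨h1, h2, h3, h4, h5, h6, h7, h8⟩, h9⟩ := h
  simp only [preatomic] at h9
  simp only [psi]
  split_ifs <;> refine ⟨by constructor <;> dsimp only <;> omega, ?_⟩ <;>
    simp only [preatomic] <;> omega

theorem wt1_psi : (s.psi m).wt1 m = s.wt1 m := by
  simp only [psi]
  split_ifs <;> simp only [wt1] <;> ring

/-- For d = 0, undoing Ψ uses up the slacks of 0 ≤ c and b ≤ m + 2c. For d > 0, iterating Ψ first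
raises c and d until d = m, then b and c. Backwards there are thus 2c - b - d steps at d = m,
followed by steps lowering d; these stop at d = 1, because a string with d = 0 is moved by the other
rule, or when c ≤ n + d becomes tight. -/
theorem atomicNeg_psi (h : s.Principal m n) :
    (s.psi m).atomicNeg m (n + 1) = s.atomicNeg m n + 1 := by
  obtain ⟨⟨h1, h2, h3, h4, h5, h6, h7, h8⟩, h9⟩ := h
  simp only [preatomic] at h9
  simp only [psi]
  split_ifs with h0 <;> simp only [atomicNeg] <;> split_ifs <;> omega

theorem atomicNeg_nonneg (h : s.Principal m n) : 0 ≤ s.atomicNeg m n := by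
  obtain ⟨⟨h1, h2, h3, h4, h5, h6, h7, h8⟩, h9⟩ := h
  simp only [preatomic] at h9
  simp only [atomicNeg]
  split_ifs <;> omega

theorem exists_psi_eq (h : s.Principal m n) (h0 : 0 < s.atomicNeg m n) :
    ∃ t : Str, t.Principal m (n - 1) ∧ t.psi m = s := by
  obtain ⟨⟨h1, h2, h3, h4, h5, h6, h7, h8⟩, h9⟩ := h
  simp only [preatomic] at h9
  simp only [atomicNeg] at h0
  by_cases hd : s.d = 0 ∨ (s.d = m ∧ 0 < 2 * s.c - s.b - s.d)
  -- At d = m > 0, lowering b and c keeps b ≤ m - 2d + 2c only while 2c - b > d; once equality holds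
  -- the preimage has d = m - 1.
  · refine ⟨⟨s.a, s.b - 1, s.c - 1, s.d⟩, ⟨?_, ?_⟩, ?_⟩
    · split_ifs at h0 <;> constructor <;> dsimp only <;> omega
    · split_ifs at h0 <;> simp only [preatomic] <;> omega
    · simp only [psi]
      rw [if_pos (by omega)]
      simp
  · refine ⟨⟨s.a, s.b, s.c - 1, s.d - 1⟩, ⟨?_, ?_⟩, ?_⟩
    · split_ifs at h0 <;> constructor <;> dsimp only <;> omega
    · split_ifs at h0 <;> simp only [preatomic] <;> omega
    · simp only [psi]
      rw [if_neg (by split_ifs at h0 <;> omega)]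
      simp

theorem wt1_reverse : (s.reverse m n .n1).wt1 m = -s.wt1 m := by
  rw [reverse, wt1_move]
  simp only [ph]; ring

theorem wt2_reverse : (s.reverse m n .n1).wt2 n = s.wt2 n + s.wt1 m := by
  rw [reverse, wt2_move]
  simp only [ph]; ring

theorem psiBar_principal (h : s.Principal m n) : (s.psiBar m n).Principal m (n + 1) := by
  rw [psiBar]
  split_ifs
  · exact psi_principal h
  · exact (psi_principal h.reverse).reverse

theorem wt1_psiBar : (s.psiBar m n).wt1 m = s.wt1 m := by
  rw [psiBar]
  split_ifs
  · exact wt1_psi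
  · rw [wt1_reverse, wt1_psi, wt1_reverse, neg_neg]

theorem atomic_psiBar (h : s.Principal m n) :
    (s.psiBar m n).atomic m (n + 1) = s.atomic m n + 1 := by
  rw [atomic, wt1_psiBar, atomic, psiBar]
  split_ifs
  · exact atomicNeg_psi h
  · rw [reverse_reverse (psi_principal h.reverse).mem, atomicNeg_psi h.reverse]

theorem atomic_nonneg (h : s.Principal m n) : 0 ≤ s.atomic m n := by
  rw [atomic]
  split_ifs
  · exact atomicNeg_nonneg h
  · exact atomicNeg_nonneg h.reverse

theorem exists_psiBar_eq (h : s.Principal m n) (h0 : 0 < s.atomic m n) :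
    ∃ t : Str, t.Principal m (n - 1) ∧ t.psiBar m (n - 1) = s := by
  rw [atomic] at h0
  split_ifs at h0 with hw
  · obtain ⟨t, ht, rfl⟩ := exists_psi_eq h h0
    exact ⟨t, ht, by rw [psiBar, if_pos (by rwa [wt1_psi] at hw)]⟩
  · obtain ⟨t, ht, hts⟩ := exists_psi_eq h.reverse h0
    refine ⟨_, ht.reverse, ?_⟩
    have : t.wt1 m = -s.wt1 m := by rw [← wt1_psi, hts, wt1_reverse]
    rw [psiBar, wt1_reverse, if_neg (by omega), reverse_reverse ht.mem, hts, sub_add_cancel,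
      reverse_reverse h.mem]

end Str

variable {lam : Weight} {s : Str}

theorem Phi_element (h : s.In lam) :
    Phi lam (element lam s) = some (element (lam + 2 • varpi1) (s.up 1)) := by
  have h0 := Str.preatomic_nonneg h
  have hu : (s.up 1).In (lam + 2 • varpi1) := by
    have := Str.up_mem h (p := 1) (by omega)
    rw [add_smul_varpi1]
    exact_mod_cast this
  rw [Phi, str_element h, ← ofString_toNats hu]
  obtain ⟨h1, h2, h3, h4, h5, h6, h7, h8⟩ := h
  congr 1
  simp only [Str.toNats, Str.up, Prod.mk.injEq, true_and]
  omega

theorem Str.In.up {s : Str} (h : s.In lam) (p : ℕ) :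
    (s.up p).In (lam + (2 * p) • varpi1) := by
  have := Str.up_mem h (p := p) (by have := Str.preatomic_nonneg h; omega)
  rw [add_smul_varpi1]
  exact_mod_cast this

theorem PhiPow_element (h : s.In lam) (p : ℕ) :
    PhiPow lam p (element lam s) = some (element (lam + (2 * p) • varpi1) (s.up p)) := by
  induction p with
  | zero => simp [PhiPow, Str.up]
  | succ p ih =>
    rw [PhiPow, ih, Option.bind_some, Phi_element (h.up p), add_assoc, ← add_smul]
    congr 2
    simp only [Str.up, Str.mk.injEq, true_and]
    push_cast
    omega

theorem exists_PhiPow_iff (h : s.In lam) (p : ℕ) :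
    (∃ U ∈ crystal (lam - (2 * p) • varpi1),
      PhiPow (lam - (2 * p) • varpi1) p U = some (element lam s)) ↔
    (p : ℤ) ≤ s.preatomic lam.1 := by
  constructor
  · rintro ⟨U, hU, hp⟩
    obtain ⟨t, ht, rfl⟩ := mem_crystal_iff.1 hU
    have hu := ht.up p
    rw [PhiPow_element ht] at hp
    rw [sub_add_cancel] at hp hu
    rw [← element_injOn hu h (Option.some.inj hp)]
    have h0 := Str.preatomic_nonneg ht
    have := Str.preatomic_up (m := lam.1 - 2 * p) (s := t) p
    rw [sub_smul_varpi1] at h0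
    push_cast at h0
    rw [sub_add_cancel] at this
    omega
  · intro hp
    have hu : (s.up (-p)).In (lam - (2 * p) • varpi1) := by
      have := Str.up_mem h (p := -p) (by omega)
      rw [sub_smul_varpi1]
      push_cast
      simpa [sub_eq_add_neg] using this
    refine ⟨_, mem_crystal_iff.2 ⟨_, hu, rfl⟩, ?_⟩
    rw [PhiPow_element hu, sub_add_cancel]
    simp [Str.up]

theorem pat_element (h : s.In lam) : (pat lam (element lam s) : ℤ) = s.preatomic lam.1 := by
  have h0 := Str.preatomic_nonneg h
  have : {p : ℕ | ∃ U ∈ crystal (lam - (2 * p) • varpi1),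
      PhiPow (lam - (2 * p) • varpi1) p U = some (element lam s)} =
      Set.Iic (s.preatomic lam.1).toNat := by
    ext p
    rw [Set.mem_ofPred_eq, exists_PhiPow_iff h, Set.mem_Iic]
    omega
  rw [pat, this, csSup_Iic, Int.toNat_of_nonneg h0]

theorem mem_principalPreatom_iff {T : Word} :
    T ∈ principalPreatom lam ↔ ∃ s : Str, s.Principal lam.1 lam.2 ∧ element lam s = T := by
  have key (s : Str) (h : s.In lam) : (∃ U ∈ crystal (lam - 2 • varpi1),
      Phi (lam - 2 • varpi1) U = some (element lam s)) ↔ 1 ≤ s.preatomic lam.1 := by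
    have := exists_PhiPow_iff h 1
    simpa [PhiPow] using this
  constructor
  · rintro ⟨hT, h2⟩
    obtain ⟨s, hs, rfl⟩ := mem_crystal_iff.1 hT
    refine ⟨s, ⟨hs, ?_⟩, rfl⟩
    rw [key s hs] at h2
    have h0 := Str.preatomic_nonneg hs
    by_cases hl : 2 ≤ lam.1
    · have := h2 hl; omega
    -- For λ₁ ≤ 1 one of d and λ₁ - d is 0, so the preatomic number vanishes automatically.
    · simp only [Str.preatomic] at *; omega
  · rintro ⟨s, hs, rfl⟩
    refine ⟨mem_crystal_iff.2 ⟨s, hs.mem, rfl⟩, fun _ => ?_⟩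
    rw [key s hs.mem, hs.preatomic_eq]
    omega

theorem Psi_element (h : s.Principal lam.1 lam.2) :
    Psi lam (element lam s) = some (element (lam + varpi2) (s.psi lam.1)) := by
  have hp : (s.psi lam.1).In (lam + varpi2) := by
    rw [add_varpi2]; exact (Str.psi_principal h).mem
  rw [Psi, str_element h.mem, ← ofString_toNats hp]
  obtain ⟨⟨h1, h2, h3, h4, h5, h6, h7, h8⟩, h9⟩ := h
  change ofString _ (if s.d.toNat = 0 ∨ (s.d.toNat : ℤ) = lam.1 then
    (s.a.toNat, s.b.toNat + 1, s.c.toNat + 1, s.d.toNat) else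
    (s.a.toNat, s.b.toNat, s.c.toNat + 1, s.d.toNat + 1)) = _
  simp only [Str.toNats, Str.psi]
  by_cases h0 : s.d = 0 ∨ s.d = lam.1
  · rw [if_pos h0, if_pos (by omega)]
    congr 1
    simp only [Prod.mk.injEq, true_and, and_true]
    omega
  · rw [if_neg h0, if_neg (by omega)]
    congr 1
    simp only [Prod.mk.injEq, true_and, and_true]
    omega

theorem PsiBar_element (h : s.Principal lam.1 lam.2) :
    PsiBar lam (element lam s) = some (element (lam + varpi2) (s.psiBar lam.1 lam.2)) := by
  rw [PsiBar, wt_element h.mem, Str.psiBar]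
  split_ifs with h0
  · exact Psi_element h
  · rw [refl_element h.mem, Option.bind_some, Psi_element h.reverse, Option.bind_some,
      refl_element (by rw [add_varpi2]; exact (Str.psi_principal h.reverse).mem), add_varpi2]

/-- The effect of `Ψ̄^k` on strings. -/
def Str.psiBarPow (m n : ℤ) : ℕ → Str → Str
  | 0, s => s
  | k + 1, s => (psiBarPow m n k s).psiBar m (n + k)

theorem Str.psiBarPow_principal {m n : ℤ} {s : Str} (h : s.Principal m n) (k : ℕ) :
    (s.psiBarPow m n k).Principal m (n + k) := by
  induction k with
  | zero => simpa [psiBarPow] using h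
  | succ k ih =>
    push_cast
    rw [← add_assoc]
    exact psiBar_principal ih

theorem Str.atomic_psiBarPow {m n : ℤ} {s : Str} (h : s.Principal m n) (k : ℕ) :
    (s.psiBarPow m n k).atomic m (n + k) = s.atomic m n + k := by
  induction k with
  | zero => simp [psiBarPow]
  | succ k ih =>
    push_cast
    rw [← add_assoc, psiBarPow, atomic_psiBar (psiBarPow_principal h k), ih, add_assoc]

theorem Str.exists_psiBarPow_eq {m n : ℤ} {s : Str} (h : s.Principal m n) (k : ℕ)
    (hk : (k : ℤ) ≤ s.atomic m n) :
    ∃ t : Str, t.Principal m (n - k) ∧ t.psiBarPow m (n - k) k = s := by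
  induction k generalizing s n with
  | zero => exact ⟨s, by simpa using h, rfl⟩
  | succ k ih =>
    obtain ⟨t, ht, rfl⟩ := exists_psiBar_eq h (by push_cast at hk; omega)
    have h1 := atomic_psiBar ht
    rw [sub_add_cancel] at h1
    obtain ⟨u, hu, rfl⟩ := ih ht (by push_cast at hk; omega)
    push_cast
    have e : n - 1 - (k : ℤ) = n - (k + 1) := by ring
    rw [e] at hu
    refine ⟨u, hu, ?_⟩
    rw [psiBarPow, e]
    congr 1
    ring

theorem PsiBarPow_element (h : s.Principal lam.1 lam.2) (k : ℕ) :
    PsiBarPow lam k (element lam s) =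
      some (element (lam + k • varpi2) (s.psiBarPow lam.1 lam.2 k)) := by
  induction k with
  | zero => simp [PsiBarPow, Str.psiBarPow]
  | succ k ih =>
    rw [PsiBarPow, ih, Option.bind_some, PsiBar_element, add_assoc, ← succ_nsmul,
      Str.psiBarPow]
    · simp only [add_smul_varpi2]
    · rw [add_smul_varpi2]; exact Str.psiBarPow_principal h k

theorem preatomWeight_element (h : s.In lam) :
    preatomWeight lam (element lam s) = (lam.1 - 2 * s.preatomic lam.1, lam.2) := by
  have := pat_element h
  rw [preatomWeight, sub_smul_varpi1]
  push_cast
  rw [this]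

/-- The projection of a string to the principal preatom. -/
def Str.core (m : ℤ) (s : Str) : Str := s.up (-s.preatomic m)

theorem Str.core_principal {m n : ℤ} {s : Str} (h : s.Mem m n) :
    (s.core m).Principal (m - 2 * s.preatomic m) n := by
  have h1 := up_mem h (p := -s.preatomic m) le_rfl
  have h2 := preatomic_up (m := m) (s := s) (-s.preatomic m)
  rw [show m + 2 * -s.preatomic m = m - 2 * s.preatomic m by ring] at h1 h2
  exact ⟨h1, by rw [core, h2]; ring⟩

/-- Each Ψ̄ raises `atomic` by exactly one, and a string with positive `atomic` has a preimage, so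
being in the image of the k-th power means k ≤ `atomic`. -/
theorem atomicNumber_element (h : s.In lam) :
    (atomicNumber lam (element lam s) : ℤ) =
      (s.core lam.1).atomic (lam.1 - 2 * s.preatomic lam.1) lam.2 := by
  have hw := preatomWeight_element h
  have hpat := pat_element h
  have hc := Str.core_principal h
  have h0 := Str.atomic_nonneg hc
  set w := preatomWeight lam (element lam s) with hw'
  have hw0 : w + (2 * pat lam (element lam s)) • varpi1 = lam := by
    rw [hw', preatomWeight, sub_add_cancel]
  have hc' : (s.core lam.1).Principal w.1 w.2 := by rw [hw]; exact hc
  have hup : (s.core lam.1).up (pat lam (element lam s) : ℤ) = s := by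
    rw [hpat]; simp [Str.core, Str.up]
  have : {k : ℕ | ∃ V ∈ principalPreatom (w - k • varpi2),
      (PsiBarPow (w - k • varpi2) k V).bind
        (PhiPow w (pat lam (element lam s))) = some (element lam s)} =
      Set.Iic ((s.core lam.1).atomic (lam.1 - 2 * s.preatomic lam.1) lam.2).toNat := by
    ext k
    rw [Set.mem_ofPred_eq, Set.mem_Iic]
    constructor
    · rintro ⟨V, hV, hk⟩
      obtain ⟨t, ht, rfl⟩ := mem_principalPreatom_iff.1 hV
      have h1 := Str.psiBarPow_principal ht k
      have h2 := Str.atomic_psiBarPow ht k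
      have h3 := Str.atomic_nonneg ht
      rw [PsiBarPow_element ht, sub_add_cancel, Option.bind_some] at hk
      simp only [sub_smul_varpi2, sub_add_cancel] at h1 h2 h3 hk
      rw [PhiPow_element h1.mem, hw0] at hk
      have h4 := Str.In.up (lam := w) h1.mem (pat lam (element lam s))
      rw [hw0] at h4
      have h5 := element_injOn h4 h (Option.some.inj hk)
      have h6 : Str.psiBarPow w.1 (w.2 - k) k t = s.core lam.1 :=
        Str.up_injective _ (h5.trans hup.symm)
      rw [h6, hw] at h2
      simp only [hw] at h3
      simp only at h2
      omega
    · intro hk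
      obtain ⟨t, ht, hts⟩ := Str.exists_psiBarPow_eq hc' k (by rw [hw]; simp only; omega)
      have ht' : t.Principal (w - k • varpi2).1 (w - k • varpi2).2 := by
        rw [sub_smul_varpi2]; exact ht
      refine ⟨_, mem_principalPreatom_iff.2 ⟨t, ht', rfl⟩, ?_⟩
      rw [PsiBarPow_element ht', sub_add_cancel, Option.bind_some]
      simp only [sub_smul_varpi2, hts]
      rw [PhiPow_element hc'.mem, hw0, hup]
  rw [atomicNumber, ← hw', this, csSup_Iic, Int.toNat_of_nonneg h0]

/-! ### Lower sets of the Bruhat order -/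

/-- The weights in the convex hull of `W λ` that are congruent to `λ` modulo the root lattice. -/
structure Hull (lam μ : Weight) : Prop where
  x_le : μ.1 + μ.2 ≤ lam.1 + lam.2
  le_x : -(lam.1 + lam.2) ≤ μ.1 + μ.2
  y_le : μ.2 ≤ lam.1 + lam.2
  le_y : -(lam.1 + lam.2) ≤ μ.2
  add_le : μ.1 + 2 * μ.2 ≤ lam.1 + 2 * lam.2
  le_add : -(lam.1 + 2 * lam.2) ≤ μ.1 + 2 * μ.2
  sub_le : μ.1 ≤ lam.1 + 2 * lam.2
  le_sub : -(lam.1 + 2 * lam.2) ≤ μ.1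
  parity : (μ.1 - lam.1) % 2 = 0

theorem sub_smul_fst (v μ : Weight) (k : ℤ) : (μ - k • v).1 = μ.1 - k * v.1 := rfl

theorem sub_smul_snd (v μ : Weight) (k : ℤ) : (μ - k • v).2 = μ.2 - k * v.2 := rfl

theorem PosRoot.pair_sub (β : PosRoot) (μ : Weight) (k : ℤ) :
    β.pair (μ - k • β.vec) = β.pair μ - 2 * k := by
  cases β <;> simp only [pair, sub_smul_fst, sub_smul_snd, vec, coroot] <;> ring

/-- A step moves by a multiple of β within the segment from μ to s_β μ, and the hull is convex and
Weyl-invariant. -/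
theorem Hull.of_step {lam μ ν : Weight} (h : Hull lam μ) (hs : BruhatStep ν μ) :
    Hull lam ν := by
  obtain ⟨β, M, rfl, hM⟩ := hs
  obtain ⟨h1, h2, h3, h4, h5, h6, h7, h8, h9⟩ := h
  cases β <;> simp only [PosRoot.pair, PosRoot.coroot] at hM <;> constructor <;>
    simp only [PosRoot.pair, sub_smul_fst, sub_smul_snd, PosRoot.vec,
      PosRoot.coroot] <;> omega

theorem hull_self {lam : Weight} (hl : Dominant lam) : Hull lam lam := by
  obtain ⟨h1, h2⟩ := hl
  constructor <;> omega

theorem hull_of_bruhatLE {lam μ : Weight} (hl : Dominant lam) (h : BruhatLE μ lam) :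
    Hull lam μ := by
  induction h using Relation.ReflTransGen.head_induction_on with
  | refl => exact hull_self hl
  | head h1 _ ih => exact ih.of_step h1

/-- The condition for `μ < μ - k β`. -/
def Upward (p k : ℤ) : Prop := (k < 0 ∧ k ≤ p) ∨ (0 < k ∧ p < k)

theorem bruhatStep_of_upward {β : PosRoot} {μ : Weight} {k : ℤ} (h : Upward (β.pair μ) k) :
    BruhatStep μ (μ - k • β.vec) := by
  refine ⟨β, β.pair μ - k, ?_, ?_⟩
  · rw [PosRoot.pair_sub]
    ext <;> simp only [sub_smul_fst, sub_smul_snd] <;> ring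
  · rw [PosRoot.pair_sub]
    unfold Upward at h
    omega

/-- The height is 2⟨μ, ρ^∨⟩. A non-dominant μ is raised by a simple reflection. A dominant one moves
along the boundary edge it lies on, by α₂ or α₁, and otherwise by α₂₁. -/
theorem exists_step_of_hull {lam μ : Weight} (hl : Dominant lam) (h : Hull lam μ) (hne : μ ≠ lam) :
    ∃ ν, BruhatStep μ ν ∧ Hull lam ν ∧ 3 * μ.1 + 4 * μ.2 < 3 * ν.1 + 4 * ν.2 := by
  have key (β : PosRoot) (k : ℤ) (hk : k < 0) (hp : k ≤ β.pair μ)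
      (hh : Hull lam (μ - k • β.vec)) (hr : 0 < 3 * β.vec.1 + 4 * β.vec.2) :
      ∃ ν, BruhatStep μ ν ∧ Hull lam ν ∧ 3 * μ.1 + 4 * μ.2 < 3 * ν.1 + 4 * ν.2 := by
    refine ⟨_, bruhatStep_of_upward (Or.inl ⟨hk, hp⟩), hh, ?_⟩
    rw [sub_smul_fst, sub_smul_snd]
    nlinarith
  obtain ⟨h1, h2, h3, h4, h5, h6, h7, h8, h9⟩ := h
  obtain ⟨hl1, hl2⟩ := hl
  by_cases c1 : μ.1 < 0
  · refine key .a1 μ.1 c1 (by simp [PosRoot.pair, PosRoot.coroot]) ?_ (by simp [PosRoot.vec])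
    constructor <;> simp only [sub_smul_fst, sub_smul_snd, PosRoot.vec] <;> omega
  by_cases c2 : μ.2 < 0
  · refine key .a2 μ.2 c2 (by simp [PosRoot.pair, PosRoot.coroot]) ?_ (by simp [PosRoot.vec])
    constructor <;> simp only [sub_smul_fst, sub_smul_snd, PosRoot.vec] <;> omega
  by_cases c3 : μ.1 + μ.2 = lam.1 + lam.2
  · have c4 : μ.2 ≠ lam.2 := fun e => hne (Prod.ext (by omega) e)
    refine key .a2 (-1) (by omega) (by simp [PosRoot.pair, PosRoot.coroot]; omega) ?_
      (by simp [PosRoot.vec])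
    constructor <;> simp only [sub_smul_fst, sub_smul_snd, PosRoot.vec] <;> omega
  by_cases c4 : μ.1 + 2 * μ.2 = lam.1 + 2 * lam.2
  · refine key .a1 (-1) (by omega) (by simp [PosRoot.pair, PosRoot.coroot]; omega) ?_
      (by simp [PosRoot.vec])
    constructor <;> simp only [sub_smul_fst, sub_smul_snd, PosRoot.vec] <;> omega
  -- Adding α₂₁ raises μ₁ + 2μ₂ by 2; the parity condition guarantees that much room.
  · refine key .a21 (-1) (by omega) (by simp [PosRoot.pair, PosRoot.coroot]; omega) ?_
      (by simp [PosRoot.vec])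
    constructor <;> simp only [sub_smul_fst, sub_smul_snd, PosRoot.vec] <;> omega

theorem bruhatLE_of_hull {lam μ : Weight} (hl : Dominant lam) (h : Hull lam μ) :
    BruhatLE μ lam := by
  induction hN : (4 * (lam.1 + lam.2) - (3 * μ.1 + 4 * μ.2)).toNat using Nat.strong_induction_on
    generalizing μ with
  | _ N ih =>
    by_cases hne : μ = lam
    · rw [hne]; exact .refl
    · obtain ⟨ν, hs, hν, hr⟩ := exists_step_of_hull hl h hne
      refine .head hs (ih _ ?_ hν rfl)
      obtain ⟨h1, h2, h3, h4, h5, h6, h7, h8, h9⟩ := hν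
      omega

theorem bruhatLE_iff_hull {lam μ : Weight} (hl : Dominant lam) : BruhatLE μ lam ↔ Hull lam μ :=
  ⟨hull_of_bruhatLE hl, bruhatLE_of_hull hl⟩

/-! ### Edges of the Bruhat graph -/

/-- The squared length of a weight. -/
def normSq (μ : Weight) : ℤ := (μ.1 + μ.2) ^ 2 + μ.2 ^ 2

/-- A strict linear preorder containing the Bruhat order. -/
def RankLT (ν μ : Weight) : Prop :=
  normSq ν < normSq μ ∨ (normSq ν = normSq μ ∧ 3 * ν.1 + 4 * ν.2 < 3 * μ.1 + 4 * μ.2)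

theorem RankLT.trans {μ ν κ : Weight} (h1 : RankLT μ ν) (h2 : RankLT ν κ) : RankLT μ κ := by
  unfold RankLT at *; omega

theorem normSq_sub (β : PosRoot) (μ : Weight) (k : ℤ) :
    normSq (μ - k • β.vec) = normSq μ - normSq β.vec * (k * (β.pair μ - k)) := by
  cases β <;> simp only [normSq, sub_smul_fst, sub_smul_snd, PosRoot.vec,
    PosRoot.pair, PosRoot.coroot] <;> ring

/-- With p = ⟨μ, β^∨⟩ the squared length drops by |β|²(p - M)M. This vanishes only for M = 0, a
linear reflection, where the height decides. -/
theorem rankLT_of_step {μ ν : Weight} (h : BruhatStep ν μ) : RankLT ν μ := by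
  obtain ⟨β, M, rfl, hM⟩ := h
  have hβ : 0 < normSq β.vec := by cases β <;> simp [normSq, PosRoot.vec]
  have hr : 0 < 3 * β.vec.1 + 4 * β.vec.2 := by cases β <;> simp [PosRoot.vec]
  unfold RankLT
  rw [normSq_sub, sub_smul_fst, sub_smul_snd]
  have e : β.pair μ - (β.pair μ - M) = M := by ring
  rw [e]
  rcases hM with ⟨h1, h2⟩ | ⟨h1, h2⟩
  · rcases h1.eq_or_lt with rfl | h1
    · right; constructor
      · ring
      · nlinarith
    · left
      have : 0 < (β.pair μ - M) * M := mul_pos (by omega) h1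
      nlinarith
  · left
    have : 0 < (β.pair μ - M) * M := mul_pos_of_neg_of_neg (by omega) h1
    nlinarith

theorem eq_or_rankLT {μ ν : Weight} (h : BruhatLE μ ν) : μ = ν ∨ RankLT μ ν := by
  induction h with
  | refl => exact Or.inl rfl
  | tail _ hs ih =>
    right
    rcases ih with rfl | ih
    · exact rankLT_of_step hs
    · exact ih.trans (rankLT_of_step hs)

/-- Two distinct weights on a β-line are always related by one elementary step, in one direction or
the other. By strictness of `RankLT`, chains leaving the line cannot produce the opposite
comparison. -/
theorem bruhatLE_sub_iff {β : PosRoot} {μ : Weight} {k : ℤ} (hk : k ≠ 0) :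
    BruhatLE μ (μ - k • β.vec) ↔ Upward (β.pair μ) k := by
  constructor
  · intro h
    by_contra hu
    have hu' : Upward (β.pair (μ - k • β.vec)) (-k) := by
      rw [PosRoot.pair_sub]; unfold Upward at *; omega
    have h1 := rankLT_of_step (bruhatStep_of_upward hu')
    have e : μ - k • β.vec - (-k) • β.vec = μ := by simp
    rw [e] at h1
    rcases eq_or_rankLT h with h2 | h2
    · rw [← h2] at h1; unfold RankLT at h1; omega
    · have := h1.trans h2; unfold RankLT at this; omega
  · intro h
    exact .single (bruhatStep_of_upward h)

theorem PosRoot.smul_eq_smul {β β' : PosRoot} {μ : Weight} {k l : ℤ}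
    (h : μ - k • β.vec = μ - l • β'.vec) (hk : k ≠ 0) : β = β' ∧ k = l := by
  have h1 := congrArg Prod.fst h
  have h2 := congrArg Prod.snd h
  simp only [sub_smul_fst, sub_smul_snd] at h1 h2
  cases β <;> cases β' <;> simp only [vec] at h1 h2 <;> simp <;> omega

theorem PosRoot.sub_smul_eq_self {β : PosRoot} {μ : Weight} {k : ℤ} :
    μ - k • β.vec = μ ↔ k = 0 := by
  constructor
  · intro h
    have h1 := congrArg Prod.fst h
    have h2 := congrArg Prod.snd h
    simp only [sub_smul_fst, sub_smul_snd] at h1 h2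
    cases β <;> simp only [vec] at h1 h2 <;> omega
  · rintro rfl; simp

theorem isEdge_sub_iff {lam : Weight} (hl : Dominant lam) {β : PosRoot} {μ : Weight} {k : ℤ} :
    IsEdge lam β μ (μ - k • β.vec) ↔
      Hull lam μ ∧ Hull lam (μ - k • β.vec) ∧ Upward (β.pair μ) k := by
  rw [IsEdge, bruhatLE_iff_hull hl, bruhatLE_iff_hull hl]
  constructor
  · rintro ⟨h1, h2, h3, h4, -⟩
    have hk : k ≠ 0 := fun h => h3 (PosRoot.sub_smul_eq_self.2 h).symm
    exact ⟨h1, h2, (bruhatLE_sub_iff hk).1 h4⟩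
  · rintro ⟨h1, h2, h3⟩
    have hk : k ≠ 0 := by unfold Upward at h3; omega
    exact ⟨h1, h2, fun h => hk (PosRoot.sub_smul_eq_self.1 h.symm), (bruhatLE_sub_iff hk).2 h3,
      k, rfl⟩

theorem edgeLabel_sub (β : PosRoot) (μ : Weight) (k : ℤ) :
    edgeLabel β μ (μ - k • β.vec) = ⟨-β.coroot.1, -β.coroot.2, k - β.pair μ⟩ := by
  have : β.pair (μ + (μ - k • β.vec)) = 2 * (β.pair μ - k) := by
    cases β <;> simp [PosRoot.pair, PosRoot.vec, PosRoot.coroot] <;> ring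
  rw [edgeLabel, this]
  ext
  · rfl
  · rfl
  · simp

theorem edgeLabel_sub_swap (β : PosRoot) (μ : Weight) (k : ℤ) :
    edgeLabel β (μ - k • β.vec) μ = ⟨-β.coroot.1, -β.coroot.2, k - β.pair μ⟩ := by
  rw [← edgeLabel_sub, edgeLabel, edgeLabel, add_comm]

/-! ### The lengths of root strings in lower sets -/

/-- The maximal `k` such that `μ - k β` lies in the lower set of `λ`. -/
def reach (lam : Weight) : PosRoot → Weight → ℤ
  | .a1, μ => min (min (lam.1 + lam.2 + (μ.1 + μ.2)) (lam.1 + lam.2 - μ.2))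
      ((lam.1 + 2 * lam.2 + μ.1) / 2)
  | .a2, μ => min ((lam.1 + lam.2 + μ.2) / 2)
      ((lam.1 + 2 * lam.2 + μ.2 - max (μ.1 + μ.2) (-(μ.1 + μ.2))) / 2)
  | .a12, μ => min ((lam.1 + lam.2 + (μ.1 + μ.2)) / 2)
      ((lam.1 + 2 * lam.2 + (μ.1 + μ.2) - max μ.2 (-μ.2)) / 2)
  | .a21, μ => min (lam.1 + lam.2 + min (μ.1 + μ.2) μ.2)
      ((lam.1 + 2 * lam.2 + (μ.1 + 2 * μ.2)) / 2)

/-- The lower end mirrors the upper one, because s_β exchanges k and ⟨μ, β^∨⟩ - k. -/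
theorem hull_sub_iff {lam μ : Weight} (h : Hull lam μ) (β : PosRoot) (k : ℤ) :
    Hull lam (μ - k • β.vec) ↔ k ≤ reach lam β μ ∧ β.pair μ - reach lam β μ ≤ k := by
  obtain ⟨h1, h2, h3, h4, h5, h6, h7, h8, h9⟩ := h
  have e : Hull lam (μ - k • β.vec) ↔ _ ∧ _ ∧ _ ∧ _ ∧ _ ∧ _ ∧ _ ∧ _ ∧ _ :=
    ⟨fun h => ⟨h.1, h.2, h.3, h.4, h.5, h.6, h.7, h.8, h.9⟩,
      fun ⟨h1, h2, h3, h4, h5, h6, h7, h8, h9⟩ => ⟨h1, h2, h3, h4, h5, h6, h7, h8, h9⟩⟩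
  rw [e]
  cases β <;> simp only [sub_smul_fst, sub_smul_snd, PosRoot.vec, PosRoot.pair,
    PosRoot.coroot, reach] <;> omega

theorem reach_nonneg {lam μ : Weight} (h : Hull lam μ) (β : PosRoot) :
    0 ≤ reach lam β μ ∧ β.pair μ ≤ reach lam β μ := by
  have := (hull_sub_iff h β 0).1 (by simpa using h)
  omega

theorem phiHat_eq_reach {lam μ : Weight} (hl : Dominant lam) (h : Hull lam μ) (β : PosRoot) :
    phiHat β μ lam = reach lam β μ := by
  have h0 := reach_nonneg h β
  refine IsGreatest.csSup_eq ⟨?_, fun k hk => ?_⟩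
  · exact bruhatLE_of_hull hl ((hull_sub_iff h β _).2 (by omega))
  · exact ((hull_sub_iff h β k).1 (hull_of_bruhatLE hl hk)).1

theorem reach_sub {lam μ : Weight} (β : PosRoot) (k : ℤ) (h : Hull lam μ)
    (hk : Hull lam (μ - k • β.vec)) : reach lam β (μ - k • β.vec) = reach lam β μ - k := by
  obtain ⟨h1, h2, h3, h4, h5, h6, h7, h8, h9⟩ := h
  obtain ⟨k1, k2, k3, k4, k5, k6, k7, k8, k9⟩ := hk
  cases β <;> simp only [sub_smul_fst, sub_smul_snd, PosRoot.vec, reach] at * <;>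
    omega

/-! ### Twisted lengths -/

/-- The index `j` with `mδ - β^∨ = tRoot j` (negative if there is none). -/
def tIndex (m : ℤ) : PosRoot → ℤ
  | .a1 => -1
  | .a2 => 4 * m - 1
  | .a12 => 4 * m - 3
  | .a21 => 2 * m - 2

theorem eq_tRoot_iff (β : PosRoot) (m : ℤ) (j : ℕ) :
    (⟨-β.coroot.1, -β.coroot.2, m⟩ : AffCoroot) = tRoot j ↔ (j : ℤ) = tIndex m β := by
  obtain ⟨h0, h1, h2, h3⟩ := tRoot_eq (j / 4)
  have hj : j = 4 * (j / 4) ∨ j = 4 * (j / 4) + 1 ∨ j = 4 * (j / 4) + 2 ∨ j = 4 * (j / 4) + 3 := by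
    omega
  generalize j / 4 = M at *
  rcases hj with rfl | rfl | rfl | rfl
  · rw [h0]; cases β <;> simp [AffCoroot.ext_iff, PosRoot.coroot, tIndex] <;> omega
  · rw [h1]; cases β <;> simp [AffCoroot.ext_iff, PosRoot.coroot, tIndex] <;> omega
  · rw [h2]; cases β <;> simp [AffCoroot.ext_iff, PosRoot.coroot, tIndex] <;> omega
  · rw [h3]; cases β <;> simp [AffCoroot.ext_iff, PosRoot.coroot, tIndex] <;> omega

theorem mem_inversions_natCast_iff (β : PosRoot) (m : ℤ) (j : ℕ) :
    (⟨-β.coroot.1, -β.coroot.2, m⟩ : AffCoroot) ∈ inversions j ↔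
      0 ≤ tIndex m β ∧ tIndex m β < j := by
  rw [inversions, Set.mem_ofPred_eq]
  simp only [eq_tRoot_iff, Nat.cast_lt]
  constructor
  · rintro ⟨i, hi, h⟩; omega
  · rintro ⟨h1, h2⟩
    exact ⟨(tIndex m β).toNat, by omega, by omega⟩

theorem mem_inversions_top_iff (β : PosRoot) (m : ℤ) :
    (⟨-β.coroot.1, -β.coroot.2, m⟩ : AffCoroot) ∈ inversions ⊤ ↔ 0 ≤ tIndex m β := by
  rw [inversions, Set.mem_ofPred_eq]
  simp only [eq_tRoot_iff]
  constructor
  · rintro ⟨i, -, h⟩; omega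
  · intro h
    exact ⟨(tIndex m β).toNat, ENat.natCast_lt_top _, by omega⟩

/-- The maximal `m` with `mδ - β^∨ ∈ N(y_j)`. -/
def inversionBound (j : ℤ) : PosRoot → ℤ
  | .a1 => 0
  | .a2 => j / 4
  | .a12 => (j + 2) / 4
  | .a21 => (j + 1) / 2

/-- The number of arrows in direction `β` pointing to a weight `μ` with `⟨μ, β^∨⟩ = p`, if
`μ - k β ≤ λ` for `p - R ≤ k ≤ R` and the arrows with labels `δ - β^∨, …, Mδ - β^∨` are inverted. -/
def arrowCount (R p M : ℤ) : ℤ := if 0 ≤ p + M then min R (p + M) else min (R - p) (-p - M - 1)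

noncomputable def arrowSet (R p M : ℤ) : Finset ℤ :=
  if 0 ≤ p + M then Finset.Ioc 0 (min R (p + M)) else Finset.Ico (max (p - R) (p + M + 1)) 0

theorem mem_arrowSet {R p M k : ℤ} (hR : p - R ≤ 0) (hR' : 0 ≤ R) :
    k ∈ arrowSet R p M ↔
      (k ≤ R ∧ p - R ≤ k) ∧ ((0 < k ∧ k ≤ p + M) ∨ (k < 0 ∧ p + M < k)) := by
  rw [arrowSet]
  split_ifs
  · rw [Finset.mem_Ioc]; omega
  · rw [Finset.mem_Ico]; omega

theorem card_arrowSet {R p M : ℤ} (hR : p ≤ R) (hR' : 0 ≤ R) :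
    ((arrowSet R p M).card : ℤ) = arrowCount R p M := by
  rw [arrowSet, arrowCount]
  split_ifs
  · rw [Int.card_Ioc]; omega
  · rw [Int.card_Ico]; omega

theorem sub_smul_sub_smul (μ v : Weight) (k : ℤ) : μ - k • v - (-k) • v = μ := by simp

theorem isEdge_sub_left_iff {lam : Weight} (hl : Dominant lam) {β : PosRoot} {μ : Weight} {k : ℤ} :
    IsEdge lam β (μ - k • β.vec) μ ↔
      Hull lam (μ - k • β.vec) ∧ Hull lam μ ∧ Upward (β.pair μ - 2 * k) (-k) := by
  have := isEdge_sub_iff hl (β := β) (μ := μ - k • β.vec) (k := -k)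
  rwa [sub_smul_sub_smul, PosRoot.pair_sub] at this

/-- The bounds `M` need to describe the inverted labels only inside the hull, so finite bounds also
serve for m = ∞. -/
theorem twistedArrow_iff {m : ℕ∞} {lam μ ν : Weight} (hl : Dominant lam) (hμ : Hull lam μ)
    {M : PosRoot → ℤ} (hM0 : ∀ β, 0 ≤ M β)
    (hM : ∀ β k, Hull lam (μ - k • β.vec) →
      ((⟨-β.coroot.1, -β.coroot.2, k - β.pair μ⟩ : AffCoroot) ∈ inversions m ↔
        1 ≤ k - β.pair μ ∧ k - β.pair μ ≤ M β)) :
    TwistedArrow m lam ν μ ↔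
      ∃ β : PosRoot, ∃ k ∈ arrowSet (reach lam β μ) (β.pair μ) (M β), μ - k • β.vec = ν := by
  have e (β : PosRoot) (k : ℤ) :
      k ∈ arrowSet (reach lam β μ) (β.pair μ) (M β) ↔ Hull lam (μ - k • β.vec) ∧
        ((0 < k ∧ k ≤ β.pair μ + M β) ∨ (k < 0 ∧ β.pair μ + M β < k)) := by
    have := reach_nonneg hμ β
    rw [mem_arrowSet (by omega) (by omega), hull_sub_iff hμ]
  simp only [e]
  constructor
  · rintro (⟨β, hβ, hn⟩ | ⟨β, hβ, hn⟩)
    · obtain ⟨k, hk⟩ := hβ.2.2.2.2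
      have hν : ν = μ - (-k) • β.vec := by rw [hk]; simp
      rw [hν] at hβ hn ⊢
      rw [isEdge_sub_left_iff hl] at hβ
      rw [edgeLabel_sub_swap, hM β _ hβ.1] at hn
      refine ⟨β, -k, ⟨hβ.1, ?_⟩, rfl⟩
      have h3 := hβ.2.2
      have h4 := hM0 β
      unfold Upward at h3
      omega
    · obtain ⟨k, rfl⟩ := hβ.2.2.2.2
      rw [isEdge_sub_iff hl] at hβ
      rw [edgeLabel_sub, hM β _ hβ.2.1] at hn
      refine ⟨β, k, ⟨hβ.2.1, ?_⟩, rfl⟩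
      have h3 := hβ.2.2
      have h4 := hM0 β
      unfold Upward at h3
      omega
  · rintro ⟨β, k, ⟨hk, h⟩, rfl⟩
    have := hM0 β
    by_cases hu : Upward (β.pair μ) k
    · right
      refine ⟨β, (isEdge_sub_iff hl).2 ⟨hμ, hk, hu⟩, ?_⟩
      rw [edgeLabel_sub, hM β _ hk]
      unfold Upward at hu
      omega
    · left
      refine ⟨β, (isEdge_sub_left_iff hl).2 ⟨hk, hμ, ?_⟩, ?_⟩
      · unfold Upward at *; omega
      · rw [edgeLabel_sub_swap, hM β _ hk]
        unfold Upward at hu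
        omega

theorem sub_smul_vec_injective (μ : Weight) (β : PosRoot) :
    Function.Injective fun k : ℤ => μ - k • β.vec := by
  intro k l h
  have h1 := congrArg Prod.fst h
  have h2 := congrArg Prod.snd h
  simp only [sub_smul_fst, sub_smul_snd] at h1 h2
  cases β <;> simp only [PosRoot.vec] at h1 h2 <;> omega

theorem twistedLength_eq {m : ℕ∞} {lam μ : Weight} (hl : Dominant lam) (hμ : Hull lam μ)
    {M : PosRoot → ℤ} (hM0 : ∀ β, 0 ≤ M β)
    (hM : ∀ β k, Hull lam (μ - k • β.vec) →
      ((⟨-β.coroot.1, -β.coroot.2, k - β.pair μ⟩ : AffCoroot) ∈ inversions m ↔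
        1 ≤ k - β.pair μ ∧ k - β.pair μ ≤ M β)) :
    (twistedLength m μ lam : ℤ) = ∑ β ∈ {PosRoot.a1, .a2, .a12, .a21},
      arrowCount (reach lam β μ) (β.pair μ) (M β) := by
  have e : {ν | TwistedArrow m lam ν μ} =
      ((({PosRoot.a1, .a2, .a12, .a21} : Finset PosRoot).biUnion fun β =>
        (arrowSet (reach lam β μ) (β.pair μ) (M β)).image fun k => μ - k • β.vec :
          Finset Weight) : Set Weight) := by
    ext ν
    rw [Set.mem_ofPred_eq, twistedArrow_iff hl hμ hM0 hM]
    simp only [Finset.coe_biUnion, Set.mem_iUnion, Finset.coe_image, Set.mem_image,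
      Finset.mem_coe, exists_prop]
    refine exists_congr fun β => ?_
    cases β <;> simp
  rw [twistedLength, e, Set.ncard_coe_finset, Finset.card_biUnion]
  · push_cast
    refine Finset.sum_congr rfl fun β _ => ?_
    have := reach_nonneg hμ β
    rw [Finset.card_image_of_injective _ (sub_smul_vec_injective μ β),
      card_arrowSet (by omega) (by omega)]
  · intro β _ β' _ hne
    rw [Function.onFun, Finset.disjoint_left]
    rintro ν h1 h2
    obtain ⟨k, hk, rfl⟩ := Finset.mem_image.1 h1
    obtain ⟨l, hl, h⟩ := Finset.mem_image.1 h2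
    have h3 := reach_nonneg hμ β
    have h0 := (mem_arrowSet (by omega) (by omega)).1 hk
    exact hne (PosRoot.smul_eq_smul h.symm (by omega)).1

theorem sum_posRoot (g : PosRoot → ℤ) :
    ∑ β ∈ {PosRoot.a1, .a2, .a12, .a21}, g β = g .a1 + (g .a2 + (g .a12 + g .a21)) := by
  rw [Finset.sum_insert (by decide), Finset.sum_insert (by decide), Finset.sum_insert (by decide),
    Finset.sum_singleton]

theorem twistedLength_natCast {lam μ : Weight} (hl : Dominant lam) (hμ : Hull lam μ) (j : ℕ) :
    (twistedLength j μ lam : ℤ) =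
      arrowCount (reach lam .a1 μ) (PosRoot.a1.pair μ) 0 +
      (arrowCount (reach lam .a2 μ) (PosRoot.a2.pair μ) (j / 4) +
      (arrowCount (reach lam .a12 μ) (PosRoot.a12.pair μ) ((j + 2) / 4) +
      arrowCount (reach lam .a21 μ) (PosRoot.a21.pair μ) ((j + 1) / 2))) := by
  rw [twistedLength_eq hl hμ (M := inversionBound j), sum_posRoot]
  · rfl
  · intro β; cases β <;> simp only [inversionBound] <;> omega
  · intro β k _
    rw [mem_inversions_natCast_iff]
    cases β <;> simp only [tIndex, inversionBound] <;> omega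

theorem twistedLength_top {lam μ : Weight} (hl : Dominant lam) (hμ : Hull lam μ) :
    (twistedLength ⊤ μ lam : ℤ) =
      arrowCount (reach lam .a1 μ) (PosRoot.a1.pair μ) 0 +
      (reach lam .a2 μ + (reach lam .a12 μ + reach lam .a21 μ)) := by
  have h0 := reach_nonneg hμ
  rw [twistedLength_eq hl hμ
    -- Labels occurring at μ are at most R - p, so this bound plays the role of ∞; then p + M = 2R
    -- and `arrowCount` is R.
    (M := fun β => match β with | .a1 => 0 | β => 2 * reach lam β μ - β.pair μ), sum_posRoot]
  · have := h0 .a2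
    have := h0 .a12
    have := h0 .a21
    simp only [arrowCount]
    rw [if_pos (by omega : 0 ≤ PosRoot.a2.pair μ + _),
      if_pos (by omega : 0 ≤ PosRoot.a12.pair μ + _),
      if_pos (by omega : 0 ≤ PosRoot.a21.pair μ + _)]
    congr 1
    omega
  · intro β; have := h0 β; cases β <;> simp only <;> omega
  · intro β k hk
    have := h0 β
    have := (hull_sub_iff hμ β k).1 hk
    rw [mem_inversions_top_iff]
    cases β <;> simp only [tIndex] <;> omega

theorem arrowCount_a1 {lam μ : Weight} (hμ : Hull lam μ) :
    arrowCount (reach lam .a1 μ) (PosRoot.a1.pair μ) 0 = if 0 ≤ μ.1 then μ.1 else -μ.1 - 1 := by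
  have h0 := reach_nonneg hμ .a1
  simp only [arrowCount, PosRoot.pair, PosRoot.coroot] at *
  split_ifs <;> omega

theorem lengthOne_eq (μ : Weight) :
    (lengthOne μ : ℤ) = if 0 ≤ μ.1 then μ.1 else -μ.1 - 1 := by
  have e : {ν | BruhatLE ν μ ∧ ν ≠ μ ∧ ∃ k : ℤ, ν = μ - k • PosRoot.a1.vec} =
      ((if 0 ≤ μ.1 then Finset.Ioc 0 μ.1 else Finset.Ioo μ.1 0).image
        (fun k => μ - k • PosRoot.a1.vec) : Finset Weight) := by
    ext ν
    rw [Set.mem_ofPred_eq, Finset.coe_image, Set.mem_image]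
    have key (k : ℤ) (hk : k ≠ 0) : BruhatLE (μ - k • PosRoot.a1.vec) μ ↔
        Upward (μ.1 - 2 * k) (-k) := by
      have := bruhatLE_sub_iff (β := .a1) (μ := μ - k • PosRoot.a1.vec) (k := -k) (by omega)
      rw [sub_smul_sub_smul, PosRoot.pair_sub] at this
      simpa [PosRoot.pair, PosRoot.coroot] using this
    constructor
    · rintro ⟨h1, h2, k, rfl⟩
      have hk : k ≠ 0 := fun h => h2 (PosRoot.sub_smul_eq_self.2 h)
      rw [key k hk] at h1
      refine ⟨k, ?_, rfl⟩
      unfold Upward at h1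
      split_ifs
      · rw [Finset.mem_coe, Finset.mem_Ioc]; omega
      · rw [Finset.mem_coe, Finset.mem_Ioo]; omega
    · rintro ⟨k, hk, rfl⟩
      have hk' : (0 < k ∧ k ≤ μ.1) ∨ (k < 0 ∧ μ.1 < k) := by
        split_ifs at hk
        · rw [Finset.mem_coe, Finset.mem_Ioc] at hk; omega
        · rw [Finset.mem_coe, Finset.mem_Ioo] at hk; omega
      have hk0 : k ≠ 0 := by omega
      refine ⟨(key k hk0).2 ?_, fun h => hk0 (PosRoot.sub_smul_eq_self.1 h), k, rfl⟩
      unfold Upward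
      omega
  rw [lengthOne, e, Set.ncard_coe_finset,
    Finset.card_image_of_injective _ (sub_smul_vec_injective μ .a1)]
  split_ifs
  · rw [Int.card_Ioc]; omega
  · rw [Int.card_Ioo]; omega

/-! ### Arrow counts along an edge -/

/-- This and `min_sub_min` compute the changes along a long-root edge lowering the smaller
coordinate: here the change of the α₂₁-count plus the 2k gained in direction α₁, there the loss in
the other long direction. -/
theorem min_sub_min_shift {A B C k : ℤ} (hk : 0 < k) :
    min (min (A - 2 * k) (B - k)) C + 2 * k - min (min A B) (C + 2 * k) =
      max 0 (min (A - B) (min (C + 2 * k - B) k)) := by omega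

theorem min_sub_min {e B C k p : ℤ} (hp : p < k) :
    min (min e (B - p)) (C + k) - min (min e (B - k)) (C + k) =
      max 0 (min (k - (B - e)) (min (C + 2 * k - B) (k - p))) := by omega

/-- The source of the thresholds in `nsStart`. Here w caps the first clamp, k - u turns positive
after u, and up to rounding z is where C + 2k - B overtakes both w and k - u; below z this common
term governs both clamps. -/
theorem clamp_eq_iff {x y C L1 l1 l2 k B u w z : ℤ} (h1 : L1 = l1 + l2)
    (hC : C = y - x - 1 ∨ C = y - x) (hyB : k ≤ B - y) (hk : 0 < k) (hxy : x < y)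
    (hy : y ≤ L1) (hkx : x < k) (hR1 : 2 * k ≤ L1 + x) (hR3 : k ≤ B)
    (hB : 2 * B = l1 + 2 * l2 + x + y) (hw : 2 * w = l1 + x - y)
    (hu : u = (l2 + x + 1) / 2) (hz : z = x + (L1 - y + 1) / 2) :
    max 0 (min w (min (C + 2 * k - B) k)) =
      max 0 (min (k - u) (min (C + 2 * k - B) (k - max x 0))) ↔
      k ≤ max 0 (max u (max z w)) := by
  have hu' : l2 + x ≤ 2 * u ∧ 2 * u ≤ l2 + x + 1 := by omega
  have hz' : L1 - y ≤ 2 * (z - x) ∧ 2 * (z - x) ≤ L1 - y + 1 := by omega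
  clear hu hz
  constructor
  · intro h
    by_contra hc
    have : u < k ∧ z < k ∧ w < k := by omega
    clear hc
    omega
  · intro h
    have : k ≤ u ∨ k ≤ z ∨ k ≤ w := by omega
    clear h
    rcases this with h | h | h <;> omega

/-- Lowering the larger coordinate leaves the total in the other three directions unchanged.
`arrowCount_edge_a12` is the mirror image, with shifts due to mδ - α₁₂^∨ preceding mδ - α₂^∨ in the
inversion order. -/
theorem arrowCount_edge_a2 {x y L1 f B k : ℤ}
    (hx : x ≤ L1) (hx' : -L1 ≤ x) (hy : y ≤ L1) (hy' : -L1 ≤ y) (a : 0 ≤ B) (a2 : x ≤ B)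
    (a3 : y ≤ B) (a4 : x + y ≤ B) (hk : 0 < k) (hkx : y < k) (hR1 : 2 * k ≤ L1 + y)
    (hR2 : k ≤ B) (hR3 : k ≤ B - x) (hxy : x ≤ y) (hf : f = (L1 + x) / 2) :
    arrowCount (min f (B - max y 0)) x (k - y) + arrowCount (min (L1 + min x y) B) (x + y)
      (2 * (k - y)) + (if 0 ≤ x - y then x - y else -(x - y) - 1) =
      arrowCount (min f (B - k)) x (k - y) + arrowCount (min (L1 + min x (y - 2 * k)) (B - k))
      (x + y - 2 * k) (2 * (k - y)) +
      (if 0 ≤ x - y + 2 * k then x - y + 2 * k else -(x - y + 2 * k) - 1) := by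
  have hf' : 2 * f ≤ L1 + x ∧ L1 + x ≤ 2 * f + 1 := by omega
  clear hf
  have e1 : min x y = x := by omega
  rw [e1]
  unfold arrowCount
  by_cases c1 : x - y + 2 * k < 0
  · rw [if_neg (by omega), if_neg (by omega), if_neg (by omega), if_neg (by omega),
      if_neg (by omega), if_neg (by omega)]
    have e1 : min x (y - 2 * k) = x := by omega
    rw [e1]
    have : min (min f (B - k) - x) (-x - (k - y) - 1) = -x - (k - y) - 1 := by omega
    rw [this]
    have : min (min f (B - max y 0) - x) (-x - (k - y) - 1) = -x - (k - y) - 1 := by omega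
    rw [this]
    omega
  by_cases c2 : x - y + k < 0
  · rw [if_neg (by omega), if_pos (by omega), if_neg (by omega), if_neg (by omega),
      if_neg (by omega), if_pos (by omega)]
    have e1 : min x (y - 2 * k) = y - 2 * k := by omega
    rw [e1]
    have : min (min f (B - k) - x) (-x - (k - y) - 1) = -x - (k - y) - 1 := by omega
    rw [this]
    have : min (min f (B - max y 0) - x) (-x - (k - y) - 1) = -x - (k - y) - 1 := by omega
    rw [this]
    omega
  have e1 : min x (y - 2 * k) = y - 2 * k := by omega
  rw [e1]
  have e2 : min (min f (B - max y 0)) (x + (k - y)) = x + (k - y) := by omega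
  by_cases c3 : x - y < 0
  · rw [if_pos (by omega), if_pos (by omega), if_neg (by omega), if_pos (by omega),
      if_neg (by omega), if_pos (by omega), e2]
    have : min (min (L1 + (y - 2 * k)) (B - k) - (x + y - 2 * k))
        (-(x + y - 2 * k) - 2 * (k - y) - 1) = y - x - 1 := by omega
    rw [this]
    omega
  · rw [if_pos (by omega), if_pos (by omega), if_pos (by omega), if_pos (by omega),
      if_pos (by omega), if_pos (by omega), e2]
    omega

theorem arrowCount_edge_a12 {x y L1 f B k : ℤ}
    (hx : x ≤ L1) (hx' : -L1 ≤ x) (hy : y ≤ L1) (hy' : -L1 ≤ y) (a : 0 ≤ B) (a2 : x ≤ B)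
    (a3 : y ≤ B) (a4 : x + y ≤ B) (hk : 0 < k) (hkx : x < k) (hR1 : 2 * k ≤ L1 + x)
    (hR2 : k ≤ B) (hR3 : k ≤ B - y) (hxy : y ≤ x) (hf : f = (L1 + y) / 2) :
    arrowCount (min f (B - max x 0)) y (k - x - 1) + arrowCount (min (L1 + min x y) B) (x + y)
      (2 * (k - x) - 1) + (if 0 ≤ x - y then x - y else -(x - y) - 1) =
      arrowCount (min f (B - k)) y (k - x - 1) + arrowCount (min (L1 + min (x - 2 * k) y) (B - k))
      (x + y - 2 * k) (2 * (k - x) - 1) +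
      (if 0 ≤ x - y - 2 * k then x - y - 2 * k else -(x - y - 2 * k) - 1) := by
  have hf' : 2 * f ≤ L1 + y ∧ L1 + y ≤ 2 * f + 1 := by omega
  clear hf
  have e1 : min x y = y := by omega
  rw [e1]
  unfold arrowCount
  by_cases c1 : 0 ≤ x - y - 2 * k
  · rw [if_neg (by omega), if_neg (by omega), if_pos (by omega), if_neg (by omega),
      if_neg (by omega), if_pos (by omega)]
    have e1 : min (x - 2 * k) y = y := by omega
    rw [e1]
    have : min (min f (B - k) - y) (-y - (k - x - 1) - 1) = -y - (k - x - 1) - 1 := by omega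
    rw [this]
    have : min (min f (B - max x 0) - y) (-y - (k - x - 1) - 1) = -y - (k - x - 1) - 1 := by omega
    rw [this]
    omega
  have e1 : min (x - 2 * k) y = x - 2 * k := by omega
  rw [e1]
  by_cases c2 : y - x + k ≤ 0
  · rw [if_neg (by omega), if_pos (by omega), if_pos (by omega), if_neg (by omega),
      if_neg (by omega), if_neg (by omega)]
    have : min (min f (B - k) - y) (-y - (k - x - 1) - 1) = -y - (k - x - 1) - 1 := by omega
    rw [this]
    have : min (min f (B - max x 0) - y) (-y - (k - x - 1) - 1) = -y - (k - x - 1) - 1 := by omega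
    rw [this]
    omega
  have e2 : min (min f (B - max x 0)) (y + (k - x - 1)) = y + (k - x - 1) := by omega
  rw [if_pos (by omega), if_pos (by omega), if_pos (by omega), if_pos (by omega),
      if_neg (by omega), if_neg (by omega), e2]
  have : min (min (L1 + (x - 2 * k)) (B - k) - (x + y - 2 * k))
      (-(x + y - 2 * k) - (2 * (k - x) - 1) - 1) = x - y := by omega
  rw [this]
  omega

theorem min_min_sub {f b c s : ℤ} (h : s + c ≤ f) : min (min f b - c) s = min (b - c) s := by omega

theorem min_min_of_le {f b s : ℤ} (h : s ≤ f) : min (min f b) s = min b s := by omega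

theorem min_add_min_shift {x y B k s r : ℤ} (a : 0 ≤ B) (a2 : x ≤ B) (a3 : y ≤ B) (a4 : x + y ≤ B)
    (hk : 0 < k) (hkx : x + y < k) (hR2 : k ≤ B) (hs : 0 ≤ s) (hr : 0 ≤ r) (h : r + s = k - 1)
    (h' : s - r = x - y ∨ s - r = x - y + 1):
    min (B - max x 0) r + min (B - max y 0) s = min (B - k - max (x - k) 0 - (y - k)) s +
      min (B - k - max (y - k) 0 - (x - k)) r := by
  have e : max x 0 = x ∨ max x 0 = 0 := by omega
  have e' : max y 0 = y ∨ max y 0 = 0 := by omega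
  rcases le_total x k with h1 | h1 <;> rcases le_total y k with h2 | h2
  · rw [max_eq_right (by omega : x - k ≤ 0), max_eq_right (by omega : y - k ≤ 0)]
    rcases e with e | e <;> rcases e' with e' | e' <;> rw [e, e'] <;> omega
  · rw [max_eq_right (by omega : x - k ≤ 0), max_eq_left (by omega : 0 ≤ y - k)]
    rcases e with e | e <;> rcases e' with e' | e' <;> rw [e, e'] <;> omega
  · rw [max_eq_left (by omega : 0 ≤ x - k), max_eq_right (by omega : y - k ≤ 0)]
    rcases e with e | e <;> rcases e' with e' | e' <;> rw [e, e'] <;> omega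
  · omega

theorem min_sub_add_min_shift {x y B k s r : ℤ} (a : 0 ≤ B) (a2 : x ≤ B) (a3 : y ≤ B)
    (a4 : x + y ≤ B) (hk : 0 < k) (hkx : x + y < k) (hR2 : k ≤ B) (hs : 0 ≤ s) (hr : 0 ≤ r)
    (h : s - r = k) (h' : s + r + 1 = x - y ∨ s + r + 1 = x - y + 1 ∨ s + r + 1 = x - y - 1):
    min (B - max x 0 - y) r + min (B - max y 0) s = min (B - k - max (x - k) 0 - (y - k)) s +
      min (B - k - max (y - k) 0) r := by
  have e : max x 0 = x ∨ max x 0 = 0 := by omega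
  have e' : max y 0 = y ∨ max y 0 = 0 := by omega
  rcases le_total x k with h1 | h1 <;> rcases le_total y k with h2 | h2
  · rw [max_eq_right (by omega : x - k ≤ 0), max_eq_right (by omega : y - k ≤ 0)]
    rcases e with e | e <;> rcases e' with e' | e' <;> rw [e, e'] <;> omega
  · rw [max_eq_right (by omega : x - k ≤ 0), max_eq_left (by omega : 0 ≤ y - k)]
    rcases e with e | e <;> rcases e' with e' | e' <;> rw [e, e'] <;> omega
  · rw [max_eq_left (by omega : 0 ≤ x - k), max_eq_right (by omega : y - k ≤ 0)]
    rcases e with e | e <;> rcases e' with e' | e' <;> rw [e, e'] <;> omega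
  · omega

/-- The reflection in an α₂₁-edge exchanges the directions α₂ and -α₁₂, so these two counts trade
places. Direction α₁ is orthogonal to α₂₁ and plays no part. -/
theorem arrowCount_edge_a21 {x y L1 f g f' g' B k M N : ℤ}
    (hx : x ≤ L1) (hx' : -L1 ≤ x) (hy : y ≤ L1) (hy' : -L1 ≤ y) (a : 0 ≤ B) (a2 : x ≤ B)
    (a3 : y ≤ B) (a4 : x + y ≤ B) (hk : 0 < k) (hkx : x + y < k) (hR1 : k ≤ L1 + x)
    (hR1' : k ≤ L1 + y) (hR2 : k ≤ B) (hf : f = (L1 + x) / 2) (hg : g = (L1 + y) / 2)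
    (hf' : f' = (L1 + x - k) / 2) (hg' : g' = (L1 + y - k) / 2) (hM : M = (k - x - y - 1) / 2)
    (hN : N = (k - x - y) / 2) :
    arrowCount (min g (B - max x 0)) y M + arrowCount (min f (B - max y 0)) x N =
      arrowCount (min g' (B - k - max (x - k) 0)) (y - k) M +
      arrowCount (min f' (B - k - max (y - k) 0)) (x - k) N := by
  have e1 : 2 * f ≤ L1 + x ∧ L1 + x ≤ 2 * f + 1 := by omega
  have e2 : 2 * g ≤ L1 + y ∧ L1 + y ≤ 2 * g + 1 := by omega
  have e3 : 2 * f' ≤ L1 + x - k ∧ L1 + x - k ≤ 2 * f' + 1 := by omega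
  have e4 : 2 * g' ≤ L1 + y - k ∧ L1 + y - k ≤ 2 * g' + 1 := by omega
  have e5 : M + N = k - x - y - 1 ∧ (M = N ∨ M + 1 = N) := by omega
  clear hf hg hf' hg' hM hN
  -- The cut-offs in the exchanged directions correspond.
  have d1 : -(y - k) - M - 1 = x + N := by omega
  have d2 : -(x - k) - N - 1 = y + M := by omega
  have d3 : y - k + M = -x - N - 1 := by omega
  have d4 : x - k + N = -y - M - 1 := by omega
  unfold arrowCount
  by_cases c1 : 0 ≤ x + N <;> by_cases c2 : 0 ≤ y + M
  · rw [if_pos c1, if_pos c2, if_neg (by omega), if_neg (by omega), d1, d2,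
      min_min_sub (by omega), min_min_sub (by omega),
      min_min_of_le (by omega), min_min_of_le (by omega)]
    apply min_add_min_shift <;> omega
  · rw [if_pos c1, if_neg c2, if_neg (by omega), if_pos (by omega), d1, d4,
      min_min_sub (by omega), min_min_sub (by omega),
      min_min_of_le (by omega), min_min_of_le (by omega)]
    apply min_sub_add_min_shift <;> omega
  · rw [if_neg c1, if_pos c2, if_pos (by omega), if_neg (by omega), d2, d3,
      min_min_sub (by omega), min_min_sub (by omega),
      min_min_of_le (by omega), min_min_of_le (by omega)]
    have := @min_sub_add_min_shift y x B k (y + M)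
        (-x - N - 1) a a3 a2 (by omega) hk (by omega) hR2 c2 (by omega) (by omega) (by omega)
    rw [add_comm, this, add_comm]
  -- The two cut-offs cannot both be negative, as (x + N) + (y + M) = k - 1.
  · omega

/-! ### Classification of the non-swappable edges -/

/-- The parity condition makes B an integer, which removes the halves of absolute values in `reach`.
-/
theorem reach_forms {lam μ : Weight} (h : Hull lam μ) : ∃ B : ℤ,
    2 * B = lam.1 + 2 * lam.2 + μ.1 + 2 * μ.2 ∧
    reach lam .a2 μ = min ((lam.1 + lam.2 + μ.2) / 2) (B - max (μ.1 + μ.2) 0) ∧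
    reach lam .a12 μ = min ((lam.1 + lam.2 + (μ.1 + μ.2)) / 2) (B - max μ.2 0) ∧
    reach lam .a21 μ = min (lam.1 + lam.2 + min (μ.1 + μ.2) μ.2) B := by
  have h9 := h.parity
  refine ⟨(lam.1 + 2 * lam.2 + μ.1 + 2 * μ.2) / 2, by omega, ?_, ?_, ?_⟩ <;> simp only [reach]
  · congr 1; omega
  · congr 1; omega
  · congr 1; omega

/-- The edges `μ → μ - k β` in direction `β = nsRoot μ` are non-swappable for `k > nsStart`, and
all other edges `μ → t_{j+1} μ` are swappable. -/
def nsStart (lam μ : Weight) : ℤ :=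
  max 0 (max ((lam.2 + min (μ.1 + μ.2) μ.2 + 1) / 2)
    (max (min (μ.1 + μ.2) μ.2 + (lam.1 + lam.2 - max (μ.1 + μ.2) μ.2 + 1) / 2)
      ((lam.1 - max μ.1 (-μ.1)) / 2)))

theorem hull_coords {lam μ : Weight} (h : Hull lam μ) {B : ℤ}
    (hB : 2 * B = lam.1 + 2 * lam.2 + μ.1 + 2 * μ.2) :
    0 ≤ B ∧ μ.1 + μ.2 ≤ B ∧ μ.2 ≤ B ∧ (μ.1 + μ.2) + μ.2 ≤ B := by
  obtain ⟨h1, h2, h3, h4, h5, h6, h7, h8, h9⟩ := h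
  omega

/-- The edge's own direction contributes k - 1 at μ and k at the target, so swappability means that
the other three counts have equal totals. They do when μ₁ ≥ 0; when μ₁ < 0 the discrepancy is the
difference of the clamps in `clamp_eq_iff`. -/
theorem swappable_a12_iff {lam μ : Weight} (hl : Dominant lam) (h : Hull lam μ) {k : ℤ} {j : ℕ}
    (hν : Hull lam (μ - k • PosRoot.a12.vec)) (hk : 0 < k) (hkp : PosRoot.a12.pair μ < k)
    (hj : (j : ℤ) = 4 * (k - PosRoot.a12.pair μ) - 3) :
    twistedLength j μ lam + 1 = twistedLength j (μ - k • PosRoot.a12.vec) lam ↔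
      ¬ (μ.1 < 0 ∧ nsStart lam μ < k) := by
  obtain ⟨B, hB, r2, r12, r21⟩ := reach_forms h
  obtain ⟨B', hB', r2', -, r21'⟩ := reach_forms hν
  have hr := reach_sub .a12 k h hν
  have hR := ((hull_sub_iff h .a12 k).1 hν).1
  obtain ⟨b1, b2, b3, b4⟩ := hull_coords h hB
  have hR0 := reach_nonneg h .a12
  rw [← @Nat.cast_inj ℤ]
  push_cast
  rw [twistedLength_natCast hl h, twistedLength_natCast hl hν, arrowCount_a1 h, arrowCount_a1 hν]
  obtain ⟨h1, h2, h3, h4, h5, h6, h7, h8, h9⟩ := h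
  obtain ⟨u, v⟩ := μ
  obtain ⟨x, rfl⟩ : ∃ x, u = x - v := ⟨u + v, by ring⟩
  rw [hr, r2, r2', r21, r21']
  have hR' := hR
  rw [r12, le_min_iff] at hR'
  obtain ⟨hR1, hR2⟩ := hR'
  have hR3 : k ≤ B ∧ k ≤ B - v := by constructor <;> omega
  clear r2 r2' r12 r21 r21' hr hν hR2
  simp only [PosRoot.pair, PosRoot.coroot, PosRoot.vec, sub_smul_fst, sub_smul_snd] at *
  -- The edge has label (k - x)δ - α₁₂^∨; these are the numbers of labels of type α₂, α₁₂, α₂₁ that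
  -- precede it.
  have M1 : (j : ℤ) / 4 = k - x - 1 := by omega
  have M2 : ((j : ℤ) + 2) / 4 = k - x - 1 := by omega
  have M3 : ((j : ℤ) + 1) / 2 = 2 * (k - x) - 1 := by omega
  have c1 : arrowCount (reach lam .a12 (x - v, v)) (1 * (x - v) + 1 * v) (k - x - 1) = k - 1 := by
    rw [arrowCount, if_pos (by omega), min_eq_right (by omega)]; ring
  have c2 : arrowCount (reach lam .a12 (x - v, v) - k) (1 * (x - v - k * 2) + 1 * (v - k * 0))
      (k - x - 1) = k := by
    rw [arrowCount, if_neg (by omega), min_eq_right (by omega)]; ring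
  rw [M1, M2, M3, c1, c2]
  have e1 : 1 * (x - v) + 2 * v = x + v := by ring
  have e2 : 1 * (x - v - k * 2) + 2 * (v - k * 0) = x + v - 2 * k := by ring
  have e3 : x - v - k * 2 = x - v - 2 * k := by ring
  have e4 : v - k * 0 = v := by ring
  have e5 : B' = B - k := by omega
  have e6 : x - v + v = x := by ring
  have e7 : x - v - 2 * k + v = x - 2 * k := by ring
  have e8 : max (x - 2 * k) 0 = 0 := by omega
  clear c1 c2 M1 M2 M3 hj hR hR0
  simp only [e1, e2, e3, e4, e5, e6, e7, e8, zero_mul, one_mul, zero_add, sub_zero] at *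
  rw [e1, e2]
  clear e1 e2 e3 e4 e5 e6 e7 e8
  rcases le_or_gt v x with hxy | hxy
  · have := arrowCount_edge_a12 (x := x) (y := v) (L1 := lam.1 + lam.2) (B := B) (k := k)
      h1 h2 h3 h4 b1 b2 b3 b4 hk hkp (by omega) (by omega) (by omega) hxy rfl
    constructor
    · intro _ h; omega
    · intro _; omega
  · have n1 : arrowCount (min ((lam.1 + lam.2 + v) / 2) (B - max x 0)) v (k - x - 1) =
        min (min ((lam.1 + lam.2 + v) / 2) (B - max x 0)) (v - x - 1 + k) := by
      rw [arrowCount, if_pos (by omega)]; congr 1; ring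
    have n2 : arrowCount (min ((lam.1 + lam.2 + v) / 2) (B - k)) v (k - x - 1) =
        min (min ((lam.1 + lam.2 + v) / 2) (B - k)) (v - x - 1 + k) := by
      rw [arrowCount, if_pos (by omega)]; congr 1; ring
    have n3 : arrowCount (min (lam.1 + lam.2 + min x v) B) (x + v) (2 * (k - x) - 1) =
        min (min (lam.1 + lam.2 + x) B) (v - x - 1 + 2 * k) := by
      rw [arrowCount, if_pos (by omega), min_eq_left hxy.le]; congr 1; ring
    have n4 : arrowCount (min (lam.1 + lam.2 + min (x - 2 * k) v) (B - k)) (x + v - 2 * k)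
        (2 * (k - x) - 1) = min (min (lam.1 + lam.2 + x - 2 * k) (B - k)) (v - x - 1) := by
      rw [arrowCount, if_pos (by omega), min_eq_left (by omega : x - 2 * k ≤ v)]; congr 1
      · congr 1; ring
      · ring
    rw [n1, n2, n3, n4, if_neg (by omega), if_neg (by omega)]
    have g1 := min_sub_min_shift (A := lam.1 + lam.2 + x) (B := B) (C := v - x - 1) hk
    have g2 := min_sub_min (e := (lam.1 + lam.2 + v) / 2) (B := B) (C := v - x - 1) (k := k)
      (p := max x 0) (by omega)
    have g3 := clamp_eq_iff (x := x) (y := v) (C := v - x - 1) (L1 := lam.1 + lam.2)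
      (l1 := lam.1) (l2 := lam.2) (k := k) (B := B) (u := (lam.2 + x + 1) / 2)
      (w := (lam.1 + x - v) / 2) (z := x + (lam.1 + lam.2 - v + 1) / 2)
      rfl (.inl rfl) (by omega) hk hxy h3 hkp (by omega) (by omega) (by omega) (by omega) rfl rfl
    have t1 : lam.1 + lam.2 + x - B = (lam.1 + x - v) / 2 := by omega
    have t2 : B - (lam.1 + lam.2 + v) / 2 = (lam.2 + x + 1) / 2 := by omega
    rw [t1] at g1
    rw [t2] at g2
    have t3 : nsStart lam (x - v, v) = max 0 (max ((lam.2 + x + 1) / 2)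
        (max (x + (lam.1 + lam.2 - v + 1) / 2) ((lam.1 + x - v) / 2))) := by
      simp only [nsStart]
      rw [sub_add_cancel, min_eq_left hxy.le, max_eq_right hxy.le,
        max_eq_right (by omega : x - v ≤ -(x - v))]
      congr 3
      congr 1
      ring
    rw [t3]
    rw [← g1, ← g2] at g3
    have h0 : x - v < 0 := by omega
    simp only [h0, true_and, not_lt]
    rw [← g3]
    constructor <;> intro _ <;> omega

theorem swappable_a2_iff {lam μ : Weight} (hl : Dominant lam) (h : Hull lam μ) {k : ℤ} {j : ℕ}
    (hν : Hull lam (μ - k • PosRoot.a2.vec)) (hk : 0 < k) (hkp : PosRoot.a2.pair μ < k)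
    (hj : (j : ℤ) = 4 * (k - PosRoot.a2.pair μ) - 1) :
    twistedLength j μ lam + 1 = twistedLength j (μ - k • PosRoot.a2.vec) lam ↔
      ¬ (0 < μ.1 ∧ nsStart lam μ < k) := by
  obtain ⟨B, hB, r2, r12, r21⟩ := reach_forms h
  obtain ⟨B', hB', -, r12', r21'⟩ := reach_forms hν
  have hr := reach_sub .a2 k h hν
  have hR := ((hull_sub_iff h .a2 k).1 hν).1
  obtain ⟨b1, b2, b3, b4⟩ := hull_coords h hB
  have hR0 := reach_nonneg h .a2
  rw [← @Nat.cast_inj ℤ]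
  push_cast
  rw [twistedLength_natCast hl h, twistedLength_natCast hl hν, arrowCount_a1 h, arrowCount_a1 hν]
  obtain ⟨h1, h2, h3, h4, h5, h6, h7, h8, h9⟩ := h
  obtain ⟨u, v⟩ := μ
  obtain ⟨x, rfl⟩ : ∃ x, u = x - v := ⟨u + v, by ring⟩
  rw [hr, r12, r12', r21, r21']
  have hR' := hR
  rw [r2, le_min_iff] at hR'
  obtain ⟨hR1, hR2⟩ := hR'
  have hR3 : k ≤ B ∧ k ≤ B - (x - v + v) := by constructor <;> omega
  clear r2 r12' r12 r21 r21' hr hν hR2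
  simp only [PosRoot.pair, PosRoot.coroot, PosRoot.vec, sub_smul_fst, sub_smul_snd] at *
  have M1 : (j : ℤ) / 4 = k - v - 1 := by omega
  have M2 : ((j : ℤ) + 2) / 4 = k - v := by omega
  have M3 : ((j : ℤ) + 1) / 2 = 2 * (k - v) := by omega
  have c1 : arrowCount (reach lam .a2 (x - v, v)) (0 * (x - v) + 1 * v) (k - v - 1) = k - 1 := by
    rw [arrowCount, if_pos (by omega), min_eq_right (by omega)]; ring
  have c2 : arrowCount (reach lam .a2 (x - v, v) - k) (0 * (x - v - k * -2) + 1 * (v - k * 2))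
      (k - v - 1) = k := by
    rw [arrowCount, if_neg (by omega), min_eq_right (by omega)]; ring
  rw [M1, M2, M3, c1, c2]
  have e1 : x - v + 2 * v = x + v := by ring
  have e2 : x - v + 2 * k + 2 * (v - 2 * k) = x + v - 2 * k := by ring
  have e3 : x - v - k * -2 = x - v + 2 * k := by ring
  have e4 : v - k * 2 = v - 2 * k := by ring
  have e5 : B' = B - k := by omega
  have e6 : x - v + v = x := by ring
  have e7 : x - v + 2 * k + (v - 2 * k) = x := by ring
  have e8 : max (v - 2 * k) 0 = 0 := by omega
  clear c1 c2 M1 M2 M3 hj hR hR0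
  simp only [e3, e4, e5, e6, e7, e8, zero_mul, one_mul, zero_add, sub_zero] at *
  rw [e1, e2]
  clear e1 e2 e3 e4 e5 e6 e7 e8
  rcases le_or_gt x v with hxy | hxy
  · have := arrowCount_edge_a2 (x := x) (y := v) (L1 := lam.1 + lam.2)
      (B := B) (k := k) h1 h2 h3 h4 b1 b2 b3 b4 hk hkp (by omega) (by omega) (by omega) hxy rfl
    constructor
    · intro _ h; omega
    · intro _; omega
  · have n1 : arrowCount (min ((lam.1 + lam.2 + x) / 2) (B - max v 0)) x (k - v) =
        min (min ((lam.1 + lam.2 + x) / 2) (B - max v 0)) (x - v + k) := by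
      rw [arrowCount, if_pos (by omega)]; congr 1; ring
    have n2 : arrowCount (min ((lam.1 + lam.2 + x) / 2) (B - k)) x (k - v) =
        min (min ((lam.1 + lam.2 + x) / 2) (B - k)) (x - v + k) := by
      rw [arrowCount, if_pos (by omega)]; congr 1; ring
    have n3 : arrowCount (min (lam.1 + lam.2 + min x v) B) (x + v) (2 * (k - v)) =
        min (min (lam.1 + lam.2 + v) B) (x - v + 2 * k) := by
      rw [arrowCount, if_pos (by omega), min_eq_right hxy.le]; congr 1; ring
    have n4 : arrowCount (min (lam.1 + lam.2 + min x (v - 2 * k)) (B - k)) (x + v - 2 * k)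
        (2 * (k - v)) = min (min (lam.1 + lam.2 + v - 2 * k) (B - k)) (x - v) := by
      rw [arrowCount, if_pos (by omega), min_eq_right (by omega : v - 2 * k ≤ x)]; congr 1
      · congr 1; ring
      · ring
    rw [n1, n2, n3, n4, if_pos (by omega), if_pos (by omega)]
    have g1 := min_sub_min_shift (A := lam.1 + lam.2 + v) (B := B) (C := x - v) hk
    have g2 := min_sub_min (e := (lam.1 + lam.2 + x) / 2) (B := B) (C := x - v) (k := k)
      (p := max v 0) (by omega)
    have g3 := clamp_eq_iff (x := v) (y := x) (C := x - v) (L1 := lam.1 + lam.2)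
      (l1 := lam.1) (l2 := lam.2) (k := k) (B := B) (u := (lam.2 + v + 1) / 2)
      (w := (lam.1 + v - x) / 2) (z := v + (lam.1 + lam.2 - x + 1) / 2)
      rfl (.inr rfl) (by omega) hk hxy h1 hkp (by omega) (by omega) (by omega) (by omega) rfl rfl
    have t1 : lam.1 + lam.2 + v - B = (lam.1 + v - x) / 2 := by omega
    have t2 : B - (lam.1 + lam.2 + x) / 2 = (lam.2 + v + 1) / 2 := by omega
    rw [t1] at g1
    rw [t2] at g2
    have t3 : nsStart lam (x - v, v) = max 0 (max ((lam.2 + v + 1) / 2)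
        (max (v + (lam.1 + lam.2 - x + 1) / 2) ((lam.1 + v - x) / 2))) := by
      simp only [nsStart]
      rw [sub_add_cancel, min_eq_right hxy.le, max_eq_left hxy.le,
        max_eq_left (by omega : -(x - v) ≤ x - v)]
      congr 3
      congr 1
      ring
    rw [t3]
    rw [← g1, ← g2] at g3
    have h0 : 0 < x - v := by omega
    simp only [h0, true_and, not_lt]
    rw [← g3]
    constructor <;> intro _ <;> omega

theorem swappable_a21 {lam μ : Weight} (hl : Dominant lam) (h : Hull lam μ) {k : ℤ} {j : ℕ}
    (hν : Hull lam (μ - k • PosRoot.a21.vec)) (hk : 0 < k) (hkp : PosRoot.a21.pair μ < k)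
    (hj : (j : ℤ) = 2 * (k - PosRoot.a21.pair μ) - 2) :
    twistedLength j μ lam + 1 = twistedLength j (μ - k • PosRoot.a21.vec) lam := by
  obtain ⟨B, hB, r2, r12, r21⟩ := reach_forms h
  obtain ⟨B', hB', r2', r12', -⟩ := reach_forms hν
  have hr := reach_sub .a21 k h hν
  have hR := ((hull_sub_iff h .a21 k).1 hν).1
  obtain ⟨b1, b2, b3, b4⟩ := hull_coords h hB
  have hR0 := reach_nonneg h .a21
  rw [← @Nat.cast_inj ℤ]
  push_cast
  rw [twistedLength_natCast hl h, twistedLength_natCast hl hν, arrowCount_a1 h, arrowCount_a1 hν]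
  obtain ⟨h1, h2, h3, h4, h5, h6, h7, h8, h9⟩ := h
  obtain ⟨u, v⟩ := μ
  obtain ⟨x, rfl⟩ : ∃ x, u = x - v := ⟨u + v, by ring⟩
  rw [hr, r12, r12', r2, r2']
  have hR' := hR
  rw [r21, le_min_iff, sub_add_cancel] at hR'
  obtain ⟨hR1, hR2⟩ := hR'
  clear r2 r12' r12 r21 r2' hr hν
  simp only [PosRoot.pair, PosRoot.coroot, PosRoot.vec, sub_smul_fst, sub_smul_snd] at *
  have M1 : (j : ℤ) / 4 = (k - x - v - 1) / 2 := by omega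
  have M2 : ((j : ℤ) + 2) / 4 = (k - x - v) / 2 := by omega
  have M3 : ((j : ℤ) + 1) / 2 = k - x - v - 1 := by omega
  have c1 : arrowCount (reach lam .a21 (x - v, v)) (1 * (x - v) + 2 * v) (k - x - v - 1) =
      k - 1 := by
    rw [arrowCount, if_pos (by omega), min_eq_right (by omega)]; ring
  have c2 : arrowCount (reach lam .a21 (x - v, v) - k) (1 * (x - v - k * 0) + 2 * (v - k * 1))
      (k - x - v - 1) = k := by
    rw [arrowCount, if_neg (by omega), min_eq_right (by omega)]; ring
  rw [M1, M2, M3, c1, c2]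
  have e3 : x - v - k * 0 = x - v := by ring
  have e4 : v - k * 1 = v - k := by ring
  have e5 : B' = B - k := by omega
  have e6 : x - v + v = x := by ring
  have e7 : x - v + (v - k) = x - k := by ring
  clear c1 c2 M1 M2 M3 hj hR hR0
  simp only [e3, e4, e5, e6, e7, zero_mul, one_mul, zero_add, sub_zero] at *
  have := arrowCount_edge_a21 (x := x) (y := v) (L1 := lam.1 + lam.2) (B := B) (k := k)
    h1 h2 h3 h4 b1 b2 b3 b4 hk (by omega) (by omega) (by omega) hR2 rfl rfl rfl rfl rfl rfl
  rw [add_sub_assoc, add_sub_assoc] at this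
  omega

/-! ### The non-swappable edges at a vertex: their number and their staircases. -/

/-- The direction of the non-swappable edges starting at `μ`. -/
def nsRoot (μ : Weight) : PosRoot := if μ.1 < 0 then .a12 else .a2

/-- The non-swappable edges starting at `μ` are `μ → μ - k β` with `β = nsRoot μ` and
`nsStart < k ≤ nsEnd`. -/
def nsEnd (lam μ : Weight) : ℤ :=
  min ((lam.1 + lam.2 + min (μ.1 + μ.2) μ.2) / 2)
    ((lam.1 + 2 * lam.2 + min (μ.1 + μ.2) μ.2 -
      max (max (μ.1 + μ.2) μ.2) (-max (μ.1 + μ.2) μ.2)) / 2)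

theorem reach_nsRoot (lam μ : Weight) : reach lam (nsRoot μ) μ = nsEnd lam μ := by
  unfold nsRoot nsEnd
  split_ifs
  · rw [min_eq_left (by omega : μ.1 + μ.2 ≤ μ.2), max_eq_right (by omega : μ.1 + μ.2 ≤ μ.2)]; rfl
  · rw [min_eq_right (by omega : μ.2 ≤ μ.1 + μ.2), max_eq_left (by omega : μ.2 ≤ μ.1 + μ.2)]; rfl

theorem pair_nsRoot (μ : Weight) : (nsRoot μ).pair μ = min (μ.1 + μ.2) μ.2 := by
  unfold nsRoot
  split_ifs <;> simp only [PosRoot.pair, PosRoot.coroot] <;> omega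

theorem pair_le_nsStart {lam μ : Weight} (h : Hull lam μ) :
    min (μ.1 + μ.2) μ.2 ≤ nsStart lam μ := by
  obtain ⟨h1, h2, h3, h4, h5, h6, h7, h8, h9⟩ := h
  have : min (μ.1 + μ.2) μ.2 + (lam.1 + lam.2 - max (μ.1 + μ.2) μ.2 + 1) / 2 ≤ nsStart lam μ :=
    le_max_of_le_right (le_max_of_le_right (le_max_left _ _))
  omega

theorem nsStart_nonneg (lam μ : Weight) : 0 ≤ nsStart lam μ := le_max_left _ _

theorem swappable_iff {lam μ : Weight} (hl : Dominant lam) {β : PosRoot} {k : ℤ} {j : ℕ}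
    (he : IsEdge lam β μ (μ - k • β.vec)) (hj : edgeLabel β μ (μ - k • β.vec) = tRoot j) :
    twistedLength j μ lam + 1 = twistedLength j (μ - k • β.vec) lam ↔
      ¬ (μ.1 ≠ 0 ∧ β = nsRoot μ ∧ nsStart lam μ < k) := by
  rw [isEdge_sub_iff hl] at he
  obtain ⟨h, hν, hu⟩ := he
  rw [edgeLabel_sub, eq_tRoot_iff] at hj
  unfold Upward at hu
  have h0 := nsStart_nonneg lam μ
  cases β
  · simp only [tIndex] at hj; omega
  · simp only [tIndex] at hj
    rw [swappable_a2_iff hl h hν (by omega) (by omega) hj]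
    unfold nsRoot
    split_ifs <;> simp <;> omega
  · simp only [tIndex] at hj
    rw [swappable_a12_iff hl h hν (by omega) (by omega) hj]
    unfold nsRoot
    split_ifs <;> simp <;> omega
  · simp only [tIndex] at hj
    have := swappable_a21 hl h hν (by omega) (by omega) hj
    have h2 : PosRoot.a21 ≠ nsRoot μ := by unfold nsRoot; split_ifs <;> simp
    simp [this, h2]

theorem exists_label {lam μ : Weight} (hl : Dominant lam) (h : Hull lam μ) {k : ℤ}
    (hk : 0 < k) (hp : min (μ.1 + μ.2) μ.2 < k) (hR : k ≤ nsEnd lam μ) :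
    ∃ j : ℕ, IsEdge lam (nsRoot μ) μ (μ - k • (nsRoot μ).vec) ∧
      edgeLabel (nsRoot μ) μ (μ - k • (nsRoot μ).vec) = tRoot j := by
  rw [← pair_nsRoot] at hp
  rw [← reach_nsRoot] at hR
  have h0 := reach_nonneg h (nsRoot μ)
  have hh := (hull_sub_iff h (nsRoot μ) k).2 (by omega)
  refine ⟨(tIndex (k - (nsRoot μ).pair μ) (nsRoot μ)).toNat,
    (isEdge_sub_iff hl).2 ⟨h, hh, .inr ⟨hk, hp⟩⟩, ?_⟩
  rw [edgeLabel_sub, eq_tRoot_iff]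
  have : 0 ≤ tIndex (k - (nsRoot μ).pair μ) (nsRoot μ) := by
    unfold nsRoot at *
    split_ifs at * <;> simp only [tIndex] <;> omega
  omega

theorem isNonSwappable_iff {lam μ ν : Weight} (hl : Dominant lam) (h : Hull lam μ) :
    IsNonSwappable lam μ ν ↔ μ.1 ≠ 0 ∧
      ∃ k ∈ Finset.Ioc (nsStart lam μ) (nsEnd lam μ), μ - k • (nsRoot μ).vec = ν := by
  simp only [Finset.mem_Ioc]
  constructor
  · rintro ⟨β, j, he, hj, hn⟩
    obtain ⟨k, rfl⟩ := he.2.2.2.2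
    rw [Ne, swappable_iff hl he hj, not_not] at hn
    obtain ⟨h1, rfl, h2⟩ := hn
    rw [isEdge_sub_iff hl, hull_sub_iff h, reach_nsRoot] at he
    exact ⟨h1, k, ⟨h2, he.2.1.1⟩, rfl⟩
  · rintro ⟨h1, k, ⟨h2, h3⟩, rfl⟩
    have := nsStart_nonneg lam μ
    have := pair_le_nsStart h
    obtain ⟨j, he, hj⟩ := exists_label hl h (by omega) (by omega) h3
    refine ⟨_, j, he, hj, ?_⟩
    rw [Ne, swappable_iff hl he hj, not_not]
    exact ⟨h1, rfl, h2⟩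

theorem isNonSwappable_sub_iff {lam μ : Weight} {β : PosRoot} {k : ℤ} (hl : Dominant lam)
    (h : Hull lam μ) : IsNonSwappable lam μ (μ - k • β.vec) ↔
      μ.1 ≠ 0 ∧ β = nsRoot μ ∧ nsStart lam μ < k ∧ k ≤ nsEnd lam μ := by
  rw [isNonSwappable_iff hl h]
  simp only [Finset.mem_Ioc]
  have := nsStart_nonneg lam μ
  constructor
  · rintro ⟨h1, k', ⟨h2, h3⟩, e⟩
    obtain ⟨h4, rfl⟩ := PosRoot.smul_eq_smul e (by omega)
    exact ⟨h1, h4.symm, h2, h3⟩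
  · rintro ⟨h1, rfl, h2, h3⟩
    exact ⟨h1, k, ⟨h2, h3⟩, rfl⟩

theorem isSwappable_sub_iff {lam μ : Weight} {k : ℤ} (hl : Dominant lam)
    (h : Hull lam μ) (hμ : μ.1 ≠ 0) (hk : 0 < k) :
    IsSwappable lam μ (μ - k • (nsRoot μ).vec) ↔
      min (μ.1 + μ.2) μ.2 < k ∧ k ≤ nsStart lam μ ∧ k ≤ nsEnd lam μ := by
  constructor
  · rintro ⟨β, j, he, hj, hn⟩
    obtain ⟨k', e⟩ := he.2.2.2.2
    obtain ⟨rfl, rfl⟩ := PosRoot.smul_eq_smul e hk.ne'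
    rw [swappable_iff hl he hj] at hn
    rw [isEdge_sub_iff hl, hull_sub_iff h, reach_nsRoot, pair_nsRoot] at he
    have := he.2.2
    unfold Upward at this
    refine ⟨by omega, ?_, he.2.1.1⟩
    by_contra hc
    exact hn ⟨hμ, rfl, not_le.1 hc⟩
  · rintro ⟨h1, h2, h3⟩
    obtain ⟨j, he, hj⟩ := exists_label hl h hk h1 h3
    refine ⟨_, j, he, hj, ?_⟩
    rw [swappable_iff hl he hj]
    omega

/-- The number of non-swappable edges starting at `μ`. -/
def nsCount (lam μ : Weight) : ℤ :=
  if μ.1 = 0 then 0 else max 0 (nsEnd lam μ - nsStart lam μ)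

theorem NInf_eq {lam μ : Weight} (hl : Dominant lam) (h : Hull lam μ) :
    (NInf μ lam : ℤ) = nsCount lam μ := by
  rw [NInf, nsCount]
  split_ifs with h0
  · have : {ν | IsNonSwappable lam μ ν} = ∅ := by
      ext ν
      simp [isNonSwappable_iff hl h, h0]
    rw [this, Set.ncard_empty]; rfl
  · have : {ν | IsNonSwappable lam μ ν} =
        ((Finset.Ioc (nsStart lam μ) (nsEnd lam μ)).image fun k => μ - k • (nsRoot μ).vec :
          Finset Weight) := by
      ext ν
      rw [Set.mem_ofPred_eq, isNonSwappable_iff hl h, Finset.coe_image]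
      simp [h0]
    rw [this, Set.ncard_coe_finset,
      Finset.card_image_of_injective _ (sub_smul_vec_injective μ _), Int.card_Ioc]
    omega

/-- The length of the longest staircase of non-swappable edges over `(μ, λ)`. -/
def stairLength (lam μ : Weight) : ℤ :=
  if μ.1 ≠ 0 ∧ nsStart lam μ ≤ nsEnd lam μ ∧
      (nsStart lam μ = 0 ∨ min (μ.1 + μ.2) μ.2 < nsStart lam μ) ∧
      nsStart (lam.1, lam.2 + 1) μ ≤ nsStart lam μ then
    max 0 (lam.1 + lam.2 + min (μ.1 + μ.2) μ.2 - 2 * nsStart lam μ) else 0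

theorem Hull.add {lam μ : Weight} (h : Hull lam μ) (i : ℕ) : Hull (lam.1, lam.2 + i) μ := by
  obtain ⟨h1, h2, h3, h4, h5, h6, h7, h8, h9⟩ := h
  constructor <;> simp only <;> omega

theorem nsStart_mono (lam μ : Weight) {i : ℤ} (hi : 0 ≤ i) :
    nsStart lam μ ≤ nsStart (lam.1, lam.2 + i) μ := by
  unfold nsStart
  simp only
  generalize min (μ.1 + μ.2) μ.2 = X
  generalize max (μ.1 + μ.2) μ.2 = Y
  refine max_le_max le_rfl (max_le_max ?_ (max_le_max ?_ le_rfl)) <;> omega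

theorem nsStart_add_le (lam μ : Weight) {i : ℤ} (hi : 0 ≤ i) :
    nsStart (lam.1, lam.2 + i) μ ≤ nsStart lam μ + i := by
  unfold nsStart
  simp only
  generalize min (μ.1 + μ.2) μ.2 = X
  generalize max (μ.1 + μ.2) μ.2 = Y
  generalize (lam.1 - max μ.1 (-μ.1)) / 2 = w
  omega

theorem le_nsEnd_add {lam μ : Weight} {k i : ℤ} (hi : 0 ≤ i) (hk : k ≤ nsEnd lam μ) :
    k + i ≤ nsEnd (lam.1, lam.2 + i) μ ↔
      i ≤ lam.1 + lam.2 + min (μ.1 + μ.2) μ.2 - 2 * k := by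
  unfold nsEnd at *
  simp only
  generalize min (μ.1 + μ.2) μ.2 = X at *
  generalize max (μ.1 + μ.2) μ.2 = Y at *
  rw [le_min_iff] at *
  generalize max Y (-Y) = Z at *
  omega

/-- The edge at λ forces n ≤ `nsStart` for λ, the first step forces `nsStart` for λ + ϖ₂ to be at
most n, and `nsStart` is monotone: all three agree. Afterwards `nsStart` grows by at most one per
step, so only `nsEnd` limits the length. -/
theorem isNSStaircase_iff {lam μ : Weight} (hl : Dominant lam) (h : Hull lam μ) {a : ℕ}
    (ha : 1 ≤ a) : (∃ α n, IsNSStaircase μ lam α n a) ↔ (a : ℤ) ≤ stairLength lam μ := by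
  have hd (i : ℕ) : lam + i • varpi2 = (lam.1, lam.2 + (i : ℤ)) := by
    rw [add_smul_varpi2]
  have hdom (i : ℕ) : Dominant (lam.1, lam.2 + (i : ℤ)) := by
    obtain ⟨h1, h2⟩ := hl; exact ⟨h1, by simp only; omega⟩
  have hz (n i : ℕ) (v : Weight) : (n + i) • v = ((n : ℤ) + i) • v := by
    rw [← Nat.cast_add, natCast_zsmul]
  have hz' (n : ℕ) (v : Weight) : n • v = (n : ℤ) • v := (natCast_zsmul _ _).symm
  unfold IsNSStaircase
  simp only [hd, hz]
  constructor
  · rintro ⟨α, n, h1, h2⟩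
    have h3 := h1 1 le_rfl ha
    have h4 := h1 a ha le_rfl
    rw [isNonSwappable_sub_iff (hdom _) (h.add _)] at h3 h4
    obtain ⟨hμ, rfl, h5, h6⟩ := h3
    obtain ⟨-, -, h7, h8⟩ := h4
    have m1 := nsStart_mono lam μ (i := 1) (by omega)
    have m0 := nsStart_nonneg lam μ
    have hn : (n : ℤ) ≤ nsStart lam μ ∧ (n : ℤ) ≤ nsEnd lam μ ∧
        ((n : ℤ) = 0 ∨ min (μ.1 + μ.2) μ.2 < n) := by
      rcases n.eq_zero_or_pos with rfl | hn
      · have := (reach_nonneg h (nsRoot μ)).1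
        rw [reach_nsRoot] at this
        simp; omega
      · rcases h2 with h2 | h2
        · omega
        · rw [hz', isSwappable_sub_iff hl h hμ (by omega)] at h2
          exact ⟨h2.2.1, h2.2.2, .inr h2.1⟩
    simp only [Nat.cast_one] at h5
    have e : nsStart lam μ = n := by omega
    rw [le_nsEnd_add (by omega) hn.2.1] at h8
    rw [stairLength, e, if_pos ⟨hμ, hn.2.1, hn.2.2, by omega⟩]
    omega
  · intro hs
    rw [stairLength] at hs
    split_ifs at hs with hc
    · obtain ⟨c1, c2, c3, c4⟩ := hc
      have m0 := nsStart_nonneg lam μ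
      refine ⟨nsRoot μ, (nsStart lam μ).toNat, fun i hi hia => ?_, ?_⟩
      · rw [isNonSwappable_sub_iff (hdom _) (h.add _), Int.toNat_of_nonneg m0]
        refine ⟨c1, rfl, ?_, ?_⟩
        · have := nsStart_add_le (lam.1, lam.2 + 1) μ (i := (i : ℤ) - 1) (by omega)
          simp only at this
          rw [show lam.2 + 1 + ((i : ℤ) - 1) = lam.2 + i by ring] at this
          omega
        · rw [le_nsEnd_add (by omega) c2]; omega
      · rcases eq_or_ne (nsStart lam μ) 0 with h0 | h0
        · left; omega
        · right
          rw [hz', isSwappable_sub_iff hl h c1 (by omega)]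
          omega
    · omega

theorem stairLength_nonneg (lam μ : Weight) : 0 ≤ stairLength lam μ := by
  rw [stairLength]; split_ifs <;> omega

theorem DHatInf_eq {lam μ : Weight} (hl : Dominant lam) (h : Hull lam μ) :
    (DHatInf μ lam : ℤ) = stairLength lam μ := by
  have h0 := stairLength_nonneg lam μ
  have e : DHatInf μ lam = (stairLength lam μ).toNat := by
    refine IsGreatest.csSup_eq ⟨?_, fun a ha => ?_⟩
    · rcases Nat.eq_zero_or_pos (stairLength lam μ).toNat with hz | hz
      · rw [hz]
        -- The empty staircase, in any direction.
        exact ⟨.a1, 0, fun i h1 h2 => by omega, .inl rfl⟩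
      · exact (isNSStaircase_iff hl h hz).2 (by omega)
    · rcases Nat.eq_zero_or_pos a with rfl | hz
      · omega
      · have := (isNSStaircase_iff hl h hz).1 ha
        omega
  omega

/-- A vanishing preatomic number means that one of the three slacks d, m - d, m - 2d + 2c - b is
zero. -/
theorem Str.Principal.cases {m n : ℤ} {s : Str} (h : s.Principal m n) :
    s.Mem m n ∧ ((s.d = 0 ∧ s.atomicNeg m n = min s.c (m + 2 * s.c - s.b)) ∨
      (1 ≤ s.d ∧ s.d < m ∧ s.b = m - 2 * s.d + 2 * s.c ∧
        s.atomicNeg m n = min (s.d - 1) (n + s.d - s.c)) ∨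
      (1 ≤ s.d ∧ s.d = m ∧ s.b ≤ 2 * s.c - m ∧
        s.atomicNeg m n = 2 * s.c - s.b - s.d + min (s.d - 1) (n + s.d - s.c))) := by
  refine ⟨h.mem, ?_⟩
  obtain ⟨⟨h1, h2, h3, h4, h5, h6, h7, h8⟩, h9⟩ := h
  simp only [Str.preatomic] at h9
  simp only [Str.atomicNeg]
  split_ifs <;> omega

theorem Str.Principal.hull_neg {m n : ℤ} {s : Str} (h : s.Principal m n) (hw : s.wt1 m ≤ 0) :
    s.atomicNeg m n ≤ n ∧ Hull (m, n - s.atomicNeg m n) (s.wt1 m, s.wt2 n) := by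
  obtain ⟨⟨h1, h2, h3, h4, h5, h6, h7, h8⟩, h9⟩ := h.cases
  simp only [Str.wt1] at hw
  rcases h9 with ⟨c1, c2⟩ | ⟨c1, c2, c3, c4⟩ | ⟨c1, c2, c3, c4⟩
  · refine ⟨by omega, ?_⟩
    constructor <;> simp only [Str.wt1, Str.wt2] <;> omega
  · refine ⟨by omega, ?_⟩
    constructor <;> simp only [Str.wt1, Str.wt2] <;> omega
  · refine ⟨by omega, ?_⟩
    constructor <;> simp only [Str.wt1, Str.wt2] <;> omega

theorem Str.Principal.ph_n2_neg {m n : ℤ} {s : Str} (h : s.Principal m n) :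
    s.ph m n .n2 = reach (m, n - s.atomicNeg m n) .a2 (s.wt1 m, s.wt2 n) := by
  obtain ⟨⟨h1, h2, h3, h4, h5, h6, h7, h8⟩, h9⟩ := h.cases
  simp only [reach, Str.ph, Str.ep, Str.wt1, Str.wt2]
  rcases h9 with ⟨c1, c2⟩ | ⟨c1, c2, c3, c4⟩ | ⟨c1, c2, c3, c4⟩
  · omega
  · omega
  · omega

/-! ### The values of `φ_i` on a principal preatom -/

/-- The value of `φ₁₂`. -/
def Str.ph12 (m n : ℤ) (s : Str) : ℤ :=
  max (max s.dualD (s.b + s.d - s.ep .n1 - (s.a + s.c - s.dualD)))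
    (s.a + s.c - s.dualD - s.ph m n .n1) + (s.wt1 m + s.wt2 n)

theorem Str.ph_reverse_n2 (m n : ℤ) (s : Str) :
    (s.reverse m n .n1).ph m n .n2 = s.ph12 m n := by
  have : (s.reverse m n .n1).ep .n2 =
      max (max s.dualD (s.b + s.d - s.ep .n1 - (s.a + s.c - s.dualD)))
      (s.a + s.c - s.dualD - s.ph m n .n1) := by
    simp only [ep, reverse, move, ofDual]
    congr 2
    ring
  have h2 := wt2_reverse (m := m) (n := n) (s := s)
  rw [ph12, ← this]
  simp only [ph]
  omega

theorem Str.Principal.cases_neg {m n : ℤ} {s : Str} (h : s.Principal m n) (hw : s.wt1 m ≤ 0) :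
    (s.d = 0 ∧ s.atomicNeg m n = min s.c (m + 2 * s.c - s.b) ∧
        ((s.a ≤ s.c ∧ s.a ≤ s.b - s.c ∧ s.ep .n1 = s.b - 2 * s.a ∧ s.dualD = s.a) ∨
         (s.b - s.c ≤ s.a ∧ s.b ≤ 2 * s.c ∧ s.ep .n1 = 2 * s.c - s.b ∧ s.dualD = s.b - s.c) ∨
         (s.c ≤ s.a ∧ 2 * s.c ≤ s.b ∧ s.ep .n1 = max 0 (s.b - 2 * s.a) ∧ s.dualD = s.c))) ∨
      (1 ≤ s.d ∧ s.d < m ∧ s.b = m - 2 * s.d + 2 * s.c ∧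
        s.atomicNeg m n = min (s.d - 1) (n + s.d - s.c) ∧
        ((s.a ≤ s.c - s.d ∧ s.ep .n1 = s.b - 2 * s.a ∧ s.dualD = s.a) ∨
         (s.c - s.d ≤ s.a ∧ s.ep .n1 = max s.d (s.b - 2 * s.a) ∧ s.dualD = s.c - s.d))) ∨
      (1 ≤ s.d ∧ s.d = m ∧ s.b ≤ 2 * s.c - m ∧
        s.atomicNeg m n = 2 * s.c - s.b - s.d + min (s.d - 1) (n + s.d - s.c) ∧
        ((s.a ≤ s.b - s.c ∧ s.ep .n1 = s.b - 2 * s.a ∧ s.dualD = s.a) ∨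
         (s.b - s.c ≤ s.a ∧ s.ep .n1 = 2 * s.c - s.b ∧ s.dualD = s.b - s.c))) := by
  obtain ⟨⟨h1, h2, h3, h4, h5, h6, h7, h8⟩, h9⟩ := h.cases
  simp only [Str.wt1, Str.dualD, Str.ep] at *
  rcases h9 with h9 | h9 | h9
  · refine .inl ⟨h9.1, h9.2, ?_⟩
    rcases le_total s.a s.c with g | g <;> rcases le_total s.a (s.b - s.c) with g' | g' <;> omega
  · refine .inr (.inl ⟨h9.1, h9.2.1, h9.2.2.1, h9.2.2.2, ?_⟩)
    rcases le_total s.a (s.c - s.d) with g | g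
    · left; omega
    · right; omega
  · refine .inr (.inr ⟨h9.1, h9.2.1, h9.2.2.1, h9.2.2.2, ?_⟩)
    rcases le_total s.a (s.b - s.c) with g | g
    · left; omega
    · right; omega

/-- This identity turns the formulas for φ₂ and φ₁₂ into one for φ₁, hence into the comparison of
the two statistics. It is doubled because ρ^∨ is half-integral. -/
theorem Str.Principal.ph_add_neg {m n : ℤ} {s : Str} (h : s.Principal m n) (hw : s.wt1 m ≤ 0) :
    2 * (s.ph m n .n1 + s.ph m n .n2 + s.ph12 m n +
      reach (m, n - s.atomicNeg m n) .a21 (s.wt1 m, s.wt2 n) + s.atomicNeg m n) =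
    3 * (m + s.wt1 m) + 4 * (n + s.wt2 n) := by
  have h9 := h.cases_neg hw
  obtain ⟨h1, h2, h3, h4, h5, h6, h7, h8⟩ := h.mem
  rw [Str.wt1] at hw
  simp only [Str.ph12, reach, Str.ph, Str.wt1, Str.wt2]
  have e2 : s.ep .n2 = s.a := rfl
  rw [e2]
  generalize s.dualD = D at *
  generalize s.ep .n1 = E at *
  generalize s.atomicNeg m n = A at *
  rcases h9 with ⟨c1, c2, c3⟩ | ⟨c1, c2, c3, c4, c5⟩ | ⟨c1, c2, c3, c4, c5⟩
  · rcases c3 with ⟨d1, d2, d3, d4⟩ | ⟨d1, d2, d3, d4⟩ | ⟨d1, d2, d3, d4⟩ <;> omega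
  · rcases c5 with ⟨d1, d2, d3⟩ | ⟨d1, d2, d3⟩ <;> omega
  · rcases c5 with ⟨d1, d2, d3⟩ | ⟨d1, d2, d3⟩ <;> omega

/-- The case logic of the φ₁₂ formula, with R = φ̂₁₂, t = `nsStart`, P the condition μ₁ = 0 and c
the remaining staircase conditions. If P holds or R < t, both corrections vanish. Otherwise
subtracting the non-swappable edges leaves t, to which a staircase may add. -/
theorem eq_sub_add_stair {R t A S φ : ℤ} {P c : Prop} [Decidable P] [Decidable c] (hA : 0 ≤ A)
    (h1 : P → φ = R) (h2 : ¬ P → R < t → φ = R) (h3 : ¬ P → t ≤ R → c → φ = t + min A (max 0 S))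
    (h4 : ¬ P → t ≤ R → ¬ c → φ = t) :
    φ = R - (if P then 0 else max 0 (R - t)) + min A (if ¬ P ∧ t ≤ R ∧ c then max 0 S else 0) := by
  by_cases hP : P
  · rw [if_pos hP, if_neg (by tauto), h1 hP]; omega
  · rw [if_neg hP]
    by_cases ht : t ≤ R
    · by_cases hc : c
      · rw [if_pos ⟨hP, ht, hc⟩, h3 hP ht hc]; omega
      · rw [if_neg (by tauto), h4 hP ht hc]; omega
    · rw [if_neg (by tauto), h2 hP (by omega)]; omega

-- The cases are the region of the preatom, the term attaining the minimum in A, and the term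
-- attaining ε₁. In each the maximum in `nsStart` collapses to `t0`. For d > 0 the threshold is the
-- same for λ + ϖ₂; for d = 0 it depends on a parity if A = c, and it strictly increases if A = m +
-- 2c - b, which rules out staircases.
set_option maxHeartbeats 4000000 in
theorem Str.Principal.ph12_neg {m n : ℤ} {s : Str} (h : s.Principal m n) (hw : s.wt1 m ≤ 0) :
    s.ph12 m n = reach (m, n - s.atomicNeg m n) .a12 (s.wt1 m, s.wt2 n) -
      nsCount (m, n - s.atomicNeg m n) (s.wt1 m, s.wt2 n) +
      min (s.atomicNeg m n) (stairLength (m, n - s.atomicNeg m n) (s.wt1 m, s.wt2 n)) := by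
  have h9 := h.cases_neg hw
  obtain ⟨h1, h2, h3, h4, h5, h6, h7, h8⟩ := h.mem
  have hx : s.wt1 m + s.wt2 n = m + n - (s.b + s.d) := by simp only [Str.wt1, Str.wt2]; ring
  have hx' : min (m + n - (s.b + s.d)) (s.wt2 n) = m + n - (s.b + s.d) := by omega
  have hy' : max (m + n - (s.b + s.d)) (s.wt2 n) = s.wt2 n := by
    rw [max_eq_right (by omega)]
  have hw' : max (s.wt1 m) (-s.wt1 m) = -s.wt1 m := by
    rw [max_eq_right (by omega)]
  rw [Str.ph12, nsCount, stairLength]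
  generalize ht : nsStart (m, n - s.atomicNeg m n) (s.wt1 m, s.wt2 n) = t
  generalize ht1 : nsStart (m, n - s.atomicNeg m n + 1) (s.wt1 m, s.wt2 n) = t1
  simp only [nsStart, reach, nsEnd, hx, hx', hy', hw'] at ht ht1 ⊢
  clear hx hx' hy' hw'
  have hp : s.ph m n .n1 = s.ep .n1 + s.wt1 m := rfl
  rw [hp]
  have hw1 : s.wt1 m = m - 2 * (s.b + s.d) + 2 * (s.a + s.c) := rfl
  have hw2 : s.wt2 n = n + s.b + s.d - 2 * (s.a + s.c) := rfl
  generalize s.wt1 m = p at *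
  generalize s.wt2 n = y at *
  generalize s.dualD = D at *
  generalize s.ep .n1 = E at *
  generalize s.atomicNeg m n = A at *
  generalize hR : min ((m + (n - A) + (m + n - (s.b + s.d))) / 2)
      ((m + 2 * (n - A) + (m + n - (s.b + s.d)) - max y (-y)) / 2) = R
  subst hw2
  subst hw1
  have hA0 : 0 ≤ A := by clear ht ht1 hR; omega
  -- R is replaced by linear upper bounds, at least one of them tight up to rounding, to eliminate
  -- the floor and |y|.
  have hR1 : 2 * R ≤ m + (n - A) + (m + n - (s.b + s.d)) := by clear h9 ht ht1; omega
  have hR2 : R ≤ m + n - A - s.b - s.d + s.a + s.c := by clear h9 ht ht1; omega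
  have hR3 : R ≤ m + 2 * n - A - s.a - s.c := by clear h9 ht ht1; omega
  have hR4 : m + (n - A) + (m + n - (s.b + s.d)) ≤ 2 * R + 1 ∨
      R = m + n - A - s.b - s.d + s.a + s.c ∨ R = m + 2 * n - A - s.a - s.c := by
    clear h9 ht ht1; omega
  clear hR
  generalize hφ : max (max D (s.b + s.d - E - (s.a + s.c - D)))
      (s.a + s.c - D - (E + (m - 2 * (s.b + s.d) + 2 * (s.a + s.c)))) +
      (m + n - (s.b + s.d)) = φ
  rcases h9 with ⟨c1, c2, c3⟩ | ⟨c1, c2, c3, c4, c5⟩ | ⟨c1, c2, c3, c4, c5⟩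
  · rcases le_total s.c (m + 2 * s.c - s.b) with g | g
    · rw [min_eq_left g] at c2
      have t0 : t = (2 * n + m - s.b - s.c + 1) / 2 + max 0 (m - s.b + s.a + s.c) := by
        clear ht1 c3 hφ hR4; omega
      have t0' : t1 = (2 * n + m - s.b - s.c + 2) / 2 + max 0 (m - s.b + s.a + s.c) := by
        clear c3 t0 hφ hR4; omega
      clear ht ht1
      subst c2
      rcases c3 with ⟨d1, d2, d3, d4⟩ | ⟨d1, d2, d3, d4⟩ | ⟨d1, d2, d3, d4⟩
      · have hphi : φ = max s.a (s.b - m - s.c) + (m + n - s.b - s.d) := by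
          clear hR1 hR2 hR3 hR4 t0 t0'; omega
        clear hφ
        rcases le_total (m - s.b + s.a + s.c) 0 with g0 | g0
        · rw [max_eq_left g0] at t0 t0'
          apply eq_sub_add_stair hA0
          · intro _; omega
          · intro _ _; omega
          · intro _ _ _; omega
          · intro _ _ _; omega
        · rw [max_eq_right g0] at t0 t0'
          apply eq_sub_add_stair hA0
          · intro _; omega
          · intro _ _; omega
          · intro _ _ _; omega
          · intro _ _ _; omega
      · have hphi : φ = max (s.b - s.c) (2 * s.b - m - 2 * s.c - s.a) +
              (m + n - s.b - s.d) := by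
          clear hR1 hR2 hR3 hR4 t0 t0'; omega
        clear hφ
        rcases le_total (m - s.b + s.a + s.c) 0 with g0 | g0
        · rw [max_eq_left g0] at t0 t0'
          apply eq_sub_add_stair hA0
          · intro _; omega
          · intro _ _; omega
          · intro _ _ _; omega
          · intro _ _ _; omega
        · rw [max_eq_right g0] at t0 t0'
          apply eq_sub_add_stair hA0
          · intro _; omega
          · intro _ _; omega
          · intro _ _ _; omega
          · intro _ _ _; omega
      · rcases le_total (s.b - 2 * s.a) 0 with g1 | g1
        · rw [max_eq_left g1] at d3
          have hphi : φ = max (max s.c (s.b - s.a)) (2 * s.b - m - 2 * s.c - s.a) +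
              (m + n - s.b - s.d) := by
            clear hR1 hR2 hR3 hR4 t0 t0'; omega
          clear hφ
          rcases le_total (m - s.b + s.a + s.c) 0 with g0 | g0
          · rw [max_eq_left g0] at t0 t0'
            apply eq_sub_add_stair hA0
            · intro _; omega
            · intro _ _; omega
            · intro _ _ _; omega
            · intro _ _ _; omega
          · rw [max_eq_right g0] at t0 t0'
            apply eq_sub_add_stair hA0
            · intro _; omega
            · intro _ _; omega
            · intro _ _ _; omega
            · intro _ _ _; omega
        · rw [max_eq_right g1] at d3
          have hphi : φ = max s.a (max s.c (s.b + s.a - m - 2 * s.c)) + (m + n - s.b - s.d) := by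
            clear hR1 hR2 hR3 hR4 t0 t0'; omega
          clear hφ
          rcases le_total (m - s.b + s.a + s.c) 0 with g0 | g0
          · rw [max_eq_left g0] at t0 t0'
            apply eq_sub_add_stair hA0
            · intro _; omega
            · intro _ _; omega
            · intro _ _ _; omega
            · intro _ _ _; omega
          · rw [max_eq_right g0] at t0 t0'
            apply eq_sub_add_stair hA0
            · intro _; omega
            · intro _ _; omega
            · intro _ _ _; omega
            · intro _ _ _; omega
    · rw [min_eq_right g] at c2
      have t0 : t = n - s.c + max 0 (m - s.b + s.a + s.c) := by
        clear ht1 c3 hφ hR4; omega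
      have t0' : t < t1 := by clear c3 t0 hφ hR4; omega
      clear ht ht1
      subst c2
      rcases c3 with ⟨d1, d2, d3, d4⟩ | ⟨d1, d2, d3, d4⟩ | ⟨d1, d2, d3, d4⟩
      · have hphi : φ = max s.a (s.b - m - s.c) + (m + n - s.b - s.d) := by
          clear hR1 hR2 hR3 hR4 t0 t0'; omega
        clear hφ
        rcases le_total (m - s.b + s.a + s.c) 0 with g0 | g0
        · rw [max_eq_left g0] at t0
          apply eq_sub_add_stair hA0
          · intro _; omega
          · intro _ _; omega
          · intro _ _ _; omega
          · intro _ _ _; omega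
        · rw [max_eq_right g0] at t0
          apply eq_sub_add_stair hA0
          · intro _; omega
          · intro _ _; omega
          · intro _ _ _; omega
          · intro _ _ _; omega
      · have hphi : φ = max (s.b - s.c) (2 * s.b - m - 2 * s.c - s.a) +
              (m + n - s.b - s.d) := by
          clear hR1 hR2 hR3 hR4 t0 t0'; omega
        clear hφ
        rcases le_total (m - s.b + s.a + s.c) 0 with g0 | g0
        · rw [max_eq_left g0] at t0
          apply eq_sub_add_stair hA0
          · intro _; omega
          · intro _ _; omega
          · intro _ _ _; omega
          · intro _ _ _; omega
        · rw [max_eq_right g0] at t0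
          apply eq_sub_add_stair hA0
          · intro _; omega
          · intro _ _; omega
          · intro _ _ _; omega
          · intro _ _ _; omega
      · rcases le_total (s.b - 2 * s.a) 0 with g1 | g1
        · rw [max_eq_left g1] at d3
          have hphi : φ = max (max s.c (s.b - s.a)) (2 * s.b - m - 2 * s.c - s.a) +
              (m + n - s.b - s.d) := by
            clear hR1 hR2 hR3 hR4 t0 t0'; omega
          clear hφ
          rcases le_total (m - s.b + s.a + s.c) 0 with g0 | g0
          · rw [max_eq_left g0] at t0
            apply eq_sub_add_stair hA0
            · intro _; omega
            · intro _ _; omega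
            · intro _ _ _; omega
            · intro _ _ _; omega
          · rw [max_eq_right g0] at t0
            apply eq_sub_add_stair hA0
            · intro _; omega
            · intro _ _; omega
            · intro _ _ _; omega
            · intro _ _ _; omega
        · rw [max_eq_right g1] at d3
          have hphi : φ = max s.a (max s.c (s.b + s.a - m - 2 * s.c)) + (m + n - s.b - s.d) := by
            clear hR1 hR2 hR3 hR4 t0 t0'; omega
          clear hφ
          rcases le_total (m - s.b + s.a + s.c) 0 with g0 | g0
          · rw [max_eq_left g0] at t0
            apply eq_sub_add_stair hA0
            · intro _; omega
            · intro _ _; omega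
            · intro _ _ _; omega
            · intro _ _ _; omega
          · rw [max_eq_right g0] at t0
            apply eq_sub_add_stair hA0
            · intro _; omega
            · intro _ _; omega
            · intro _ _ _; omega
            · intro _ _ _; omega
  · rcases le_total (s.d - 1) (n + s.d - s.c) with g | g
    · rw [min_eq_left g] at c4
      have t0 : t = n - s.c + 1 + max 0 (s.a + s.d - s.c) := by clear ht1 c5 hφ hR4; omega
      have t0' : t1 = n - s.c + 1 + max 0 (s.a + s.d - s.c) := by clear ht c5 t0 hφ hR4; omega
      clear ht ht1
      subst c4
      rcases c5 with ⟨d1, d2, d3⟩ | ⟨d1, d2, d3⟩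
      · have hphi : φ = s.c + (m + n - s.b - s.d) := by
          clear hR1 hR2 hR3 hR4 t0 t0'; omega
        clear hφ
        rcases le_total (s.a + s.d - s.c) 0 with g0 | g0
        · rw [max_eq_left g0] at t0 t0'
          apply eq_sub_add_stair hA0
          · intro _; omega
          · intro _ _; omega
          · intro _ _ _; omega
          · intro _ _ _; omega
        · rw [max_eq_right g0] at t0 t0'
          apply eq_sub_add_stair hA0
          · intro _; omega
          · intro _ _; omega
          · intro _ _ _; omega
          · intro _ _ _; omega
      · have hphi : φ = max (s.c - s.d) (m - s.d + 2 * s.c - s.a - E) + (m + n - s.b - s.d) := by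
          clear hR1 hR2 hR3 hR4 t0 t0'; omega
        clear hφ
        rcases le_total (s.a + s.d - s.c) 0 with g0 | g0
        · rw [max_eq_left g0] at t0 t0'
          apply eq_sub_add_stair hA0
          · intro _; omega
          · intro _ _; omega
          · intro _ _ _; omega
          · intro _ _ _; omega
        · rw [max_eq_right g0] at t0 t0'
          apply eq_sub_add_stair hA0
          · intro _; omega
          · intro _ _; omega
          · intro _ _ _; omega
          · intro _ _ _; omega
    · rw [min_eq_right g] at c4
      have t0 : t = max 0 (s.a + s.d - s.c) := by clear ht1 c5 hφ hR4; omega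
      have t0' : t1 = max 0 (s.a + s.d - s.c) := by clear ht c5 t0 hφ hR4; omega
      clear ht ht1
      subst c4
      rcases c5 with ⟨d1, d2, d3⟩ | ⟨d1, d2, d3⟩
      · have hphi : φ = s.c + (m + n - s.b - s.d) := by
          clear hR1 hR2 hR3 hR4 t0 t0'; omega
        clear hφ
        rcases le_total (s.a + s.d - s.c) 0 with g0 | g0
        · rw [max_eq_left g0] at t0 t0'
          apply eq_sub_add_stair hA0
          · intro _; omega
          · intro _ _; omega
          · intro _ _ _; omega
          · intro _ _ _; omega
        · rw [max_eq_right g0] at t0 t0'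
          apply eq_sub_add_stair hA0
          · intro _; omega
          · intro _ _; omega
          · intro _ _ _; omega
          · intro _ _ _; omega
      · have hphi : φ = max (s.c - s.d) (m - s.d + 2 * s.c - s.a - E) + (m + n - s.b - s.d) := by
          clear hR1 hR2 hR3 hR4 t0 t0'; omega
        clear hφ
        rcases le_total (s.a + s.d - s.c) 0 with g0 | g0
        · rw [max_eq_left g0] at t0 t0'
          apply eq_sub_add_stair hA0
          · intro _; omega
          · intro _ _; omega
          · intro _ _ _; omega
          · intro _ _ _; omega
        · rw [max_eq_right g0] at t0 t0'
          apply eq_sub_add_stair hA0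
          · intro _; omega
          · intro _ _; omega
          · intro _ _ _; omega
          · intro _ _ _; omega
  · rcases le_total (s.d - 1) (n + s.d - s.c) with g | g
    · rw [min_eq_left g] at c4
      have t0 : t = n - s.c + 1 + max 0 (s.a + s.c - s.b) := by clear ht1 c5 hφ hR4; omega
      have t0' : t1 = n - s.c + 1 + max 0 (s.a + s.c - s.b) := by clear ht c5 t0 hφ hR4; omega
      clear ht ht1
      subst c4
      rcases c5 with ⟨d1, d2, d3⟩ | ⟨d1, d2, d3⟩
      · have hphi : φ = (s.b + m - s.c) + (m + n - s.b - s.d) := by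
          clear hR1 hR2 hR3 hR4 t0 t0'; omega
        clear hφ
        rcases le_total (s.a + s.c - s.b) 0 with g0 | g0
        · rw [max_eq_left g0] at t0 t0'
          apply eq_sub_add_stair hA0
          · intro _; omega
          · intro _ _; omega
          · intro _ _ _; omega
          · intro _ _ _; omega
        · rw [max_eq_right g0] at t0 t0'
          apply eq_sub_add_stair hA0
          · intro _; omega
          · intro _ _; omega
          · intro _ _ _; omega
          · intro _ _ _; omega
      · have hphi : φ = max (s.b - s.c) (2 * s.b + m - 2 * s.c - s.a) + (m + n - s.b - s.d) := by
          clear hR1 hR2 hR3 hR4 t0 t0'; omega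
        clear hφ
        rcases le_total (s.a + s.c - s.b) 0 with g0 | g0
        · rw [max_eq_left g0] at t0 t0'
          apply eq_sub_add_stair hA0
          · intro _; omega
          · intro _ _; omega
          · intro _ _ _; omega
          · intro _ _ _; omega
        · rw [max_eq_right g0] at t0 t0'
          apply eq_sub_add_stair hA0
          · intro _; omega
          · intro _ _; omega
          · intro _ _ _; omega
          · intro _ _ _; omega
    · rw [min_eq_right g] at c4
      have t0 : t = max 0 (s.a + s.c - s.b) := by clear ht1 c5 hφ hR4; omega
      have t0' : t1 = max 0 (s.a + s.c - s.b) := by clear ht c5 t0 hφ hR4; omega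
      clear ht ht1
      subst c4
      rcases c5 with ⟨d1, d2, d3⟩ | ⟨d1, d2, d3⟩
      · have hphi : φ = (s.b + m - s.c) + (m + n - s.b - s.d) := by
          clear hR1 hR2 hR3 hR4 t0 t0'; omega
        clear hφ
        rcases le_total (s.a + s.c - s.b) 0 with g0 | g0
        · rw [max_eq_left g0] at t0 t0'
          apply eq_sub_add_stair hA0
          · intro _; omega
          · intro _ _; omega
          · intro _ _ _; omega
          · intro _ _ _; omega
        · rw [max_eq_right g0] at t0 t0'
          apply eq_sub_add_stair hA0
          · intro _; omega
          · intro _ _; omega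
          · intro _ _ _; omega
          · intro _ _ _; omega
      · have hphi : φ = max (s.b - s.c) (2 * s.b + m - 2 * s.c - s.a) + (m + n - s.b - s.d) := by
          clear hR1 hR2 hR3 hR4 t0 t0'; omega
        clear hφ
        rcases le_total (s.a + s.c - s.b) 0 with g0 | g0
        · rw [max_eq_left g0] at t0 t0'
          apply eq_sub_add_stair hA0
          · intro _; omega
          · intro _ _; omega
          · intro _ _ _; omega
          · intro _ _ _; omega
        · rw [max_eq_right g0] at t0 t0'
          apply eq_sub_add_stair hA0
          · intro _; omega
          · intro _ _; omega
          · intro _ _ _; omega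
          · intro _ _ _; omega

/-! ### The recharge of an element of the crystal -/

section Up

variable {m n p : ℤ} {s : Str}

theorem Str.wt1_up : (s.up p).wt1 (m + 2 * p) = s.wt1 m := by
  simp only [Str.wt1, Str.up]; ring

theorem Str.wt2_up : (s.up p).wt2 n = s.wt2 n := by
  simp only [Str.wt2, Str.up]; ring

theorem Str.ep_n1_up : (s.up p).ep .n1 = s.ep .n1 + p := by
  simp only [Str.ep, Str.up]; omega

theorem Str.dualD_up : (s.up p).dualD = s.dualD := by
  simp only [Str.dualD, Str.up]; omega

theorem Str.ph_n1_up : (s.up p).ph (m + 2 * p) n .n1 = s.ph m n .n1 + p := by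
  have h1 := Str.wt1_up (m := m) (p := p) (s := s)
  have h2 := Str.ep_n1_up (p := p) (s := s)
  simp only [Str.ph]
  omega

theorem Str.ph_n2_up : (s.up p).ph (m + 2 * p) n .n2 = s.ph m n .n2 := by
  have h := Str.wt2_up (n := n) (p := p) (s := s)
  simp only [Str.ph]
  rw [h]; rfl

theorem Str.ph12_up : (s.up p).ph12 (m + 2 * p) n = s.ph12 m n := by
  rw [Str.ph12, Str.ph12, Str.wt1_up, Str.wt2_up, Str.ph_n1_up, Str.ep_n1_up, Str.dualD_up]
  simp only [Str.up]
  congr 2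
  · congr 1; ring
  · ring

end Up

theorem Str.up_core (m : ℤ) (s : Str) : (s.core m).up (s.preatomic m) = s := by
  simp [Str.core, Str.up]

/-! ### The symmetry s₁ and the case μ₁ > 0. -/

/-- The action of `s₁` on weights. -/
def reflOne (μ : Weight) : Weight := (-μ.1, μ.2 + μ.1)

theorem Hull.of_reflOne {lam μ : Weight} (h : Hull lam (reflOne μ)) : Hull lam μ := by
  obtain ⟨h1, h2, h3, h4, h5, h6, h7, h8, h9⟩ := h
  simp only [reflOne] at *
  constructor <;> omega

/-- s₁ exchanges the coordinates x and y, hence α₂ and α₁₂, and fixes α₂₁. -/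
theorem reach_a2_reflOne (lam μ : Weight) : reach lam .a2 (reflOne μ) = reach lam .a12 μ := by
  simp only [reach, reflOne]
  rw [show -μ.1 + (μ.2 + μ.1) = μ.2 by ring, add_comm μ.2]

theorem reach_a12_reflOne (lam μ : Weight) : reach lam .a12 (reflOne μ) = reach lam .a2 μ := by
  simp only [reach, reflOne]
  rw [show -μ.1 + (μ.2 + μ.1) = μ.2 by ring, add_comm μ.2]

theorem reach_a21_reflOne (lam μ : Weight) : reach lam .a21 (reflOne μ) = reach lam .a21 μ := by
  simp only [reach, reflOne]
  rw [show -μ.1 + (μ.2 + μ.1) = μ.2 by ring, add_comm μ.2, min_comm μ.2,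
    show -μ.1 + 2 * (μ.1 + μ.2) = μ.1 + 2 * μ.2 by ring]

theorem nsStart_reflOne (lam μ : Weight) : nsStart lam (reflOne μ) = nsStart lam μ := by
  simp only [nsStart, reflOne]
  rw [show -μ.1 + (μ.2 + μ.1) = μ.2 by ring, add_comm μ.2, min_comm μ.2, max_comm μ.2, neg_neg,
    max_comm (-μ.1)]

theorem nsEnd_reflOne (lam μ : Weight) : nsEnd lam (reflOne μ) = nsEnd lam μ := by
  simp only [nsEnd, reflOne]
  rw [show -μ.1 + (μ.2 + μ.1) = μ.2 by ring, add_comm μ.2, min_comm μ.2, max_comm μ.2]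

theorem nsCount_reflOne (lam μ : Weight) : nsCount lam (reflOne μ) = nsCount lam μ := by
  rw [nsCount, nsCount, nsStart_reflOne, nsEnd_reflOne]
  simp [reflOne]

theorem stairLength_reflOne (lam μ : Weight) :
    stairLength lam (reflOne μ) = stairLength lam μ := by
  rw [stairLength, stairLength, nsStart_reflOne, nsEnd_reflOne, nsStart_reflOne]
  have : min ((reflOne μ).1 + (reflOne μ).2) (reflOne μ).2 = min (μ.1 + μ.2) μ.2 := by
    simp only [reflOne]
    rw [show -μ.1 + (μ.2 + μ.1) = μ.2 by ring, add_comm μ.2, min_comm μ.2]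
  rw [this]
  simp [reflOne]

namespace Str.Principal

variable {m n : ℤ} {s : Str}

theorem hull (h : s.Principal m n) :
    s.atomic m n ≤ n ∧ Hull (m, n - s.atomic m n) (s.wt1 m, s.wt2 n) := by
  rw [atomic]
  split_ifs with hw
  · exact h.hull_neg hw
  · have := h.reverse.hull_neg (by rw [wt1_reverse]; omega)
    rw [wt1_reverse, wt2_reverse] at this
    exact ⟨this.1, Hull.of_reflOne this.2⟩

/-- For μ₁ > 0 the identity for s₁T is used: φ₁(s₁T) = φ₁(T) - μ₁ and ⟨s₁μ, ρ^∨⟩ = ⟨μ, ρ^∨⟩ - μ₁, so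
both sides change equally. -/
theorem ph_n1_eq (h : s.Principal m n) :
    let lam : Weight := (m, n - s.atomic m n)
    let μ : Weight := (s.wt1 m, s.wt2 n)
    2 * (s.ph m n .n1 + (reach lam .a2 μ + (reach lam .a12 μ + reach lam .a21 μ)) - nsCount lam μ +
      min (s.atomic m n) (stairLength lam μ) + s.atomic m n) =
    3 * (m + s.wt1 m) + 4 * (n + s.wt2 n) := by
  dsimp only
  rw [atomic]
  split_ifs with hw
  · have h1 := h.ph_add_neg hw
    have h2 := h.ph12_neg hw
    have h3 := h.ph_n2_neg
    omega
  · have hw' : (s.reverse m n .n1).wt1 m ≤ 0 := by rw [wt1_reverse]; omega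
    have h1 := h.reverse.ph_add_neg hw'
    have h2 := h.reverse.ph12_neg hw'
    have h3 := h.reverse.ph_n2_neg
    have e : ((s.reverse m n .n1).wt1 m, (s.reverse m n .n1).wt2 n) =
        reflOne (s.wt1 m, s.wt2 n) := by rw [wt1_reverse, wt2_reverse]; rfl
    rw [e] at h1 h2 h3
    rw [reach_a21_reflOne] at h1
    rw [reach_a12_reflOne, nsCount_reflOne, stairLength_reflOne] at h2
    rw [reach_a2_reflOne] at h3
    rw [ph_reverse h.mem, wt1_reverse, wt2_reverse] at h1
    have h4 : s.ph m n .n1 = s.ep .n1 + s.wt1 m := rfl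
    omega

end Str.Principal

theorem recharge_element {lam' : Weight} {s : Str} (h : s.In lam') (p A : ℕ)
    (lam μ : Weight) (hp : p = pat lam' (element lam' s)) (hlam : lam = lam' - (2 * p) • varpi1)
    (hA : A = atomicNumber lam' (element lam' s)) (hμ : μ = wt (element lam' s)) :
    (μ.1 ≤ 0 →
      (phi .n2 (element lam' s) : ℤ) = phiHat .a2 μ (lam - A • varpi2) ∧
      (phi12 (element lam' s) : ℤ) = phiHat .a12 μ (lam - A • varpi2)
        - NInf μ (lam - A • varpi2) + DInf μ lam A) ∧
    rInf lam' (element lam' s) = rPar (element lam' s) := by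
  have hpZ := pat_element h
  have hAZ := atomicNumber_element h
  have hw := preatomWeight_element h
  have hU := Str.core_principal h
  have hsU := Str.up_core lam'.1 s
  rw [← hp] at hpZ
  rw [← hA] at hAZ
  rw [wt_element h] at hμ
  set U := s.core lam'.1 with hUdef
  rw [← hpZ] at hAZ hw hU hsU
  have hm : lam'.1 = lam'.1 - 2 * p + 2 * p := by ring
  have w1 : s.wt1 lam'.1 = U.wt1 (lam'.1 - 2 * p) := by
    conv_lhs => rw [← hsU, hm, Str.wt1_up]
  have w2 : s.wt2 lam'.2 = U.wt2 lam'.2 := by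
    conv_lhs => rw [← hsU, Str.wt2_up]
  have p1 : s.ph lam'.1 lam'.2 .n1 = U.ph (lam'.1 - 2 * p) lam'.2 .n1 + p := by
    conv_lhs => rw [← hsU, hm, Str.ph_n1_up]
  have p2 : s.ph lam'.1 lam'.2 .n2 = U.ph (lam'.1 - 2 * p) lam'.2 .n2 := by
    conv_lhs => rw [← hsU, hm, Str.ph_n2_up]
  have p12 : s.ph12 lam'.1 lam'.2 = U.ph12 (lam'.1 - 2 * p) lam'.2 := by
    conv_lhs => rw [← hsU, hm, Str.ph12_up]
  have hlam' : lam = (lam'.1 - 2 * p, lam'.2) := by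
    rw [hlam, sub_smul_varpi1]; push_cast; rfl
  rw [w1, w2] at hμ
  have hl0 : lam - A • varpi2 = (lam'.1 - 2 * p, lam'.2 - A) := by
    rw [hlam', sub_smul_varpi2]
  obtain ⟨hAn, hh⟩ := hU.hull
  have hid := hU.ph_n1_eq
  rw [← hAZ] at hAn hh hid
  rw [← hμ, ← hl0] at hh hid
  have hm0 := hU.mem.nonneg.1
  have hdom : Dominant (lam - A • varpi2) := by
    rw [hl0]; exact ⟨hm0, by simp only; omega⟩
  have hN := NInf_eq hdom hh
  have hD : (DInf μ lam A : ℤ) = min (A : ℤ) (stairLength (lam - A • varpi2) μ) := by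
    rw [DInf, Nat.cast_min, DHatInf_eq hdom hh]
  refine ⟨fun hμ0 => ?_, ?_⟩
  · have hw0 : U.wt1 (lam'.1 - 2 * p) ≤ 0 := by rw [hμ] at hμ0; exact hμ0
    have hAn : U.atomicNeg (lam'.1 - 2 * p) lam'.2 = A := by
      rw [hAZ, Str.atomic, if_pos hw0]
    have h2 := hU.ph_n2_neg
    have h12 := hU.ph12_neg hw0
    rw [hAn, ← hμ, ← hl0] at h2 h12
    rw [phiHat_eq_reach hdom hh, phiHat_eq_reach hdom hh, phi_element h, phi12_element h,
      Str.ph_reverse_n2, p2, p12, h2, h12, hN, hD]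
    exact ⟨rfl, rfl⟩
  · have hT := twistedLength_top hdom hh
    rw [arrowCount_a1 hh, ← lengthOne_eq] at hT
    have hph := phi_element h .n1
    rw [p1] at hph
    -- Doubled to stay in ℤ. Of ⟨2pϖ₁, ρ^∨⟩ = 3p, the term -2p of the statistic absorbs 2p and the
    -- shift of φ₁ under Φᵖ the remaining p.
    have key : 2 * (-((twistedLength ⊤ μ (lam - A • varpi2) : ℤ) - NInf μ (lam - A • varpi2) +
        DInf μ lam A + A + 2 * p)) + (3 * lam'.1 + 4 * lam'.2) =
        -(3 * μ.1 + 4 * μ.2) + 2 * phi .n1 (element lam' s) - 2 * lengthOne μ := by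
      rw [hT, hN, hD, hph]
      have e1 : U.wt1 (lam'.1 - 2 * p) = μ.1 := by rw [hμ]
      have e2 : U.wt2 lam'.2 = μ.2 := by rw [hμ]
      dsimp only at hid
      rw [e1, e2] at hid
      linarith
    have hw' : wt (element lam' s) = μ := by rw [wt_element h, w1, w2, hμ]
    have hpw : preatomWeight lam' (element lam' s) = lam := by rw [hw, hlam']
    rw [rInf, rPar, sigmaInf, hw', hpw, ← hA, ← hp, rhoPair, rhoPair]
    have keyQ := congrArg (Int.cast : ℤ → ℚ) key
    push_cast at keyQ ⊢
    linarith

end SpFour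

/-- `lam'` is the highest weight of the crystal, `p` the preatomic number of `T`, `lam` the
highest weight of the preatom of `T`, and `A` the atomic number of `T`. -/
theorem mainTheorem8 (lam' : SpFour.Weight) (T : SpFour.Word) (hT : T ∈ SpFour.crystal lam')
    (p A : ℕ) (lam μ : SpFour.Weight)
    (hp : p = SpFour.pat lam' T) (hlam : lam = lam' - (2 * p) • SpFour.varpi1)
    (hA : A = SpFour.atomicNumber lam' T) (hμ : μ = SpFour.wt T) :
    (μ.1 ≤ 0 →
      (SpFour.phi .n2 T : ℤ) = SpFour.phiHat .a2 μ (lam - A • SpFour.varpi2) ∧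
      (SpFour.phi12 T : ℤ) = SpFour.phiHat .a12 μ (lam - A • SpFour.varpi2)
        - SpFour.NInf μ (lam - A • SpFour.varpi2) + SpFour.DInf μ lam A) ∧
    SpFour.rInf lam' T = SpFour.rPar T := by
  obtain ⟨s, hs, rfl⟩ := SpFour.mem_crystal_iff.1 hT
  exact SpFour.recharge_element hs p A lam μ hp hlam hA hμ
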